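/- Let $\nu$ be a prime $p$ or $\infty$, let $\mathbb{Q}_\nu$ be $\mathbb{Q}_p$ or $\mathbb{R}$ respectively, with its standard absolute value, and equip $\mathbb{Q}_\nu^m$ with the supremum norm; $B(x,r)$ denotes an open ball. **Definitions.** Let $\mu$ be a Borel measure on $\mathbb{Q}_\nu^m$ and $W\subset\mathbb{Q}_\nu^m$ open. * $\mu$ is *$D$-Federer on $W$* if $\sup \mu(B(x,3r))/\mu(B(x,r))<D$, the supremum being over $x\in\operatorname{supp}\mu$, $r>0$ with $B(x,3r)\subset W$. * A function $g:\mathbb{Q}_\nu^m\to\mathbb{Q}_\nu$ is *$(C,\alpha)$-good on $W$ with respect to $\mu$* if $\mu(\{x\in B:|g(x)|<\varepsilon\})\le C\,(\varepsilon/\sup_{B\cap\operatorname{supp}\mu}|g|)^\alpha\mu(B)$ for every open ball $B\subset W$ centred in $\operatorname{supp}\mu$ and every $\varepsilon>0$ (no condition if the supremum is $0$); it is *absolutely $(C,\alpha)$-good* if the same holds with $\sup_B|g|$ in place of $\sup_{B\cap\operatorname{supp}\mu}|g|$. * $\mu$ is *(absolutely) $(C,\alpha)$-decaying on $W$* if all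 affine maps $\mathbb{Q}_\nu^m\to\mathbb{Q}_\nu$ are (absolutely) $(C,\alpha)$-good on $W$ with respect to $\mu$. * $\mu$ is *Federer* (resp. *absolutely decaying*) if $\mu$-a.e. point has a neighbourhood on which $\mu$ is $D$-Federer for some $D>0$ (resp. absolutely $(C,\alpha)$-decaying for some $C,\alpha>0$). * $\mu$ is *friendly* if it is locally finite, gives measure $0$ to every affine hyperplane, and $\mu$-a.e. point has a neighbourhood on which $\mu$ is $D$-Federer and $(C,\alpha)$-decaying for some $C,\alpha,D>0$. * For $\nu=\infty$, $C^k$ has the usual meaning. For $\nu=p$, a map $f$ on an open set $U\subset\mathbb{Q}_p^d$ is $C^k$ if each point of $U$ has a neighbourhood $V_1\times\dots\times V_d\subset U$, with $V_i\subset\mathbb{Q}_p$ open, on which for every multi-index $\beta$ with $|\beta|\le k$ the iterated difference quotient $\Phi_\beta f=\Phi_1^{\beta_1}\circ\dots\circ\Phi_d^{\beta_d}f$ extends to a continuous function on $V_1^{\beta_1+1}\times\dots\times V_d^{\beta_d+1}$; here $\Phi_i^k$ is the $k$-th order difference quotient in the $i$-th variable, given in one variable by $\Phi^0g=g$ and $\Phi^{k}g(x_1,\dots,x_{k+1})=\frac{\Phi^{k-1}g(x_1,x_3,\dots,x_{k+1})-\Phi^{k-1}g(x_2,x_3,\dots,x_{k+1})}{x_1-x_2}$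 at tuples of distinct points. * $f:U\to\mathbb{Q}_\nu^n$ is *nonsingular* at $x$ if its Jacobian matrix at $x$ has rank $d$, and *$l$-nondegenerate* at $x$ if the partial derivatives of $f$ at $x$ of orders $1,\dots,l$ span $\mathbb{Q}_\nu^n$. **Theorem.** Let $U\subset\mathbb{Q}_\nu^d$ be open and let $\mu$ be a locally finite Borel measure on $U$ that is absolutely decaying and Federer. Let $f:U\to\mathbb{Q}_\nu^n$ be a $C^{l+1}$ map that is nonsingular and $l$-nondegenerate at $\mu$-a.e. point. Then: 1. $f_*\mu$ is friendly locally on the source: $\mu$-a.e. $x\in U$ has an open neighbourhood $V\subset U$ such that $f_*(\mu|_{V'})$ is friendly for every open $V'\subset V$. 2. Suppose that $f_*\mu$ is locally finite, and that for $\mu$-a.e. $x\in U$ and every neighbourhood $V$ of $x$ there is a neighbourhood $W$ of $f(x)$ with $f^{-1}(W)\subset V$ (as is the case, for instance, when $f$ is a homeomorphism onto its image). Then $f_*\mu$ is friendly. -/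

import Mathlib

open MeasureTheory Set Filter Topology
open scoped ENNReal

noncomputable section

/-! ## The fields `ℚ_ν` -/

/-- The index `ν`: either `∞` or a prime number. -/
inductive Place where
  | infinite : Place
  | prime (p : ℕ) (hp : p.Prime) : Place

/-- The field `ℚ_ν`: the reals for `ν = ∞`, the `p`-adic numbers for `ν = p`. -/
def Qv : Place → Type
  | .infinite => ℝ
  | .prime p hp => haveI : Fact p.Prime := ⟨hp⟩; ℚ_[p]

/-- `ℚ_ν` with its standard field structure and standard absolute value. -/
instance instNontriviallyNormedFieldQv : (ν : Place) → NontriviallyNormedField (Qv ν)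
  | .infinite => inferInstanceAs (NontriviallyNormedField ℝ)
  | .prime p hp =>
      haveI : Fact p.Prime := ⟨hp⟩
      inferInstanceAs (NontriviallyNormedField ℚ_[p])

/-- `ℚ_ν` carries its Borel `σ`-algebra; `ℚ_ν^d = (Fin d → Qv ν)` carries the product one (which
is its Borel `σ`-algebra, `ℚ_ν` being second countable) and the supremum norm. -/
instance instMeasurableSpaceQv (ν : Place) : MeasurableSpace (Qv ν) := borel (Qv ν)

instance instBorelSpaceQv (ν : Place) : BorelSpace (Qv ν) := ⟨rfl⟩

/-! ## Maps of class `C^k` -/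

section Calculus

variable {K E : Type*} [NontriviallyNormedField K] [NormedAddCommGroup E] [NormedSpace K E]

/-- The `k`-th order difference quotient `Φ^k g (x_1, …, x_{k+1})` of a function of one variable:
`Φ^0 g = g` and `Φ^{k+1} g (x_1, x_2, x_3, …)
  = (Φ^k g (x_1, x_3, …) - Φ^k g (x_2, x_3, …)) / (x_1 - x_2)`.
It is only used at tuples of pairwise distinct points. -/
def diffQuotOne (g : K → E) : (k : ℕ) → (Fin (k + 1) → K) → E
  | 0, x => g (x 0)
  | k + 1, x => (x 0 - x 1)⁻¹ •
      (diffQuotOne g k (fun j => x (Fin.succAbove 1 j)) -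
        diffQuotOne g k (fun j => x (Fin.succAbove 0 j)))

/-- The difference quotient `Φ_β f = Φ_1^{β_1} ∘ ⋯ ∘ Φ_d^{β_d} f` of a function of `d` variables,
where `Φ_i^k` is the `k`-th order difference quotient in the `i`-th variable. Its argument
consists of `β_i + 1` points of `K` for each `i`. -/
def diffQuot : (d : ℕ) → ((Fin d → K) → E) → (β : Fin d → ℕ) →
    ((i : Fin d) → Fin (β i + 1) → K) → E
  | 0, f, _, _ => f Fin.elim0
  | d + 1, f, β, X =>
      diffQuotOne
        (fun t => diffQuot d (fun y => f (Fin.cons t y)) (fun i => β i.succ) (fun i => X i.succ))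
        (β 0) (X 0)

/-- `f` is `C^k` on the product `V_1 × ⋯ × V_d`: for each multi-index `β` with `|β| ≤ k` the
difference quotient `Φ_β f` extends to a continuous function on `V_1^{β_1+1} × ⋯ × V_d^{β_d+1}`. -/
def IsCkOnBox {d : ℕ} (k : ℕ) (f : (Fin d → K) → E) (V : Fin d → Set K) : Prop :=
  ∀ β : Fin d → ℕ, ∑ i, β i ≤ k →
    ∃ Φ : ((i : Fin d) → Fin (β i + 1) → K) → E,
      ContinuousOn Φ {X | ∀ i j, X i j ∈ V i} ∧
      ∀ X : (i : Fin d) → Fin (β i + 1) → K, (∀ i j, X i j ∈ V i) →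
        (∀ i, Function.Injective (X i)) → Φ X = diffQuot d f β X

/-- `f` is `C^k` (in the sense of difference quotients) on the open set `U`: each point of `U` has
a product neighbourhood contained in `U` on which `f` is `C^k`. -/
def IsCkDiffQuot {d : ℕ} (k : ℕ) (f : (Fin d → K) → E) (U : Set (Fin d → K)) : Prop :=
  ∀ x ∈ U, ∃ V : Fin d → Set K, (∀ i, IsOpen (V i) ∧ x i ∈ V i) ∧ Set.pi univ V ⊆ U ∧
    IsCkOnBox k f V

/-- The partial derivative `∂_i f`. -/
def pderivAt {d : ℕ} (i : Fin d) (f : (Fin d → K) → E) : (Fin d → K) → E :=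
  fun x => deriv (fun t => f (Function.update x i t)) (x i)

/-- The iterated partial derivative `∂_β f = ∂_1^{β_1} ∘ ⋯ ∘ ∂_d^{β_d} f`. -/
def pderivMulti {d : ℕ} (β : Fin d → ℕ) (f : (Fin d → K) → E) : (Fin d → K) → E :=
  (List.finRange d).foldr (fun i g => (pderivAt i)^[β i] g) f

/-- `f` is nonsingular at `x`: its Jacobian at `x` has rank `d`, that is, the `d` first order
partial derivatives of `f` at `x` are linearly independent. -/
def NonsingularAt {d : ℕ} (f : (Fin d → K) → E) (x : Fin d → K) : Prop :=
  LinearIndependent K (fun i => pderivAt i f x)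

/-- `f` is `l`-nondegenerate at `x`: the partial derivatives of `f` at `x` of orders `1, …, l`
span the target space. -/
def NondegenerateAt {d : ℕ} (l : ℕ) (f : (Fin d → K) → E) (x : Fin d → K) : Prop :=
  Submodule.span K {v : E | ∃ β : Fin d → ℕ, 1 ≤ ∑ i, β i ∧ ∑ i, β i ≤ l ∧
    v = pderivMulti β f x} = ⊤

end Calculus

/-- `C^k` maps from an open subset of `ℚ_ν^d` to `ℚ_ν^n`: the usual notion over `ℝ`, the one
through difference quotients over `ℚ_p`. -/
def IsCk : (ν : Place) → {d n : ℕ} → ℕ → ((Fin d → Qv ν) → (Fin n → Qv ν)) →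
    Set (Fin d → Qv ν) → Prop
  | .infinite, d, n, k, f, U =>
      ContDiffOn ℝ (k : ℕ∞) (E := Fin d → ℝ) (F := Fin n → ℝ) f U
  | .prime _ _, _, _, k, f, U => IsCkDiffQuot k f U

/-! ## Classes of measures -/

/-- `μ` is `D`-Federer on `U`: the supremum of `μ(B(x,3r)) / μ(B(x,r))`, over `x ∈ supp μ` and
`r > 0` with `B(x,3r) ⊆ U`, is less than `D`. -/
def FedererOn {X : Type*} [MetricSpace X] [MeasurableSpace X] (μ : Measure X) (D : ℝ)
    (U : Set X) : Prop :=
  ∃ D' : ℝ, D' < D ∧ ∀ x ∈ μ.support, ∀ r : ℝ, 0 < r → Metric.ball x (3 * r) ⊆ U →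
    μ (Metric.ball x (3 * r)) ≤ ENNReal.ofReal D' * μ (Metric.ball x r)

/-- `μ` is Federer: `μ`-almost every point has a neighbourhood on which `μ` is `D`-Federer for
some `D > 0`. -/
def IsFederer {X : Type*} [MetricSpace X] [MeasurableSpace X] (μ : Measure X) : Prop :=
  ∀ᵐ x ∂μ, ∃ W : Set X, IsOpen W ∧ x ∈ W ∧ ∃ D : ℝ, 0 < D ∧ FedererOn μ D W

section Decay

variable {K : Type*} [NontriviallyNormedField K] [MeasurableSpace K] {n : ℕ}

/-- `g` is `(C, α)`-good on `U` with respect to `μ`: for each open ball `B ⊆ U` centred in `supp μ`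
and each `ε > 0`, `μ {x ∈ B : |g x| < ε} ≤ C (ε / sup_{B ∩ supp μ} |g|)^α μ(B)`
(in `[0, ∞]`, so that there is no condition when the supremum is `0`). -/
def GoodOn (μ : Measure (Fin n → K)) (C α : ℝ) (g : (Fin n → K) → K)
    (U : Set (Fin n → K)) : Prop :=
  ∀ x ∈ μ.support, ∀ r : ℝ, 0 < r → Metric.ball x r ⊆ U → ∀ ε : ℝ, 0 < ε →
    μ {y | y ∈ Metric.ball x r ∧ ‖g y‖ < ε} ≤
      ENNReal.ofReal C *
        (ENNReal.ofReal ε / ⨆ y ∈ Metric.ball x r ∩ μ.support, ‖g y‖ₑ) ^ α *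
        μ (Metric.ball x r)

/-- `g` is absolutely `(C, α)`-good on `U` with respect to `μ`: the same with the supremum of `|g|`
taken over the whole ball `B`. -/
def AbsolutelyGoodOn (μ : Measure (Fin n → K)) (C α : ℝ) (g : (Fin n → K) → K)
    (U : Set (Fin n → K)) : Prop :=
  ∀ x ∈ μ.support, ∀ r : ℝ, 0 < r → Metric.ball x r ⊆ U → ∀ ε : ℝ, 0 < ε →
    μ {y | y ∈ Metric.ball x r ∧ ‖g y‖ < ε} ≤
      ENNReal.ofReal C *
        (ENNReal.ofReal ε / ⨆ y ∈ Metric.ball x r, ‖g y‖ₑ) ^ α *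
        μ (Metric.ball x r)

/-- `μ` is `(C, α)`-decaying on `U`: each affine map `K^n → K` is `(C, α)`-good on `U`. -/
def DecayingOn (μ : Measure (Fin n → K)) (C α : ℝ) (U : Set (Fin n → K)) : Prop :=
  ∀ (a : Fin n → K) (c : K), GoodOn μ C α (fun x => ∑ i, a i * x i + c) U

/-- `μ` is absolutely `(C, α)`-decaying on `U`: each affine map `K^n → K` is absolutely
`(C, α)`-good on `U`. -/
def AbsolutelyDecayingOn (μ : Measure (Fin n → K)) (C α : ℝ) (U : Set (Fin n → K)) : Prop :=
  ∀ (a : Fin n → K) (c : K), AbsolutelyGoodOn μ C α (fun x => ∑ i, a i * x i + c) U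

/-- `μ` is absolutely decaying: `μ`-almost every point has a neighbourhood on which `μ` is
absolutely `(C, α)`-decaying for some `C, α > 0`. -/
def IsAbsolutelyDecaying (μ : Measure (Fin n → K)) : Prop :=
  ∀ᵐ x ∂μ, ∃ W : Set (Fin n → K), IsOpen W ∧ x ∈ W ∧
    ∃ C α : ℝ, 0 < C ∧ 0 < α ∧ AbsolutelyDecayingOn μ C α W

/-- `μ` is nonplanar: affine hyperplanes have measure zero. -/
def IsNonplanar (μ : Measure (Fin n → K)) : Prop :=
  ∀ (a : Fin n → K) (c : K), a ≠ 0 → μ {x | ∑ i, a i * x i = c} = 0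

/-- Friendly measures on `K^n`. -/
def IsFriendly (μ : Measure (Fin n → K)) : Prop :=
  IsLocallyFiniteMeasure μ ∧ IsNonplanar μ ∧
    ∀ᵐ x ∂μ, ∃ W : Set (Fin n → K), IsOpen W ∧ x ∈ W ∧
      ∃ C α D : ℝ, 0 < C ∧ 0 < α ∧ 0 < D ∧ FedererOn μ D W ∧ DecayingOn μ C α W

end Decay

end

/-! The heart of the proof is a bound for the `μ`-measure of the set where an affine combination
`c·f + c₀` is small. Near a generic point `f` is bi-Lipschitz, so this bound and the Federer
property pass to the image.

Both notions of `C^{l+1}` enter only through one consequence: locally, at every base point `y`, `f`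
is a polynomial of degree `l` up to `M‖z - y‖^{l+1}`, with `M` uniform. Over `ℝ` this is Taylor's
formula with integral remainder; over `ℚ_p` it is Newton interpolation at nodes that collapse to
`y`. Comparing the polynomials at two base points shows that their coefficients satisfy Taylor
expansions of their own (`HasTaylorApprox.exists_hasTaylorJet`), hence are the partial derivatives.

Nondegeneracy at `p` gives, for each `c`, a derivative of `c·f` of order between `1` and `l` and of
size at least a constant times `‖c‖`, whatever `c₀` is. On a ball of small radius `r` the Taylor
error, of order `‖c‖ r^{l+1}`, is then negligible against the derivatives weighted by `r^{|β|}`, and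
this weighted jet is comparable to a single number `a` on the whole ball
(`exists_jetBound_affineJet`).

For a function `g` with such a jet, `{|g| < ε}` has relative measure at most `C(ε/a)^α`, by
induction on `l` (`jetsGood_succ`). Near a point where `|g| < a` some derivative of positive order
is large, so some `∂_i g` has a nondegenerate jet of order one less. Where `∂_i g` is small, the
induction hypothesis applies. Where it is not, `g` is almost affine on much smaller balls and decay
applies to the affine part. Decay must be absolute here, since a gradient bounds an affine map from
below on a full ball but not on its intersection with `supp μ`. The Federer property adds up the
estimates on small balls (`measure_inter_ball_le_of_local`).

In the image, balls pull back to sets squeezed between balls of comparable radii, and supremums over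
`supp ν` are bounded above by a multiple of `a`. Hyperplanes are null on letting `ε → 0`. -/

/-! ## Polynomials in several variables and Taylor jets -/

section Polynomials

/-- The multi-indices of order at most `m`. -/
def degIdx (d m : ℕ) : Finset (Fin d → ℕ) :=
  (Fintype.piFinset fun _ => Finset.range (m + 1)).filter (fun β => ∑ i, β i ≤ m)

theorem mem_degIdx {d m : ℕ} {β : Fin d → ℕ} : β ∈ degIdx d m ↔ ∑ i, β i ≤ m := by
  simp only [degIdx, Finset.mem_filter, Fintype.mem_piFinset, Finset.mem_range,
    and_iff_right_iff_imp]
  intro h i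
  have := Finset.single_le_sum (f := β) (fun _ _ => Nat.zero_le _) (Finset.mem_univ i)
  omega

theorem zero_mem_degIdx {d m : ℕ} : (0 : Fin d → ℕ) ∈ degIdx d m := by
  simp [mem_degIdx]

variable {K : Type*} [NontriviallyNormedField K] {d : ℕ}

/-- The divided monomial `h^γ / γ!`. -/
noncomputable def divMon (γ : Fin d → ℕ) (h : Fin d → K) : K :=
  ∏ i, h i ^ γ i / ((γ i).factorial : K)

/-- The polynomial `∑_{|γ| ≤ m} c_γ h^γ / γ!`. -/
noncomputable def taylorPoly (c : (Fin d → ℕ) → K) (m : ℕ) (h : Fin d → K) : K :=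
  ∑ γ ∈ degIdx d m, c γ * divMon γ h

@[simp]
theorem divMon_zero_left (h : Fin d → K) : divMon 0 h = 1 := by simp [divMon]

theorem divMon_zero_right {γ : Fin d → ℕ} (hγ : γ ≠ 0) : divMon γ (0 : Fin d → K) = 0 := by
  obtain ⟨i, hi⟩ := Function.ne_iff.1 hγ
  refine Finset.prod_eq_zero (Finset.mem_univ i) ?_
  simp only [Pi.zero_apply] at hi ⊢
  simp [zero_pow hi]

theorem divMon_single (i : Fin d) (h : Fin d → K) : divMon (Pi.single i 1) h = h i := by
  rw [divMon, Finset.prod_eq_single i]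
  · simp
  · intro j _ hj
    simp [Pi.single_eq_of_ne hj]
  · simp

theorem taylorPoly_zero_right (c : (Fin d → ℕ) → K) (m : ℕ) : taylorPoly c m 0 = c 0 := by
  rw [taylorPoly, Finset.sum_eq_single 0]
  · simp
  · intro γ _ hγ
    simp [divMon_zero_right hγ]
  · simp [zero_mem_degIdx]

/-- The constant cannot be taken to be `1`: over `ℚ_p` dividing by a factorial may enlarge the norm.
-/
theorem exists_norm_divMon_le (K : Type*) [NontriviallyNormedField K] (d m : ℕ) :
    ∃ F : ℝ, 1 ≤ F ∧ ∀ γ ∈ degIdx d m, ∀ h : Fin d → K,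
    ‖divMon γ h‖ ≤ F * ‖h‖ ^ (∑ i, γ i) := by
  refine ⟨1 + ∑ γ ∈ degIdx d m, ∏ i, ‖((γ i).factorial : K)‖⁻¹, ?_, ?_⟩
  · have : 0 ≤ ∑ γ ∈ degIdx d m, ∏ i, ‖((γ i).factorial : K)‖⁻¹ := by positivity
    linarith
  · intro γ hγ h
    have h1 : ‖divMon γ h‖ ≤ (∏ i, ‖((γ i).factorial : K)‖⁻¹) * ‖h‖ ^ (∑ i, γ i) := by
      rw [divMon, norm_prod, ← Finset.prod_pow_eq_pow_sum, ← Finset.prod_mul_distrib]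
      refine Finset.prod_le_prod (fun _ _ => norm_nonneg _) fun i _ => ?_
      rw [norm_div, norm_pow, div_eq_inv_mul]
      gcongr
      exact norm_le_pi_norm h i
    have h2 : ∏ i, ‖((γ i).factorial : K)‖⁻¹ ≤
        ∑ γ ∈ degIdx d m, ∏ i, ‖((γ i).factorial : K)‖⁻¹ :=
      Finset.single_le_sum (f := fun γ : Fin d → ℕ => ∏ i, ‖((γ i).factorial : K)‖⁻¹)
        (fun _ _ => by positivity) hγ
    refine h1.trans ?_
    gcongr
    linarith

theorem divMon_smul (γ : Fin d → ℕ) (a : K) (h : Fin d → K) :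
    divMon γ (a • h) = a ^ (∑ i, γ i) * divMon γ h := by
  rw [divMon, divMon, ← Finset.prod_pow_eq_pow_sum, ← Finset.prod_mul_distrib]
  refine Finset.prod_congr rfl fun i _ => ?_
  simp [mul_pow, mul_div_assoc]

theorem pow_add_div_factorial [CharZero K] (a b : K) (n : ℕ) :
    (a + b) ^ n / (n.factorial : K) = ∑ j ∈ Finset.range (n + 1),
      (b ^ j / (j.factorial : K)) * (a ^ (n - j) / ((n - j).factorial : K)) := by
  rw [add_comm a b, add_pow, Finset.sum_div]
  refine Finset.sum_congr rfl fun j hj => ?_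
  have hj : j ≤ n := by simpa [Nat.lt_succ_iff] using hj
  rw [Nat.cast_choose K hj]
  have h1 : (j.factorial : K) ≠ 0 := by exact_mod_cast j.factorial_ne_zero
  have h2 : ((n - j).factorial : K) ≠ 0 := by exact_mod_cast (n - j).factorial_ne_zero
  have h3 : (n.factorial : K) ≠ 0 := by exact_mod_cast n.factorial_ne_zero
  field_simp

theorem divMon_add [CharZero K] (γ : Fin d → ℕ) (h k : Fin d → K) :
    divMon γ (h + k) = ∑ β ∈ Fintype.piFinset fun i => Finset.range (γ i + 1),
      divMon β k * divMon (γ - β) h := by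
  simp only [divMon, Pi.add_apply, pow_add_div_factorial, Finset.prod_univ_sum, Pi.sub_apply,
    Finset.prod_mul_distrib]

/-- Re-expansion at a shifted centre: the new coefficients are the derivatives of the polynomial
there. It lets polynomials attached to different base points be compared coefficient by coefficient.
-/
theorem taylorPoly_add [CharZero K] (c : (Fin d → ℕ) → K) (m : ℕ) (h k : Fin d → K) :
    taylorPoly c m (h + k) =
      taylorPoly (fun β => taylorPoly (fun δ => c (β + δ)) (m - ∑ i, β i) h) m k := by
  simp only [taylorPoly, divMon_add, Finset.mul_sum, Finset.sum_mul]
  rw [Finset.sum_sigma', Finset.sum_sigma']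
  refine Finset.sum_nbij' (fun x => ⟨x.2, x.1 - x.2⟩) (fun x => ⟨x.1 + x.2, x.1⟩) ?_ ?_ ?_ ?_ ?_
  · rintro ⟨γ, β⟩ hx
    simp only [Finset.mem_sigma, mem_degIdx, Fintype.mem_piFinset, Finset.mem_range,
      Pi.sub_apply] at hx ⊢
    have h1 : ∑ i, (γ i - β i) + ∑ i, β i = ∑ i, γ i := by
      rw [← Finset.sum_add_distrib]
      exact Finset.sum_congr rfl fun i _ => by have := hx.2 i; omega
    omega
  · rintro ⟨β, δ⟩ hx
    simp only [Finset.mem_sigma, mem_degIdx, Fintype.mem_piFinset, Finset.mem_range,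
      Pi.add_apply, Finset.sum_add_distrib] at hx ⊢
    exact ⟨by omega, fun i => by omega⟩
  · rintro ⟨γ, β⟩ hx
    simp only [Finset.mem_sigma, Fintype.mem_piFinset, Finset.mem_range] at hx
    have : β + (γ - β) = γ := by
      ext i
      have := hx.2 i
      simp only [Pi.add_apply, Pi.sub_apply]
      omega
    simp [this]
  · rintro ⟨β, δ⟩ hx
    simp
  · rintro ⟨γ, β⟩ hx
    simp only [Finset.mem_sigma, Fintype.mem_piFinset, Finset.mem_range] at hx
    have : β + (γ - β) = γ := by
      ext i
      have := hx.2 i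
      simp only [Pi.add_apply, Pi.sub_apply]
      omega
    simp only [this]
    ring

theorem taylorPoly_sub (c c' : (Fin d → ℕ) → K) (m : ℕ) (h : Fin d → K) :
    taylorPoly c m h - taylorPoly c' m h = taylorPoly (c - c') m h := by
  simp [taylorPoly, ← Finset.sum_sub_distrib, sub_mul]

/-- A polynomial which vanishes on the unit ball has zero coefficients. -/
theorem eq_zero_of_taylorPoly_eq_zero [CharZero K] (c : (Fin d → ℕ) → K) (m : ℕ)
    (hc : ∀ h : Fin d → K, ‖h‖ ≤ 1 → taylorPoly c m h = 0) :
    ∀ β ∈ degIdx d m, c β = 0 := by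
  classical
  let e : (Fin d → ℕ) → (Fin d →₀ ℕ) := fun β => Finsupp.equivFunOnFinite.symm β
  have he : Function.Injective e := Finsupp.equivFunOnFinite.symm.injective
  let P : MvPolynomial (Fin d) K :=
    ∑ γ ∈ degIdx d m, MvPolynomial.monomial (e γ) (c γ * ∏ i, ((γ i).factorial : K)⁻¹)
  have hP : P = 0 := by
    refine MvPolynomial.funext_set (fun _ => Metric.closedBall (0 : K) 1) (fun _ => ?_) ?_
    · exact infinite_of_mem_nhds (0 : K) (Metric.closedBall_mem_nhds _ one_pos)
    · intro x hx
      have hx1 : ‖x‖ ≤ 1 := by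
        rw [pi_norm_le_iff_of_nonneg zero_le_one]
        intro i
        simpa using hx i (mem_univ _)
      rw [map_zero, ← hc x hx1, taylorPoly, map_sum]
      refine Finset.sum_congr rfl fun γ _ => ?_
      rw [MvPolynomial.eval_monomial, divMon, mul_assoc, Finsupp.prod_fintype _ _ (by simp),
        ← Finset.prod_mul_distrib]
      simp [e, div_eq_inv_mul]
  intro β hβ
  have h1 := congrArg (MvPolynomial.coeff (e β)) hP
  simp only [P, MvPolynomial.coeff_sum, MvPolynomial.coeff_monomial, he.eq_iff,
    MvPolynomial.coeff_zero, Finset.sum_ite_eq', hβ, if_true] at h1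
  rcases mul_eq_zero.1 h1 with h2 | h2
  · exact h2
  · obtain ⟨i, -, hi⟩ := Finset.prod_eq_zero_iff.1 h2
    simp [Nat.factorial_ne_zero] at hi

theorem continuous_divMon (γ : Fin d → ℕ) : Continuous (divMon γ : (Fin d → K) → K) := by
  unfold divMon
  fun_prop

/-- The coefficients form a finite-dimensional space that embeds linearly in the continuous
functions on the unit ball, and an injective linear map on such a space is bounded below. -/
theorem exists_coeff_bound_unit (K : Type*) [NontriviallyNormedField K] [CharZero K]
    [ProperSpace K] (d m : ℕ) :
    ∃ C : ℝ, 0 < C ∧ ∀ (c : (Fin d → ℕ) → K) (A : ℝ),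
      (∀ h : Fin d → K, ‖h‖ ≤ 1 → ‖taylorPoly c m h‖ ≤ A) → ∀ β ∈ degIdx d m, ‖c β‖ ≤ C * A := by
  let B := Metric.closedBall (0 : Fin d → K) 1
  have : CompactSpace B := isCompact_iff_compactSpace.1 (isCompact_closedBall _ _)
  let φ : (degIdx d m → K) →ₗ[K] C(B, K) :=
    { toFun := fun c => ⟨fun h => ∑ γ : degIdx d m, c γ * divMon γ.1 h.1, by
        refine continuous_finsetSum _ fun γ _ => ?_
        exact continuous_const.mul ((continuous_divMon _).comp continuous_subtype_val)⟩
      map_add' := fun c c' => by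
        ext h
        simp [add_mul, Finset.sum_add_distrib]
      map_smul' := fun a c => by
        ext h
        simp [Finset.mul_sum, mul_assoc] }
  have key : ∀ (c : (Fin d → ℕ) → K) (h : B),
      φ (fun γ => c γ.1) h = taylorPoly c m h.1 := by
    intro c h
    simp only [φ, LinearMap.coe_mk, AddHom.coe_mk, ContinuousMap.coe_mk, taylorPoly]
    exact Finset.sum_coe_sort (degIdx d m) (fun γ => c γ * divMon γ h.1)
  have hinj : LinearMap.ker φ = ⊥ := by
    rw [LinearMap.ker_eq_bot']
    intro c hc
    classical
    let c' : (Fin d → ℕ) → K := fun γ => if h : γ ∈ degIdx d m then c ⟨γ, h⟩ else 0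
    have hcc : (fun γ : degIdx d m => c' γ.1) = c := by
      ext γ
      simp [c']
    ext γ
    rw [← hcc]
    refine eq_zero_of_taylorPoly_eq_zero c' m (fun h hh => ?_) γ.1 γ.2
    rw [← key c' ⟨h, by simpa [B] using hh⟩, hcc, hc]
    rfl
  obtain ⟨C, hC, hφ⟩ := φ.exists_antilipschitzWith hinj
  refine ⟨C, hC, fun c A hA β hβ => ?_⟩
  have h1 := hφ.le_mul_dist (fun γ : degIdx d m => c γ.1) 0
  rw [dist_zero_right, map_zero, dist_zero_right] at h1
  have hA0 : 0 ≤ A := (norm_nonneg _).trans (hA 0 (by simp))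
  calc ‖c β‖ ≤ ‖fun γ : degIdx d m => c γ.1‖ :=
        norm_le_pi_norm (fun γ : degIdx d m => c γ.1) ⟨β, hβ⟩
    _ ≤ C * ‖φ fun γ : degIdx d m => c γ.1‖ := h1
    _ ≤ C * A := by
        gcongr
        rw [ContinuousMap.norm_le _ hA0]
        intro h
        rw [key]
        exact hA _ (mem_closedBall_zero_iff.1 h.2)

/-- A field element of norm in a given shell. -/
theorem exists_norm_shell (K : Type*) [NontriviallyNormedField K] :
    ∃ κ : ℝ, 1 < κ ∧ ∀ t : ℝ, 0 < t → ∃ a : K, a ≠ 0 ∧ ‖a‖ < t ∧ t ≤ κ * ‖a‖ := by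
  obtain ⟨c, hc⟩ := NormedField.exists_one_lt_norm K
  refine ⟨‖c‖, hc, fun t ht => ?_⟩
  obtain ⟨n, hn, h1, h2, -⟩ := rescale_to_shell hc ht (x := (1 : K)) one_ne_zero
  rw [smul_eq_mul, mul_one] at h1 h2
  refine ⟨n, hn, h1, ?_⟩
  · rw [div_le_iff₀ (by linarith)] at h2
    rwa [mul_comm]

/-- Bounds for the coefficients of a polynomial in terms of its supremum on a ball. -/
theorem exists_coeff_bound (K : Type*) [NontriviallyNormedField K] [CharZero K]
    [ProperSpace K] (d m : ℕ) :
    ∃ C : ℝ, 0 < C ∧ ∀ (c : (Fin d → ℕ) → K) (A t : ℝ), 0 < t →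
      (∀ h : Fin d → K, ‖h‖ ≤ t → ‖taylorPoly c m h‖ ≤ A) →
      ∀ β ∈ degIdx d m, ‖c β‖ * t ^ (∑ i, β i) ≤ C * A := by
  obtain ⟨C, hC, h⟩ := exists_coeff_bound_unit K d m
  obtain ⟨κ, hκ, hs⟩ := exists_norm_shell K
  refine ⟨κ ^ m * C, by positivity, fun c A t ht hA β hβ => ?_⟩
  -- The norm may take discrete values, so `t` is replaced by some `‖a‖` within a factor `κ`; this
  -- costs `κ ^ m`.
  obtain ⟨a, ha, h1, h2⟩ := hs t ht
  have h3 := h (fun γ => c γ * a ^ (∑ i, γ i)) A (fun k hk => by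
    have : taylorPoly (fun γ => c γ * a ^ (∑ i, γ i)) m k = taylorPoly c m (a • k) := by
      simp only [taylorPoly, divMon_smul, mul_assoc]
    rw [this]
    refine hA _ ?_
    rw [norm_smul]
    calc ‖a‖ * ‖k‖ ≤ t * 1 := by gcongr
      _ = t := mul_one t) β hβ
  rw [norm_mul, norm_pow] at h3
  have hA0 : 0 ≤ A := (norm_nonneg _).trans (hA 0 (by simpa using ht.le))
  calc ‖c β‖ * t ^ (∑ i, β i) ≤ ‖c β‖ * (κ * ‖a‖) ^ (∑ i, β i) := by gcongr
    _ = κ ^ (∑ i, β i) * (‖c β‖ * ‖a‖ ^ (∑ i, β i)) := by ring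
    _ ≤ κ ^ m * (C * A) := by
        gcongr
        · exact hκ.le
        · exact mem_degIdx.1 hβ
    _ = κ ^ m * C * A := by ring

/-- `g` is approximated by polynomials of degree `l`, uniformly on `S`. -/
def HasTaylorApprox (l : ℕ) (g : (Fin d → K) → K) (S : Set (Fin d → K)) (M : ℝ) : Prop :=
  ∃ c : (Fin d → K) → (Fin d → ℕ) → K, ∀ y ∈ S, ∀ z ∈ S,
    ‖g z - taylorPoly (c y) l (z - y)‖ ≤ M * ‖z - y‖ ^ (l + 1)

/-- The functions `D β`, `|β| ≤ l`, satisfy the Taylor expansions of the partial derivatives of a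
function of class `C^{l+1}`, uniformly on `S`. -/
def HasTaylorJet (l : ℕ) (D : (Fin d → ℕ) → (Fin d → K) → K) (S : Set (Fin d → K))
    (M : ℝ) : Prop :=
  ∀ β, ∑ i, β i ≤ l → ∀ y ∈ S, ∀ z ∈ S,
    ‖D β z - taylorPoly (fun γ => D (β + γ) y) (l - ∑ i, β i) (z - y)‖ ≤
      M * ‖z - y‖ ^ (l + 1 - ∑ i, β i)

/-- The jet consists of the coefficients of the approximating polynomials. Those at `y` and `z`
approximate the same function, so they differ by `O(t ^ (l + 1))` on a ball of radius `t = ‖z - y‖`;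
the coefficient of order `|β|` of the difference is then `O(t ^ (l + 1 - |β|))`. -/
theorem HasTaylorApprox.exists_hasTaylorJet [CharZero K] [ProperSpace K] {l : ℕ}
    {g : (Fin d → K) → K} {p : Fin d → K} {R M : ℝ} (hM : 0 ≤ M)
    (hg : HasTaylorApprox l g (Metric.ball p R) M) :
    ∃ D M', 0 ≤ M' ∧ HasTaylorJet l D (Metric.ball p (R / 3)) M' ∧
      ∀ y ∈ Metric.ball p (R / 3), D 0 y = g y := by
  obtain ⟨c, hc⟩ := hg
  obtain ⟨C, hC, hcoef⟩ := exists_coeff_bound K d l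
  refine ⟨fun β y => c y β, C * (M * (1 + 2 ^ (l + 1))), by positivity, ?_, ?_⟩
  · intro β hβ y hy z hz
    rcases eq_or_ne z y with rfl | hne
    · simp only [sub_self, taylorPoly_zero_right, add_zero, norm_zero]
      positivity
    set t := ‖z - y‖ with ht
    have ht0 : 0 < t := norm_pos_iff.2 (sub_ne_zero.2 hne)
    rw [Metric.mem_ball, dist_eq_norm] at hy hz
    have hR : 0 < R := by have := norm_nonneg (y - p); linarith
    have htR : t ≤ 2 * R / 3 := by
      have : z - y = (z - p) - (y - p) := by abel
      rw [ht, this]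
      exact (norm_sub_le _ _).trans (by linarith)
    -- Both polynomials are expanded at `z` and tested at `‖k‖ ≤ t`, where `z + k` is within `t` of
    -- `z` and `2 * t` of `y`: hence `1 + 2 ^ (l + 1)`. The radius `R / 3` keeps `z + k` where both
    -- approximations hold.
    have key := hcoef (c z - fun β => taylorPoly (fun δ => c y (β + δ)) (l - ∑ i, β i) (z - y))
      (M * (1 + 2 ^ (l + 1)) * t ^ (l + 1)) t ht0 (fun k hk => by
        rw [← taylorPoly_sub, ← taylorPoly_add]
        have hw : z + k ∈ Metric.ball p R := by
          rw [Metric.mem_ball, dist_eq_norm]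
          calc ‖z + k - p‖ = ‖(z - p) + k‖ := by congr 1; abel
            _ ≤ ‖z - p‖ + ‖k‖ := norm_add_le _ _
            _ < R := by linarith
        have hsub : Metric.ball p (R / 3) ⊆ Metric.ball p R :=
          Metric.ball_subset_ball (by linarith)
        have h1 := hc z (hsub (by rwa [Metric.mem_ball, dist_eq_norm])) _ hw
        have h2 := hc y (hsub (by rwa [Metric.mem_ball, dist_eq_norm])) _ hw
        rw [add_sub_cancel_left] at h1
        have e : z + k - y = z - y + k := by abel
        rw [e] at h2
        have h3 : ‖z - y + k‖ ≤ 2 * t := (norm_add_le _ _).trans (by linarith)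
        calc _ = ‖(g (z + k) - taylorPoly (c y) l (z - y + k)) -
              (g (z + k) - taylorPoly (c z) l k)‖ := by congr 1; ring
          _ ≤ M * ‖z - y + k‖ ^ (l + 1) + M * ‖k‖ ^ (l + 1) := (norm_sub_le _ _).trans (by linarith)
          _ ≤ M * (2 * t) ^ (l + 1) + M * t ^ (l + 1) := by gcongr
          _ = _ := by ring) β (mem_degIdx.2 hβ)
    have e : t ^ (l + 1) = t ^ (l + 1 - ∑ i, β i) * t ^ (∑ i, β i) := by
      rw [← pow_add]
      congr 1
      omega
    rw [e] at key
    refine le_of_mul_le_mul_right (key.trans (le_of_eq ?_)) (pow_pos ht0 (∑ i, β i))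
    ring
  · intro y hy
    have hy' : y ∈ Metric.ball p R := by
      have h0 := hy
      rw [Metric.mem_ball] at hy ⊢
      have := dist_nonneg (x := y) (y := p)
      linarith
    have := hc y hy' y hy'
    simp only [sub_self, taylorPoly_zero_right, norm_zero, ne_eq, Nat.add_eq_zero_iff, one_ne_zero,
      and_false, not_false_eq_true, zero_pow, mul_zero, norm_le_zero_iff] at this
    exact (sub_eq_zero.1 this).symm

end Polynomials

/-! ### Jets consist of the iterated partial derivatives. -/

section Derivatives

variable {K : Type*} [NontriviallyNormedField K] {d : ℕ}

theorem sum_single_one (i : Fin d) : ∑ j, (Pi.single i 1 : Fin d → ℕ) j = 1 := by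
  simp

theorem sum_add_single (β : Fin d → ℕ) (i : Fin d) :
    ∑ j, (β + Pi.single i 1 : Fin d → ℕ) j = ∑ j, β j + 1 := by
  simp only [Pi.add_apply, Finset.sum_add_distrib, sum_single_one]

theorem exists_eq_add_single {β : Fin d → ℕ} (hβ : β ≠ 0) :
    ∃ i, ∃ β' : Fin d → ℕ, β = β' + Pi.single i 1 := by
  obtain ⟨i, hi⟩ := Function.ne_iff.1 hβ
  refine ⟨i, Function.update β i (β i - 1), ?_⟩
  ext j
  rcases eq_or_ne j i with rfl | hj
  · simp only [Pi.zero_apply] at hi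
    simp
    omega
  · simp [hj]

theorem eq_zero_of_sum_eq_zero {β : Fin d → ℕ} (hβ : ∑ i, β i = 0) : β = 0 := by
  ext i
  exact (Finset.sum_eq_zero_iff.1 hβ) i (Finset.mem_univ i)

theorem taylorPoly_eq_zero_add (c : (Fin d → ℕ) → K) (m : ℕ) (h : Fin d → K) :
    taylorPoly c m h = c 0 +
      ∑ γ ∈ (degIdx d m).filter (fun γ => 1 ≤ ∑ i, γ i), c γ * divMon γ h := by
  rw [taylorPoly, ← Finset.sum_filter_add_sum_filter_not _ (fun γ => 1 ≤ ∑ i, γ i), add_comm]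
  congr 1
  have : (degIdx d m).filter (fun γ => ¬ 1 ≤ ∑ i, γ i) = {0} := by
    ext γ
    simp only [Finset.mem_filter, mem_degIdx, Finset.mem_singleton]
    constructor
    · rintro ⟨-, h⟩
      exact eq_zero_of_sum_eq_zero (by omega)
    · rintro rfl
      simp
  rw [this]
  simp

theorem taylorPoly_eq_linear_add (c : (Fin d → ℕ) → K) {m : ℕ} (hm : 1 ≤ m) (h : Fin d → K) :
    taylorPoly c m h = c 0 + ∑ i, c (Pi.single i 1) * h i +
      ∑ γ ∈ (degIdx d m).filter (fun γ => 2 ≤ ∑ i, γ i), c γ * divMon γ h := by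
  rw [taylorPoly_eq_zero_add, add_assoc]
  congr 1
  rw [← Finset.sum_filter_add_sum_filter_not _ (fun γ : Fin d → ℕ => 2 ≤ ∑ i, γ i), add_comm]
  congr 1
  · symm
    refine Finset.sum_bij (fun i _ => Pi.single i 1) ?_ ?_ ?_ ?_
    · intro i _
      simp [mem_degIdx, hm]
    · intro i _ j _ hij
      by_contra hne
      have := congrFun hij i
      simp [hne] at this
    · intro γ hγ
      simp only [Finset.mem_filter, mem_degIdx] at hγ
      have h0 : γ ≠ 0 := by
        rintro rfl
        simp at hγ
      obtain ⟨i, β', rfl⟩ := exists_eq_add_single h0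
      rw [sum_add_single] at hγ
      have := eq_zero_of_sum_eq_zero (β := β') (by omega)
      exact ⟨i, Finset.mem_univ _, by simp [this]⟩
    · intro i _
      rw [divMon_single]
  · rw [Finset.filter_filter]
    refine Finset.sum_congr ?_ fun _ _ => rfl
    ext γ
    simp only [Finset.mem_filter]
    constructor
    · rintro ⟨h1, h2, h3⟩
      exact ⟨h1, h3⟩
    · rintro ⟨h1, h2⟩
      exact ⟨h1, by omega, h2⟩

theorem hasDerivAt_of_norm_le_sq {φ : K → K} {x a : K} {B : ℝ}
    (h : ∀ᶠ t in 𝓝 x, ‖φ t - φ x - (t - x) * a‖ ≤ B * ‖t - x‖ ^ 2) : HasDerivAt φ a x := by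
  rw [hasDerivAt_iff_isLittleO]
  have h1 : (fun t => φ t - φ x - (t - x) • a) =O[𝓝 x] fun t => (t - x) ^ 2 := by
    refine Asymptotics.IsBigO.of_bound B ?_
    filter_upwards [h] with t ht
    simpa using ht
  refine h1.trans_isLittleO ?_
  have h2 : (fun t : K => t ^ 2) =o[𝓝 0] fun t => t :=
    Asymptotics.isLittleO_pow_id (by norm_num)
  refine h2.comp_tendsto ?_
  have : Tendsto (fun t => t - x) (𝓝 x) (𝓝 (x - x)) := (continuous_id.sub continuous_const).tendsto x
  simpa using this

/-- For orders below `l` the Taylor error has exponent at least `2`, so beyond the linear term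
everything is quadratic in the increment. -/
theorem HasTaylorJet.hasDerivAt {l : ℕ} {D : (Fin d → ℕ) → (Fin d → K) → K}
    {S : Set (Fin d → K)} {M : ℝ} (hM : 0 ≤ M) (hD : HasTaylorJet l D S M) (hS : IsOpen S)
    {β : Fin d → ℕ} (hβ : ∑ i, β i + 1 ≤ l) {x : Fin d → K} (hx : x ∈ S) (i : Fin d) :
    HasDerivAt (fun t => D β (Function.update x i t)) (D (β + Pi.single i 1) x) (x i) := by
  obtain ⟨F, hF, hdiv⟩ := exists_norm_divMon_le K d l
  set m := l - ∑ i, β i with hm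
  have hm1 : 1 ≤ m := by omega
  set s := (degIdx d m).filter (fun γ => 2 ≤ ∑ i, γ i)
  refine hasDerivAt_of_norm_le_sq (B := (∑ γ ∈ s, ‖D (β + γ) x‖ * F) + M) ?_
  have hcont : Tendsto (fun t => Function.update x i t) (𝓝 (x i)) (𝓝 x) := by
    have : Continuous fun t => Function.update x i t := continuous_const.update i continuous_id
    simpa using this.tendsto (x i)
  filter_upwards [hcont (hS.mem_nhds hx), Metric.ball_mem_nhds (x i) one_pos] with t ht ht1
  have hdiff : Function.update x i t - x = Pi.single i (t - x i) := by
    ext j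
    rcases eq_or_ne j i with rfl | hj <;> simp [*]
  have hnorm : ‖Function.update x i t - x‖ = ‖t - x i‖ := by
    rw [hdiff, Pi.norm_single]
  have hle : ‖t - x i‖ ≤ 1 := by rw [← dist_eq_norm]; exact (Metric.mem_ball.1 ht1).le
  have key := hD β (by omega) x hx _ ht
  rw [taylorPoly_eq_linear_add _ hm1, hnorm, hdiff] at key
  have hlin : ∑ j, D (β + Pi.single j 1) x * (Pi.single i (t - x i) : Fin d → K) j =
      (t - x i) * D (β + Pi.single i 1) x := by
    rw [Finset.sum_eq_single i]
    · simp [mul_comm]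
    · intro j _ hj
      simp [hj]
    · simp
  rw [hlin] at key
  simp only [add_zero] at key
  have hrest : ‖∑ γ ∈ s, D (β + γ) x * divMon γ (Pi.single i (t - x i) : Fin d → K)‖ ≤
      (∑ γ ∈ s, ‖D (β + γ) x‖ * F) * ‖t - x i‖ ^ 2 := by
    rw [Finset.sum_mul]
    refine norm_sum_le_of_le _ fun γ hγ => ?_
    rw [Finset.mem_filter, mem_degIdx] at hγ
    rw [norm_mul, mul_assoc]
    gcongr
    refine (hdiv γ (mem_degIdx.2 (by omega)) _).trans ?_
    rw [Pi.norm_single]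
    gcongr ?_ * ?_
    exact pow_le_pow_of_le_one (norm_nonneg _) hle hγ.2
  have hpow : M * ‖t - x i‖ ^ (l + 1 - ∑ i, β i) ≤ M * ‖t - x i‖ ^ 2 := by
    gcongr ?_ * ?_
    exact pow_le_pow_of_le_one (norm_nonneg _) hle (by omega)
  simp only [Function.update_eq_self]
  calc _ = ‖(D β (Function.update x i t) - (D β x + (t - x i) * D (β + Pi.single i 1) x +
        ∑ γ ∈ s, D (β + γ) x * divMon γ (Pi.single i (t - x i) : Fin d → K))) +
        ∑ γ ∈ s, D (β + γ) x * divMon γ (Pi.single i (t - x i) : Fin d → K)‖ := by congr 1; ring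
    _ ≤ M * ‖t - x i‖ ^ 2 + (∑ γ ∈ s, ‖D (β + γ) x‖ * F) * ‖t - x i‖ ^ 2 :=
        (norm_add_le _ _).trans (add_le_add (key.trans hpow) hrest)
    _ = _ := by ring

variable {E : Type*} [NormedAddCommGroup E] [NormedSpace K E]

theorem pderivAt_iterate_eq {l : ℕ} {D : (Fin d → ℕ) → (Fin d → K) → E} {S : Set (Fin d → K)}
    (hS : IsOpen S)
    (hD : ∀ β : Fin d → ℕ, ∑ i, β i + 1 ≤ l → ∀ x ∈ S, ∀ i,
      HasDerivAt (fun t => D β (Function.update x i t)) (D (β + Pi.single i 1) x) (x i))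
    {g : (Fin d → K) → E} {β : Fin d → ℕ} (hg : ∀ x ∈ S, g x = D β x) (i : Fin d) (k : ℕ)
    (hk : ∑ i, β i + k ≤ l) :
    ∀ x ∈ S, (pderivAt i)^[k] g x = D (β + Pi.single i k) x := by
  induction k with
  | zero => simpa using hg
  | succ k ih =>
    intro x hx
    have ih := ih (by omega)
    rw [Function.iterate_succ_apply', pderivAt]
    have hcont : Tendsto (fun t => Function.update x i t) (𝓝 (x i)) (𝓝 x) := by
      have : Continuous fun t => Function.update x i t := continuous_const.update i continuous_id
      simpa using this.tendsto (x i)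
    have hev : (fun t => (pderivAt i)^[k] g (Function.update x i t)) =ᶠ[𝓝 (x i)]
        fun t => D (β + Pi.single i k) (Function.update x i t) := by
      filter_upwards [hcont (hS.mem_nhds hx)] with t ht
      exact ih _ ht
    have hd := hD (β + Pi.single i k) (by
      simp only [Pi.add_apply, Finset.sum_add_distrib, Finset.sum_pi_single', Finset.mem_univ,
        if_true]
      omega) x hx i
    rw [hev.deriv_eq, hd.deriv, add_assoc, ← Pi.single_add]

theorem pderivMulti_eq {l : ℕ} {D : (Fin d → ℕ) → (Fin d → K) → E} {S : Set (Fin d → K)}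
    (hS : IsOpen S)
    (hD : ∀ β : Fin d → ℕ, ∑ i, β i + 1 ≤ l → ∀ x ∈ S, ∀ i,
      HasDerivAt (fun t => D β (Function.update x i t)) (D (β + Pi.single i 1) x) (x i))
    {g : (Fin d → K) → E} (hg : ∀ x ∈ S, g x = D 0 x) {β : Fin d → ℕ} (hβ : ∑ i, β i ≤ l) :
    ∀ x ∈ S, pderivMulti β g x = D β x := by
  -- After the variables in `L` have been treated, the derivative reached is `β` restricted to `L`;
  -- the absence of repetitions lets each variable contribute its full exponent once.
  have main : ∀ L : List (Fin d), L.Nodup → ∀ x ∈ S,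
      L.foldr (fun i g => (pderivAt i)^[β i] g) g x = D (fun j => if j ∈ L then β j else 0) x := by
    intro L
    induction L with
    | nil =>
      intro _ x hx
      have e : (fun j => if j ∈ ([] : List (Fin d)) then β j else 0) = 0 := by
        ext j
        simp
      rw [e, List.foldr_nil, hg x hx]
    | cons i L ih =>
      intro hL x hx
      rw [List.nodup_cons] at hL
      rw [List.foldr_cons]
      have e : (fun j => if j ∈ i :: L then β j else 0) =
          (fun j => if j ∈ L then β j else 0) + Pi.single i (β i) := by
        ext j
        rcases eq_or_ne j i with rfl | hj
        · simp [hL.1]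
        · simp [hj]
      rw [e]
      refine pderivAt_iterate_eq hS hD (ih hL.2) i (β i) ?_ x hx
      have h1 : ∑ j, ((fun j => if j ∈ L then β j else 0) + Pi.single i (β i) : Fin d → ℕ) j ≤
          ∑ j, β j := by
        rw [← e]
        refine Finset.sum_le_sum fun j _ => ?_
        split_ifs <;> simp
      simp only [Pi.add_apply, Finset.sum_add_distrib, Finset.sum_pi_single', Finset.mem_univ,
        if_true] at h1
      exact h1.trans hβ
  intro x hx
  have := main (List.finRange d) (List.nodup_finRange d) x hx
  simpa [pderivMulti, List.mem_finRange] using this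

end Derivatives

/-! ### Difference quotients and polynomial interpolation in several variables. -/

section DifferenceQuotients

variable {K : Type*} [NontriviallyNormedField K] {d : ℕ}
  {E : Type*} [NormedAddCommGroup E] [NormedSpace K E]

theorem diffQuotOne_smul_sub (a : K) (g g' : K → E) (k : ℕ) (x : Fin (k + 1) → K) :
    diffQuotOne (fun t => a • (g t - g' t)) k x =
      a • (diffQuotOne g k x - diffQuotOne g' k x) := by
  induction k with
  | zero => rfl
  | succ k ih =>
    simp only [diffQuotOne]
    rw [ih, ih, ← smul_sub a, smul_comm _ a, ← smul_sub]
    congr 2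
    abel

theorem diffQuot_smul_sub (a : K) (f f' : (Fin d → K) → E) (β : Fin d → ℕ)
    (X : (i : Fin d) → Fin (β i + 1) → K) :
    diffQuot d (fun y => a • (f y - f' y)) β X =
      a • (diffQuot d f β X - diffQuot d f' β X) := by
  induction d with
  | zero => rfl
  | succ d ih =>
    simp only [diffQuot]
    rw [← diffQuotOne_smul_sub]
    congr 1
    ext t
    exact ih _ _ _ _

/-- Difference quotients in separate variables commute. This makes the Newton coefficients in the
first variable, as functions of the others, inherit bounds on their difference quotients. -/
theorem diffQuot_diffQuotOne (F : K → (Fin d → K) → E) (k : ℕ) (z : Fin (k + 1) → K)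
    (β : Fin d → ℕ) (X : (i : Fin d) → Fin (β i + 1) → K) :
    diffQuot d (fun y => diffQuotOne (fun t => F t y) k z) β X =
      diffQuotOne (fun t => diffQuot d (F t) β X) k z := by
  induction k with
  | zero => rfl
  | succ k ih => simp only [diffQuotOne, diffQuot_smul_sub, ih]

theorem diffQuot_zero_apply (f : (Fin d → K) → E) (X : (i : Fin d) → Fin (0 + 1) → K) :
    diffQuot d f (fun _ => 0) X = f (fun i => X i 0) := by
  induction d with
  | zero =>
    simp only [diffQuot]
    congr 1
    exact Subsingleton.elim _ _
  | succ d ih =>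
    simp only [diffQuot, diffQuotOne]
    rw [ih]
    congr 1
    ext i
    refine Fin.cases rfl (fun i => rfl) i

theorem diffQuotOne_apply_pi {ι : Type*} [Fintype ι] (g : K → ι → K) (k : ℕ)
    (x : Fin (k + 1) → K) (j : ι) :
    diffQuotOne (fun t => g t j) k x = diffQuotOne g k x j := by
  induction k with
  | zero => rfl
  | succ k ih => simp [diffQuotOne, ih]

theorem diffQuot_apply_pi {ι : Type*} [Fintype ι] (f : (Fin d → K) → ι → K) (β : Fin d → ℕ)
    (X : (i : Fin d) → Fin (β i + 1) → K) (j : ι) :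
    diffQuot d (fun y => f y j) β X = diffQuot d f β X j := by
  induction d with
  | zero => rfl
  | succ d ih =>
    simp only [diffQuot]
    rw [← diffQuotOne_apply_pi]
    congr 1
    ext t
    exact ih _ _ _

/-- The tuple `(x_{k-1}, …, x_0)`. -/
def revNodes (x : ℕ → K) : (k : ℕ) → Fin k → K
  | 0 => Fin.elim0
  | k + 1 => Fin.cons (x k) (revNodes x k)

omit [NontriviallyNormedField K] in
theorem revNodes_mem_range (x : ℕ → K) {k : ℕ} (i : Fin k) :
    ∃ j < k, revNodes x k i = x j := by
  induction k with
  | zero => exact i.elim0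
  | succ k ih =>
    refine Fin.cases ?_ (fun i => ?_) i
    · exact ⟨k, k.lt_succ_self, rfl⟩
    · obtain ⟨j, hj, h⟩ := ih i
      exact ⟨j, hj.trans k.lt_succ_self, h⟩

omit [NontriviallyNormedField K] in
theorem revNodes_injective {x : ℕ → K} (hx : Function.Injective x) (k : ℕ) :
    Function.Injective (revNodes x k) := by
  induction k with
  | zero => exact fun i => i.elim0
  | succ k ih =>
    rw [revNodes, Fin.cons_injective_iff]
    refine ⟨?_, ih⟩
    rintro ⟨i, hi⟩
    obtain ⟨j, hj, h⟩ := revNodes_mem_range x i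
    rw [h] at hi
    exact hj.ne (hx hi)

theorem diffQuotOne_cons_cons (g : K → E) (k : ℕ) (y a : K) (R : Fin k → K) (h : y ≠ a) :
    diffQuotOne g k (Fin.cons y R) = diffQuotOne g k (Fin.cons a R) +
      (y - a) • diffQuotOne g (k + 1) (Fin.cons y (Fin.cons a R)) := by
  have h1 : (fun j => (Fin.cons y (Fin.cons a R) : Fin (k + 2) → K) (Fin.succAbove 1 j)) =
      Fin.cons y R := by
    ext j
    refine Fin.cases rfl (fun j => ?_) j
    rw [← Fin.succ_zero_eq_one, Fin.succ_succAbove_succ]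
    simp
  have h0 : (fun j => (Fin.cons y (Fin.cons a R) : Fin (k + 2) → K) (Fin.succAbove 0 j)) =
      Fin.cons a R := by
    ext j
    simp
  simp only [diffQuotOne]
  rw [h1, h0]
  have : (Fin.cons y (Fin.cons a R) : Fin (k + 2) → K) 1 = a := rfl
  rw [this, Fin.cons_zero, smul_inv_smul₀ (sub_ne_zero.2 h)]
  abel

/-- Newton's interpolation formula with remainder. -/
theorem newton_interpolation (g : K → E) (x : ℕ → K) {y : K} (hy : ∀ j, y ≠ x j) (m : ℕ) :
    g y = ∑ j ∈ Finset.range m, (∏ i ∈ Finset.range j, (y - x i)) •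
        diffQuotOne g j (revNodes x (j + 1)) +
      (∏ i ∈ Finset.range m, (y - x i)) • diffQuotOne g m (Fin.cons y (revNodes x m)) := by
  induction m with
  | zero => simp [diffQuotOne]
  | succ m ih =>
    rw [Finset.sum_range_succ, Finset.prod_range_succ, mul_smul]
    conv_lhs => rw [ih]
    rw [diffQuotOne_cons_cons g m y (x m) (revNodes x m) (hy m), smul_add, ← add_assoc]
    rfl

/-- Polynomial functions of degree at most `m`. -/
def IsPolyFun (m : ℕ) (q : (Fin d → K) → K) : Prop :=
  ∃ P : MvPolynomial (Fin d) K, P.totalDegree ≤ m ∧ ∀ y, q y = MvPolynomial.eval y P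

theorem IsPolyFun.mono {m m' : ℕ} (h : m ≤ m') {q : (Fin d → K) → K} (hq : IsPolyFun m q) :
    IsPolyFun m' q := by
  obtain ⟨P, hP, hq⟩ := hq
  exact ⟨P, hP.trans h, hq⟩

theorem IsPolyFun.sum {ι : Type*} {s : Finset ι} {m : ℕ} {q : ι → (Fin d → K) → K}
    (hq : ∀ i ∈ s, IsPolyFun m (q i)) : IsPolyFun m fun y => ∑ i ∈ s, q i y := by
  classical
  induction s using Finset.induction_on with
  | empty => exact ⟨0, by simp, by simp⟩
  | insert i s hi ih =>
    obtain ⟨P, hP, h⟩ := ih fun j hj => hq j (Finset.mem_insert_of_mem hj)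
    obtain ⟨Q, hQ, h'⟩ := hq i (Finset.mem_insert_self _ _)
    refine ⟨Q + P, (MvPolynomial.totalDegree_add _ _).trans (max_le hQ hP), fun y => ?_⟩
    have hy := h y
    simp only at hy
    simp only [Finset.sum_insert hi, h', hy, map_add]

theorem IsPolyFun.mul {m m' : ℕ} {q q' : (Fin d → K) → K} (hq : IsPolyFun m q)
    (hq' : IsPolyFun m' q') : IsPolyFun (m + m') fun y => q y * q' y := by
  obtain ⟨P, hP, h⟩ := hq
  obtain ⟨Q, hQ, h'⟩ := hq'
  exact ⟨P * Q, (MvPolynomial.totalDegree_mul _ _).trans (add_le_add hP hQ), fun y => by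
    simp only [h, h', map_mul]⟩

theorem isPolyFun_const (a : K) : IsPolyFun 0 fun _ : Fin d → K => a :=
  ⟨MvPolynomial.C a, by simp, by simp⟩

theorem isPolyFun_prod_sub (x : ℕ → K) (i : Fin d) (j : ℕ) :
    IsPolyFun j fun y : Fin d → K => ∏ k ∈ Finset.range j, (y i - x k) := by
  induction j with
  | zero => simpa using isPolyFun_const (1 : K)
  | succ j ih =>
    simp only [Finset.prod_range_succ]
    refine ih.mul ⟨MvPolynomial.X i - MvPolynomial.C (x j), ?_, by simp⟩
    exact (MvPolynomial.totalDegree_sub _ _).trans (by simp)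

theorem IsPolyFun.comp_tail {m : ℕ} {q : (Fin d → K) → K} (hq : IsPolyFun m q) :
    IsPolyFun m fun y : Fin (d + 1) → K => q (Fin.tail y) := by
  obtain ⟨P, hP, h⟩ := hq
  refine ⟨MvPolynomial.rename Fin.succ P, (MvPolynomial.totalDegree_rename_le _ _).trans hP,
    fun y => ?_⟩
  simp only [h, MvPolynomial.eval_rename]
  rfl

theorem IsPolyFun.exists_taylorPoly [CharZero K] {m : ℕ} {q : (Fin d → K) → K}
    (hq : IsPolyFun m q) (x : Fin d → K) :
    ∃ c, ∀ y, q y = taylorPoly c m (y - x) := by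
  obtain ⟨P, hP, h⟩ := hq
  have h0 : ∃ c, ∀ y, q y = taylorPoly c m y := by
    let e : (Fin d → ℕ) → (Fin d →₀ ℕ) := fun β => Finsupp.equivFunOnFinite.symm β
    refine ⟨fun γ => MvPolynomial.coeff (e γ) P * ∏ i, ((γ i).factorial : K), fun y => ?_⟩
    rw [h, MvPolynomial.eval_eq', taylorPoly]
    have hterm : ∀ γ : Fin d → ℕ, MvPolynomial.coeff (e γ) P * (∏ i, ((γ i).factorial : K)) *
        divMon γ y = MvPolynomial.coeff (e γ) P * ∏ i, y i ^ γ i := by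
      intro γ
      rw [divMon, mul_assoc, ← Finset.prod_mul_distrib]
      congr 1
      refine Finset.prod_congr rfl fun i _ => ?_
      rw [mul_div_cancel₀]
      exact_mod_cast (γ i).factorial_ne_zero
    simp only [hterm]
    refine Finset.sum_of_injOn (fun s => (s : Fin d → ℕ)) DFunLike.coe_injective.injOn ?_ ?_ ?_
    · intro s hs
      rw [Finset.mem_coe, mem_degIdx]
      refine le_trans (le_of_eq ?_) ((MvPolynomial.le_totalDegree hs).trans hP)
      rw [Finsupp.sum_fintype _ _ (by simp)]
    · intro γ _ hγ
      have : e γ ∉ P.support := fun h => hγ ⟨e γ, h, rfl⟩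
      rw [MvPolynomial.notMem_support_iff.1 this, zero_mul]
    · intro s _
      congr 2
      ext i
      rfl
  obtain ⟨c, hc⟩ := h0
  refine ⟨fun β => taylorPoly (fun δ => c (β + δ)) (m - ∑ i, β i) x, fun y => ?_⟩
  rw [hc, ← taylorPoly_add, add_sub_cancel]

/-- Interpolation by polynomials at pairwise distinct nodes, in several variables. -/
theorem exists_interpolation (d : ℕ) : ∀ (l : ℕ) (F : (Fin d → K) → K) (V : Fin d → Set K) (M : ℝ)
    (x : Fin d → ℕ → K), 0 ≤ M →
    (∀ β : Fin d → ℕ, ∑ i, β i = l + 1 → ∀ X : (i : Fin d) → Fin (β i + 1) → K,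
      (∀ i j, X i j ∈ V i) → (∀ i, Function.Injective (X i)) → ‖diffQuot d F β X‖ ≤ M) →
    (∀ i, Function.Injective (x i)) → (∀ i j, x i j ∈ V i) →
    ∃ q, IsPolyFun l q ∧ ∀ y : Fin d → K, (∀ i, y i ∈ V i) → (∀ i j, y i ≠ x i j) →
      ∀ R : ℝ, 0 ≤ R → (∀ i j, ‖y i - x i j‖ ≤ R) →
        ‖F y - q y‖ ≤ ((l : ℝ) + 2) ^ d * M * R ^ (l + 1) := by
  induction d with
  | zero =>
    intro l F V M x hM _ _ _
    refine ⟨fun _ => F Fin.elim0, (isPolyFun_const _).mono (Nat.zero_le _), ?_⟩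
    intro y _ _ R hR _
    rw [Subsingleton.elim y Fin.elim0, sub_self, norm_zero]
    positivity
  | succ d ih =>
    intro l F V M x hM hF hinj hxV
    have hnode : ∀ k (i : Fin k), revNodes (x 0) k i ∈ V 0 := by
      intro k i
      obtain ⟨j, -, hj⟩ := revNodes_mem_range (x 0) i
      rw [hj]
      exact hxV 0 j
    -- `H j` is the `j`-th coefficient of Newton's formula in the first variable. It multiplies a
    -- product of `j` small factors, so interpolating it to degree `l - j` suffices.
    let H : ℕ → (Fin d → K) → K := fun j y' =>
      diffQuotOne (fun t => F (Fin.cons t y')) j (revNodes (x 0) (j + 1))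
    have hH : ∀ j ∈ Finset.range (l + 1), ∃ q, IsPolyFun (l - j) q ∧
        ∀ y : Fin d → K, (∀ i, y i ∈ V i.succ) → (∀ i j, y i ≠ x i.succ j) →
        ∀ R : ℝ, 0 ≤ R → (∀ i j, ‖y i - x i.succ j‖ ≤ R) →
        ‖H j y - q y‖ ≤ (((l - j : ℕ) : ℝ) + 2) ^ d * M * R ^ (l - j + 1) := by
      intro j hj
      have hj : j ≤ l := by simpa [Nat.lt_succ_iff] using hj
      refine ih (l - j) (H j) (fun i => V i.succ) M (fun i => x i.succ) hM ?_
        (fun i => hinj i.succ) (fun i => hxV i.succ)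
      intro β hβ X hX hXi
      -- Order `j` in the first variable and `l - j + 1` in the others make total order `l + 1`, so
      -- the bound `M` is inherited without loss.
      have h1 := hF (Fin.cons j β) (by rw [Fin.sum_cons, hβ]; omega)
        (Fin.cons (α := fun i => Fin ((Fin.cons j β : Fin (d + 1) → ℕ) i + 1) → K)
          (revNodes (x 0) (j + 1)) X) ?_ ?_
      · simp only [H, diffQuot_diffQuotOne]
        exact h1
      · intro i
        refine Fin.cases ?_ (fun i => ?_) i
        · exact hnode (j + 1)
        · exact hX i
      · intro i
        refine Fin.cases ?_ (fun i => ?_) i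
        · exact revNodes_injective (hinj 0) (j + 1)
        · exact hXi i
    choose! q hq hqH using hH
    refine ⟨fun y => ∑ j ∈ Finset.range (l + 1),
      (∏ i ∈ Finset.range j, (y 0 - x 0 i)) * q j (Fin.tail y), ?_, ?_⟩
    · refine IsPolyFun.sum fun j hj => ?_
      refine ((isPolyFun_prod_sub (x 0) 0 j).mul (hq j hj).comp_tail).mono ?_
      have : j ≤ l := by simpa [Nat.lt_succ_iff] using hj
      omega
    · intro y hyV hyx R hR hyR
      have hprod : ∀ j, ‖∏ i ∈ Finset.range j, (y 0 - x 0 i)‖ ≤ R ^ j := by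
        intro j
        rw [norm_prod]
        refine (Finset.prod_le_prod (fun _ _ => norm_nonneg _) fun i _ => hyR 0 i).trans ?_
        simp
      have hrem : ‖diffQuotOne (fun t => F (Fin.cons t (Fin.tail y))) (l + 1)
          (Fin.cons (y 0) (revNodes (x 0) (l + 1)))‖ ≤ M := by
        have h1 : ‖diffQuotOne (fun t => diffQuot d (fun y' => F (Fin.cons t y')) (fun _ => 0)
            (fun i _ => y i.succ)) (l + 1) (Fin.cons (y 0) (revNodes (x 0) (l + 1)))‖ ≤ M :=
          hF (Fin.cons (l + 1) fun _ => 0) (by simp [Fin.sum_cons])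
          (Fin.cons (α := fun i => Fin ((Fin.cons (l + 1) fun _ => 0 : Fin (d + 1) → ℕ) i + 1) → K)
            (Fin.cons (y 0) (revNodes (x 0) (l + 1))) fun i _ => y i.succ) ?_ ?_
        · have e : ∀ t, diffQuot d (fun y' => F (Fin.cons t y')) (fun _ => 0)
              (fun i _ => y i.succ) = F (Fin.cons t (Fin.tail y)) := fun t => by
            rw [diffQuot_zero_apply]
            rfl
          simp only [e] at h1
          exact h1
        · intro i
          refine Fin.cases ?_ (fun i => ?_) i
          · intro k
            exact Fin.cases (hyV 0) (hnode (l + 1)) (k : Fin (l + 2))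
          · exact fun _ => hyV i.succ
        · intro i
          refine Fin.cases ?_ (fun i => ?_) i
          · have : Function.Injective
                (Fin.cons (y 0) (revNodes (x 0) (l + 1)) : Fin (l + 2) → K) := by
              rw [Fin.cons_injective_iff]
              refine ⟨?_, revNodes_injective (hinj 0) (l + 1)⟩
              rintro ⟨k, hk⟩
              obtain ⟨k', -, hk'⟩ := revNodes_mem_range (x 0) k
              exact hyx 0 k' (hk.symm.trans hk')
            exact this
          · exact Function.injective_of_subsingleton (α := Fin 1) _
      have hnewton := newton_interpolation (fun t => F (Fin.cons t (Fin.tail y))) (x 0)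
        (hyx 0) (l + 1)
      simp only [Fin.cons_self_tail] at hnewton
      rw [hnewton]
      have e : ∀ a b c : K, a + b - c = (a - c) + b := fun a b c => by ring
      rw [e, ← Finset.sum_sub_distrib]
      simp only [smul_eq_mul, ← mul_sub]
      have hsum : ‖∑ j ∈ Finset.range (l + 1), (∏ i ∈ Finset.range j, (y 0 - x 0 i)) *
          (H j (Fin.tail y) - q j (Fin.tail y))‖ ≤
          ∑ j ∈ Finset.range (l + 1), ((l : ℝ) + 2) ^ d * M * R ^ (l + 1) := by
        refine norm_sum_le_of_le _ fun j hj => ?_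
        have hjl : j ≤ l := by simpa [Nat.lt_succ_iff] using hj
        rw [norm_mul]
        have h1 := hqH j hj (Fin.tail y) (fun i => hyV i.succ) (fun i => hyx i.succ) R hR
          (fun i => hyR i.succ)
        calc _ ≤ R ^ j * ((((l - j : ℕ) : ℝ) + 2) ^ d * M * R ^ (l - j + 1)) := by
              gcongr
              exact hprod j
          _ = (((l - j : ℕ) : ℝ) + 2) ^ d * M * R ^ (l + 1) := by
              have : l + 1 = j + (l - j + 1) := by omega
              rw [this, pow_add R j]
              ring
          _ ≤ _ := by
              gcongr
              omega
      have hlast : ‖(∏ i ∈ Finset.range (l + 1), (y 0 - x 0 i)) *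
          diffQuotOne (fun t => F (Fin.cons t (Fin.tail y))) (l + 1)
          (Fin.cons (y 0) (revNodes (x 0) (l + 1)))‖ ≤ ((l : ℝ) + 2) ^ d * M * R ^ (l + 1) := by
        rw [norm_mul]
        calc _ ≤ R ^ (l + 1) * M := by
              gcongr
              exact hprod _
          _ = 1 * M * R ^ (l + 1) := by ring
          _ ≤ _ := by
              gcongr
              exact one_le_pow₀ (by linarith [(Nat.cast_nonneg l : (0 : ℝ) ≤ l)])
      -- There are `l + 1` coefficients and one remainder, all with the same bound: this is the
      -- extra factor `l + 2`.
      refine (norm_add_le_of_le hsum hlast).trans (le_of_eq ?_)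
      rw [Finset.sum_const, Finset.card_range, nsmul_eq_mul, pow_succ]
      push_cast
      ring

end DifferenceQuotients

/-! ### Taylor approximation from bounded difference quotients. -/

section TaylorPadic

variable {K : Type*} [NontriviallyNormedField K] {d : ℕ}

theorem continuous_taylorPoly (c : (Fin d → ℕ) → K) (m : ℕ) : Continuous (taylorPoly c m) := by
  unfold taylorPoly
  exact continuous_finsetSum _ fun γ _ => continuous_const.mul (continuous_divMon γ)

/-- A sequence of distinct points close to a point. -/
theorem exists_nodes {V : Set K} (hV : IsOpen V) {x : K} (hx : x ∈ V) {δ : ℝ} (hδ : 0 < δ) :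
    ∃ u : ℕ → K, Function.Injective u ∧ ∀ j, u j ∈ V ∧ u j ≠ x ∧ dist (u j) x < δ := by
  have hinf : ((V ∩ Metric.ball x δ) \ {x}).Infinite := by
    refine Set.Infinite.sdiff (infinite_of_mem_nhds x ?_) (finite_singleton x)
    exact inter_mem (hV.mem_nhds hx) (Metric.ball_mem_nhds x hδ)
  have e := hinf.natEmbedding
  exact ⟨fun j => e j, fun i j h => e.injective (Subtype.ext h),
    fun j => ⟨(e j).2.1.1, (e j).2.2, (e j).2.1.2⟩⟩

/-- A Taylor polynomial at `x` is replaced by an interpolation polynomial with nodes within `δ` of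
`x` and different from it. The first estimate needs points whose coordinates avoid the nodes; the
second, uniform in `δ`, provides compactness as `δ → 0`. -/
theorem exists_approx_of_diffQuot_bound [CharZero K] [ProperSpace K] {l : ℕ}
    {F : (Fin d → K) → K} {p : Fin d → K} {R M : ℝ} (hM : 0 ≤ M)
    (hF : ∀ β : Fin d → ℕ, ∑ i, β i ≤ l + 1 → ∀ X : (i : Fin d) → Fin (β i + 1) → K,
      (∀ i j, X i j ∈ Metric.ball (p i) R) → (∀ i, Function.Injective (X i)) →
      ‖diffQuot d F β X‖ ≤ M)
    {x : Fin d → K} (hx : x ∈ Metric.ball p R) {δ : ℝ} (hδ : 0 < δ) (hδ1 : δ ≤ 1) :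
    ∃ c, (∀ z ∈ Metric.ball p R, (∀ i, z i = x i ∨ δ ≤ dist (z i) (x i)) →
        ‖F z - taylorPoly c l (z - x)‖ ≤ ((l : ℝ) + 2) ^ d * M * (‖z - x‖ + δ) ^ (l + 1)) ∧
      ∀ z ∈ Metric.ball p R,
        ‖taylorPoly c l (z - x)‖ ≤ M + ((l : ℝ) + 2) ^ d * M * (2 * R + 1) ^ (l + 1) := by
  have hR : 0 < R := dist_nonneg.trans_lt (Metric.mem_ball.1 hx)
  have hcoord : ∀ z ∈ Metric.ball p R, ∀ i, z i ∈ Metric.ball (p i) R := fun z hz i =>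
    (dist_le_pi_dist z p i).trans_lt hz
  have hnodes := fun i => exists_nodes Metric.isOpen_ball (hcoord x hx i) hδ
  choose u hu hu' using hnodes
  obtain ⟨q, hq, hqF⟩ := exists_interpolation d l F (fun i => Metric.ball (p i) R) M u hM
    (fun β hβ => hF β hβ.le) hu (fun i j => (hu' i j).1)
  obtain ⟨c, hc⟩ := hq.exists_taylorPoly x
  have hdist : ∀ z : Fin d → K, ∀ i j, ‖z i - u i j‖ ≤ ‖z - x‖ + δ := by
    intro z i j
    have e : z i - u i j = (z - x) i - (u i j - x i) := by simp
    rw [e]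
    refine (norm_sub_le _ _).trans (add_le_add (norm_le_pi_norm _ i) ?_)
    rw [← dist_eq_norm]
    exact (hu' i j).2.2.le
  refine ⟨c, fun z hz hzx => ?_, ?_⟩
  · rw [← hc]
    refine hqF z (hcoord z hz) (fun i j hij => ?_) _ (by positivity) (hdist z)
    rcases hzx i with h | h
    · exact (hu' i j).2.1 (hij.symm.trans h)
    · have := (hu' i j).2.2
      rw [← hij] at this
      linarith
  -- Interpolation controls `q` only off the nodes. Such points are dense, the nodes being
  -- countable, and the polynomial is continuous.
  · have hdense : Dense {z : Fin d → K | ∀ i, z i ∈ (range (u i))ᶜ} := by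
      have := dense_pi (univ : Set (Fin d)) (s := fun i => (range (u i))ᶜ)
        fun i _ => (countable_range (u i)).dense_compl K
      simpa [Set.pi] using this
    have hclosed : IsClosed {z : Fin d → K | ‖taylorPoly c l (z - x)‖ ≤
        M + ((l : ℝ) + 2) ^ d * M * (2 * R + 1) ^ (l + 1)} :=
      isClosed_le ((continuous_taylorPoly c l).comp
        (continuous_id.sub continuous_const)).norm continuous_const
    intro z hz
    refine closure_minimal ?_ hclosed (hdense.open_subset_closure_inter Metric.isOpen_ball hz)
    rintro w ⟨hw, hwu⟩
    have hFw : ‖F w‖ ≤ M := by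
      have h1 := hF (fun _ => 0) (by simp) (fun i _ => w i) (fun i _ => hcoord w hw i)
        (fun i => Function.injective_of_subsingleton (α := Fin 1) _)
      rwa [diffQuot_zero_apply] at h1
    have hwx : ‖w - x‖ ≤ 2 * R := by
      rw [← dist_eq_norm]
      refine (dist_triangle_right w x p).trans ?_
      rw [Metric.mem_ball] at hw hx
      linarith
    have h2 := hqF w (hcoord w hw) (fun i j hij => hwu i ⟨j, hij.symm⟩) (2 * R + 1)
      (by positivity) (fun i j => (hdist w i j).trans (add_le_add hwx hδ1))
    simp only [mem_ofPred_eq]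
    rw [← hc]
    calc ‖q w‖ = ‖F w - (F w - q w)‖ := by congr 1; ring
      _ ≤ ‖F w‖ + ‖F w - q w‖ := norm_sub_le _ _
      _ ≤ _ := add_le_add hFw h2

/-- The nodes collapse to `x`: the interpolation polynomials have bounded coefficients, a
subsequence converges, and the error bound passes to the limit. -/
theorem hasTaylorApprox_of_diffQuot_bound [CharZero K] [ProperSpace K] {l : ℕ}
    {F : (Fin d → K) → K} {p : Fin d → K} {R M : ℝ} (hM : 0 ≤ M)
    (hF : ∀ β : Fin d → ℕ, ∑ i, β i ≤ l + 1 → ∀ X : (i : Fin d) → Fin (β i + 1) → K,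
      (∀ i j, X i j ∈ Metric.ball (p i) R) → (∀ i, Function.Injective (X i)) →
      ‖diffQuot d F β X‖ ≤ M) :
    HasTaylorApprox l F (Metric.ball p R) (((l : ℝ) + 2) ^ d * M) := by
  suffices h : ∀ x ∈ Metric.ball p R, ∃ c, ∀ z ∈ Metric.ball p R,
      ‖F z - taylorPoly c l (z - x)‖ ≤ ((l : ℝ) + 2) ^ d * M * ‖z - x‖ ^ (l + 1) by
    choose! c hc using h
    exact ⟨c, hc⟩
  intro x hx
  have hδ : ∀ N : ℕ, (1 : ℝ) / ((N : ℝ) + 1) ≤ 1 := fun N => by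
    rw [div_le_one (by positivity)]
    linarith [(Nat.cast_nonneg N : (0 : ℝ) ≤ N)]
  choose c hc1 hc2 using fun N : ℕ =>
    exists_approx_of_diffQuot_bound hM hF hx (Nat.one_div_pos_of_nat (n := N)) (hδ N)
  obtain ⟨C, hC, hcoef⟩ := exists_coeff_bound K d l
  set t := (R - dist x p) / 2 with ht
  rw [Metric.mem_ball] at hx
  have ht0 : 0 < t := by linarith
  set A := M + ((l : ℝ) + 2) ^ d * M * (2 * R + 1) ^ (l + 1)
  have hbound : ∀ N, ∀ β ∈ degIdx d l, ‖c N β‖ ≤ C * A / t ^ (∑ i, β i) := by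
    intro N β hβ
    rw [le_div_iff₀ (by positivity)]
    refine hcoef (c N) A t ht0 (fun h hh => ?_) β hβ
    have := hc2 N (x + h) (by
      rw [Metric.mem_ball]
      calc dist (x + h) p ≤ dist (x + h) x + dist x p := dist_triangle _ _ _
        _ ≤ t + dist x p := by
            gcongr
            simpa [dist_eq_norm] using hh
        _ < R := by rw [ht]; linarith)
    rwa [add_sub_cancel_left] at this
  have hcomp : IsCompact (Set.pi univ fun β : degIdx d l =>
      Metric.closedBall (0 : K) (C * A / t ^ (∑ i, β.1 i))) :=
    isCompact_univ_pi fun β => isCompact_closedBall _ _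
  obtain ⟨v, -, φ, hφ, hlim⟩ := hcomp.tendsto_subseq (x := fun N (β : degIdx d l) => c N β.1)
    (fun N β _ => by simpa using hbound N β.1 β.2)
  classical
  let c' : (Fin d → ℕ) → K := fun β => if h : β ∈ degIdx d l then v ⟨β, h⟩ else 0
  refine ⟨c', fun z hz => ?_⟩
  have hδlim : Tendsto (fun N => (1 : ℝ) / ((φ N : ℝ) + 1)) atTop (𝓝 0) :=
    tendsto_one_div_add_atTop_nhds_zero_nat.comp hφ.tendsto_atTop
  have h1 : Tendsto (fun N => ‖F z - taylorPoly (c (φ N)) l (z - x)‖) atTop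
      (𝓝 ‖F z - taylorPoly c' l (z - x)‖) := by
    refine (tendsto_const_nhds.sub ?_).norm
    refine tendsto_finsetSum _ fun β hβ => Tendsto.mul_const _ ?_
    have := (tendsto_pi_nhds.1 hlim) ⟨β, hβ⟩
    simpa [c', hβ] using this
  have h2 : Tendsto (fun N => ((l : ℝ) + 2) ^ d * M *
      (‖z - x‖ + (1 : ℝ) / ((φ N : ℝ) + 1)) ^ (l + 1)) atTop
      (𝓝 (((l : ℝ) + 2) ^ d * M * ‖z - x‖ ^ (l + 1))) := by
    have := ((hδlim.const_add ‖z - x‖).pow (l + 1)).const_mul (((l : ℝ) + 2) ^ d * M)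
    simpa using this
  refine le_of_tendsto_of_tendsto h1 h2 ?_
  -- For a fixed `z`, a coordinate either equals that of `x`, hence is not a node, or is eventually
  -- farther from it than all nodes.
  have hev : ∀ i, ∀ᶠ N in atTop, z i = x i ∨ (1 : ℝ) / ((φ N : ℝ) + 1) ≤ dist (z i) (x i) := by
    intro i
    rcases eq_or_ne (z i) (x i) with h | h
    · exact Eventually.of_forall fun _ => Or.inl h
    · filter_upwards [hδlim.eventually_le_const (dist_pos.2 h)] with N hN
      exact Or.inr hN
  filter_upwards [eventually_all.2 hev] with N hN
  exact hc1 (φ N) z hz hN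

/-- The continuous extension of each difference quotient is bounded near the diagonal point all of
whose entries come from `p`, and there are finitely many multi-indices. -/
theorem IsCkDiffQuot.exists_hasTaylorApprox [CharZero K] [ProperSpace K] {l n : ℕ}
    {f : (Fin d → K) → Fin n → K} {U : Set (Fin d → K)} (hf : IsCkDiffQuot (l + 1) f U)
    {p : Fin d → K} (hp : p ∈ U) :
    ∃ R > 0, ∃ M ≥ 0, Metric.ball p R ⊆ U ∧
      ∀ j, HasTaylorApprox l (fun x => f x j) (Metric.ball p R) M := by
  obtain ⟨V, hV, hVU, hbox⟩ := hf p hp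
  have hlocal : ∀ β ∈ degIdx d (l + 1), ∃ B : ℝ, ∀ᶠ R : ℝ in 𝓝[>] 0,
      ∀ X : (i : Fin d) → Fin (β i + 1) → K, (∀ i j, X i j ∈ V i) →
      (∀ i j, X i j ∈ Metric.ball (p i) R) → (∀ i, Function.Injective (X i)) →
      ‖diffQuot d f β X‖ ≤ B := by
    intro β hβ
    obtain ⟨Φ, hΦ, hΦf⟩ := hbox β (mem_degIdx.1 hβ)
    have h0 := (hΦ (fun i _ => p i) (fun i _ => (hV i).2)).norm
    obtain ⟨ε, hε, h⟩ := Metric.mem_nhdsWithin_iff.1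
      (h0.eventually_le_const (lt_add_one ‖Φ fun i _ => p i‖))
    refine ⟨‖Φ fun i _ => p i‖ + 1, ?_⟩
    filter_upwards [Ioo_mem_nhdsGT hε] with R hR X hX hXR hXi
    rw [← hΦf X hX hXi]
    refine h ⟨?_, hX⟩
    rw [Metric.mem_ball, dist_pi_lt_iff hε]
    intro i
    rw [dist_pi_lt_iff hε]
    intro j
    exact (Metric.mem_ball.1 (hXR i j)).trans hR.2
  choose! B hB using hlocal
  have hVev : ∀ᶠ R : ℝ in 𝓝[>] 0, ∀ i, Metric.ball (p i) R ⊆ V i := by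
    rw [eventually_all]
    intro i
    obtain ⟨ε, hε, h⟩ := Metric.isOpen_iff.1 (hV i).1 _ (hV i).2
    filter_upwards [Ioo_mem_nhdsGT hε] with R hR
    exact (Metric.ball_subset_ball hR.2.le).trans h
  obtain ⟨R, ⟨hR1, hR2⟩, hR3⟩ := (((eventually_all_finset _).2 hB).and hVev |>.and
    self_mem_nhdsWithin).exists
  have hR3 : 0 < R := hR3
  set M := ∑ β ∈ degIdx d (l + 1), |B β|
  have hM : 0 ≤ M := Finset.sum_nonneg fun _ _ => abs_nonneg _
  refine ⟨R, hR3, ((l : ℝ) + 2) ^ d * M, by positivity, ?_, fun j => ?_⟩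
  · refine fun z hz => hVU fun i _ => hR2 i ?_
    exact (dist_le_pi_dist z p i).trans_lt hz
  · refine hasTaylorApprox_of_diffQuot_bound hM fun β hβ X hX hXi => ?_
    rw [diffQuot_apply_pi]
    have hβ := mem_degIdx.2 hβ
    calc ‖diffQuot d f β X j‖ ≤ ‖diffQuot d f β X‖ := norm_le_pi_norm _ j
      _ ≤ B β := hR1 β hβ X (fun i j => hR2 i (hX i j)) hX hXi
      _ ≤ |B β| := le_abs_self _
      _ ≤ M := Finset.single_le_sum (f := fun β => |B β|) (fun _ _ => abs_nonneg _) hβ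

end TaylorPadic

/-! ### Taylor approximation over the reals. -/

section TaylorReal

variable {d : ℕ}

theorem isPolyFun_multilinear {K : Type*} [NontriviallyNormedField K] {k : ℕ}
    (T : MultilinearMap K (fun _ : Fin k => Fin d → K) K) : IsPolyFun k fun h => T fun _ => h := by
  have e : ∀ h : Fin d → K, (T fun _ => h) =
      ∑ r : Fin k → Fin d, (∏ i, h (r i)) * T fun i => Pi.single (r i) 1 := by
    intro h
    have h1 : (fun _ : Fin k => h) = fun _ => ∑ i, h i • (Pi.single i 1 : Fin d → K) := by
      ext _ j
      simp [Finset.sum_apply, Pi.single_apply]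
    conv_lhs => rw [h1]
    rw [MultilinearMap.map_sum]
    refine Finset.sum_congr rfl fun r _ => ?_
    rw [MultilinearMap.map_smul_univ, smul_eq_mul]
  simp only [e]
  refine IsPolyFun.sum fun r _ => ?_
  refine IsPolyFun.mul (m := k) (m' := 0) ?_ (isPolyFun_const _)
  refine ⟨∏ i, MvPolynomial.X (r i), ?_, fun y => by simp [map_prod]⟩
  refine (MvPolynomial.totalDegree_finsetProd _ _).trans ?_
  simp [MvPolynomial.totalDegree_X]

/-- Integral form of Taylor's remainder along the segment from `y` to `z`, which stays in the convex
ball; the factor `1 / l!` is bounded by `1`. -/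
theorem hasTaylorApprox_of_iteratedFDeriv_bound {l : ℕ} {F : (Fin d → ℝ) → ℝ} {p : Fin d → ℝ}
    {R B : ℝ} (hF : ∀ x ∈ Metric.ball p R, ContDiffAt ℝ (l + 1 : ℕ) F x)
    (hB : ∀ x ∈ Metric.ball p R, ‖iteratedFDeriv ℝ (l + 1) F x‖ ≤ B) :
    HasTaylorApprox l F (Metric.ball p R) B := by
  suffices h : ∀ y ∈ Metric.ball p R, ∃ c, ∀ z ∈ Metric.ball p R,
      ‖F z - taylorPoly c l (z - y)‖ ≤ B * ‖z - y‖ ^ (l + 1) by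
    choose! c hc using h
    exact ⟨c, hc⟩
  intro y hy
  have hq : IsPolyFun l fun h : Fin d → ℝ => ∑ k ∈ Finset.range (l + 1),
      (iteratedFDeriv ℝ k F y fun _ => h) * ((k.factorial : ℝ))⁻¹ := by
    refine IsPolyFun.sum fun k hk => ?_
    have hk : k ≤ l := by simpa [Nat.lt_succ_iff] using hk
    exact ((isPolyFun_multilinear (iteratedFDeriv ℝ k F y).toMultilinearMap).mul
      (isPolyFun_const _)).mono hk
  obtain ⟨c, hc⟩ := hq.exists_taylorPoly 0
  refine ⟨c, fun z hz => ?_⟩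
  have hseg : ∀ t ∈ Icc (0 : ℝ) 1, y + t • (z - y) ∈ Metric.ball p R := fun t ht =>
    (convex_ball p R).add_smul_sub_mem hy hz ht
  have htaylor := map_add_eq_sum_add_integral_iteratedFDeriv (f := F) (x := y) (y := z - y)
    (n := l) (fun t ht => by exact_mod_cast hF _ (hseg t ht))
  rw [add_sub_cancel] at htaylor
  have hcz := hc (z - y)
  rw [sub_zero] at hcz
  have hB0 : 0 ≤ B := (norm_nonneg _).trans (hB y hy)
  rw [htaylor, ← hcz]
  simp only [smul_eq_mul, mul_comm _ ((Nat.factorial _ : ℝ)⁻¹)]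
  rw [add_sub_cancel_left, norm_mul]
  have h1 : ‖((l.factorial : ℝ))⁻¹‖ ≤ 1 := by
    rw [norm_inv, Real.norm_natCast]
    exact inv_le_one_of_one_le₀ (by exact_mod_cast l.factorial_pos)
  have h2 : ‖∫ t in (0 : ℝ)..1, (1 - t) ^ l *
      iteratedFDeriv ℝ (l + 1) F (y + t • (z - y)) fun _ => z - y‖ ≤
      B * ‖z - y‖ ^ (l + 1) * |1 - 0| := by
    refine intervalIntegral.norm_integral_le_of_norm_le_const fun t ht => ?_
    rw [uIoc_of_le zero_le_one] at ht
    rw [norm_mul]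
    have h3 : ‖(1 - t) ^ l‖ ≤ 1 := by
      rw [norm_pow]
      refine pow_le_one₀ (norm_nonneg _) ?_
      rw [Real.norm_eq_abs, abs_le]
      constructor <;> linarith [ht.1, ht.2]
    have h4 : ‖iteratedFDeriv ℝ (l + 1) F (y + t • (z - y)) fun _ => z - y‖ ≤
        B * ‖z - y‖ ^ (l + 1) := by
      refine ((iteratedFDeriv ℝ (l + 1) F (y + t • (z - y))).le_opNorm _).trans ?_
      rw [Finset.prod_const, Finset.card_univ, Fintype.card_fin]
      gcongr
      exact hB _ (hseg t ⟨ht.1.le, ht.2⟩)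
    calc _ ≤ 1 * (B * ‖z - y‖ ^ (l + 1)) := by gcongr
      _ = _ := one_mul _
  calc _ ≤ 1 * (B * ‖z - y‖ ^ (l + 1) * |1 - 0|) := by gcongr
    _ = _ := by simp

theorem ContDiffOn.exists_hasTaylorApprox {l n : ℕ} {f : (Fin d → ℝ) → Fin n → ℝ}
    {U : Set (Fin d → ℝ)} (hU : IsOpen U) (hf : ContDiffOn ℝ (l + 1 : ℕ) f U)
    {p : Fin d → ℝ} (hp : p ∈ U) :
    ∃ R > 0, ∃ M ≥ 0, Metric.ball p R ⊆ U ∧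
      ∀ j, HasTaylorApprox l (fun x => f x j) (Metric.ball p R) M := by
  have hcd : ∀ j, ∀ x ∈ U, ContDiffAt ℝ (l + 1 : ℕ) (fun x => f x j) x := fun j x hx =>
    contDiffAt_pi.1 (hf.contDiffAt (hU.mem_nhds hx)) j
  have hev : ∀ j, ∀ᶠ x in 𝓝 p, ‖iteratedFDeriv ℝ (l + 1) (fun x => f x j) x‖ ≤
      ‖iteratedFDeriv ℝ (l + 1) (fun x => f x j) p‖ + 1 := by
    intro j
    have : ContinuousAt (iteratedFDeriv ℝ (l + 1) (fun x => f x j)) p :=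
      ((hcd j p hp).iteratedFDeriv_right (i := l + 1) (m := 0) (by simp)).continuousAt
    exact this.norm.eventually_le_const (lt_add_one _)
  obtain ⟨R, hR, h⟩ := Metric.mem_nhds_iff.1 ((eventually_all.2 hev).and (hU.mem_nhds hp))
  refine ⟨R, hR, ∑ j, (‖iteratedFDeriv ℝ (l + 1) (fun x => f x j) p‖ + 1), by positivity,
    fun x hx => (h hx).2, fun j => ?_⟩
  refine hasTaylorApprox_of_iteratedFDeriv_bound (fun x hx => hcd j x (h hx).2) fun x hx => ?_
  refine ((h hx).1 j).trans ?_
  exact Finset.single_le_sum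
    (f := fun j => ‖iteratedFDeriv ℝ (l + 1) (fun x => f x j) p‖ + 1)
    (fun _ _ => by positivity) (Finset.mem_univ j)

end TaylorReal

/-! ### Jets of vector-valued maps, with common constants. -/

section Jets

variable {K : Type*} [NontriviallyNormedField K] [CharZero K] [ProperSpace K] {d : ℕ}

/-- A map which is uniformly approximated by polynomials of degree `l` has Taylor jets. -/
theorem exists_jets_of_hasTaylorApprox {l n : ℕ} {f : (Fin d → K) → Fin n → K} {p : Fin d → K}
    {R M : ℝ} (hR : 0 < R) (hM : 0 ≤ M)
    (h : ∀ j, HasTaylorApprox l (fun x => f x j) (Metric.ball p R) M) :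
    ∃ R' > 0, R' ≤ R ∧ ∃ M' ≥ 0, ∃ D : Fin n → (Fin d → ℕ) → (Fin d → K) → K,
      (∀ j, HasTaylorJet l (D j) (Metric.ball p R') M') ∧
      ∀ j, ∀ y ∈ Metric.ball p R', D j 0 y = f y j := by
  choose D M' hM' hD hD0 using fun j => (h j).exists_hasTaylorJet hM
  refine ⟨R / 3, by positivity, by linarith, ∑ j, M' j, Finset.sum_nonneg fun j _ => hM' j, D,
    fun j β hβ y hy z hz => (hD j β hβ y hy z hz).trans ?_, hD0⟩
  gcongr
  exact Finset.single_le_sum (fun j _ => hM' j) (Finset.mem_univ j)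

end Jets

/-! ### Passing from small balls to large ones by the Federer property. -/

section Covering

variable {X : Type*} [MetricSpace X] [SecondCountableTopology X] [MeasurableSpace X] [BorelSpace X]

omit [SecondCountableTopology X] [MeasurableSpace X] [BorelSpace X] in
theorem exists_maximal_separated (T : Set X) (t : ℝ) :
    ∃ Y ⊆ T, (Y.Pairwise fun a b => t ≤ dist a b) ∧ ∀ z ∈ T, z ∉ Y → ∃ y ∈ Y, dist z y < t := by
  obtain ⟨Y, hY⟩ := zorn_subset {Y : Set X | Y ⊆ T ∧ Y.Pairwise fun a b => t ≤ dist a b} (by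
    intro c hc hchain
    refine ⟨⋃₀ c, ⟨sUnion_subset fun s hs => (hc hs).1, ?_⟩, fun s hs => subset_sUnion_of_mem hs⟩
    rw [pairwise_sUnion hchain.directedOn]
    exact fun s hs => (hc hs).2)
  refine ⟨Y, hY.prop.1, hY.prop.2, fun z hz hzY => ?_⟩
  by_contra! hcon
  have h1 : insert z Y ∈ {Y : Set X | Y ⊆ T ∧ Y.Pairwise fun a b => t ≤ dist a b} := by
    refine ⟨insert_subset hz hY.prop.1, hY.prop.2.insert fun y hy _ => ⟨hcon y hy, ?_⟩⟩
    rw [dist_comm]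
    exact hcon y hy
  exact hzY (hY.le_of_ge h1 (subset_insert z Y) (mem_insert z Y))

/-- For a Federer measure, estimates on all small balls centred in `E ∩ supp μ` add up to an
estimate on a large ball. -/
theorem measure_inter_ball_le_of_local {μ : Measure X} {W : Set X} {D : ℝ≥0∞}
    (hD : ∀ x ∈ μ.support, ∀ s : ℝ, 0 < s → Metric.ball x (3 * s) ⊆ W →
      μ (Metric.ball x (3 * s)) ≤ D * μ (Metric.ball x s))
    {x₀ : X} (hx₀ : x₀ ∈ μ.support) {r s : ℝ} (hs : 0 < s) (hsr : s ≤ r)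
    (hW : Metric.ball x₀ (3 * r) ⊆ W) {E : Set X} {q : ℝ≥0∞}
    (h : ∀ y ∈ μ.support, y ∈ E → dist y x₀ < r →
      μ (E ∩ Metric.ball y s) ≤ q * μ (Metric.ball y s)) :
    μ (E ∩ Metric.ball x₀ r) ≤ q * D ^ 2 * μ (Metric.ball x₀ r) := by
  -- With this separation the balls of radius `s / 3` are disjoint while those of radius `s` still
  -- cover. One factor `D` is paid to go from `s` to `s / 3`, the other from `3 * r` to `r`.
  obtain ⟨Y, hYT, hYsep, hYmax⟩ :=
    exists_maximal_separated (E ∩ μ.support ∩ Metric.ball x₀ r) (2 * s / 3)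
  have hdisj : Y.PairwiseDisjoint fun y => Metric.ball y (s / 3) := by
    intro y hy z hz hyz
    refine Metric.ball_disjoint_ball ?_
    have := hYsep hy hz hyz
    linarith
  have hcount : Y.Countable := hdisj.countable_of_isOpen (fun _ _ => Metric.isOpen_ball)
    fun y _ => ⟨y, Metric.mem_ball_self (by positivity)⟩
  have hcover : E ∩ Metric.ball x₀ r ⊆ (⋃ y ∈ Y, E ∩ Metric.ball y s) ∪ μ.supportᶜ := by
    rintro z ⟨hzE, hzr⟩
    by_cases hz : z ∈ μ.support
    · left
      by_cases hzY : z ∈ Y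
      · exact mem_biUnion hzY ⟨hzE, Metric.mem_ball_self hs⟩
      · obtain ⟨y, hy, hyz⟩ := hYmax z ⟨⟨hzE, hz⟩, hzr⟩ hzY
        exact mem_biUnion hy ⟨hzE, Metric.mem_ball.2 (hyz.trans (by linarith))⟩
    · exact Or.inr hz
  have hball : ∀ y ∈ Y, μ (Metric.ball y s) ≤ D * μ (Metric.ball y (s / 3)) := by
    intro y hy
    have h1 := hD y (hYT hy).1.2 (s / 3) (by positivity) (by
      refine (Metric.ball_subset_ball' ?_).trans hW
      have := Metric.mem_ball.1 (hYT hy).2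
      linarith)
    rwa [mul_div_cancel₀ s three_ne_zero] at h1
  calc μ (E ∩ Metric.ball x₀ r) ≤ μ ((⋃ y ∈ Y, E ∩ Metric.ball y s) ∪ μ.supportᶜ) :=
        measure_mono hcover
    _ ≤ μ (⋃ y ∈ Y, E ∩ Metric.ball y s) + μ μ.supportᶜ := measure_union_le _ _
    _ = μ (⋃ y ∈ Y, E ∩ Metric.ball y s) := by rw [Measure.measure_compl_support, add_zero]
    _ ≤ ∑' y : Y, μ (E ∩ Metric.ball y.1 s) := measure_biUnion_le μ hcount _
    _ ≤ ∑' y : Y, q * D * μ (Metric.ball y.1 (s / 3)) := by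
        refine ENNReal.tsum_le_tsum fun y => ?_
        have hy := hYT y.2
        refine (h y.1 hy.1.2 hy.1.1 hy.2).trans ?_
        rw [mul_assoc]
        gcongr
        exact hball y.1 y.2
    _ = q * D * μ (⋃ y ∈ Y, Metric.ball y (s / 3)) := by
        rw [ENNReal.tsum_mul_left, measure_biUnion hcount hdisj
          fun _ _ => Metric.isOpen_ball.measurableSet]
    _ ≤ q * D * μ (Metric.ball x₀ (3 * r)) := by
        gcongr
        refine iUnion₂_subset fun y hy => Metric.ball_subset_ball' ?_
        have := Metric.mem_ball.1 (hYT hy).2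
        linarith
    _ ≤ q * D * (D * μ (Metric.ball x₀ r)) := by
        gcongr
        exact hD x₀ hx₀ r (hs.trans_le hsr) hW
    _ = q * D ^ 2 * μ (Metric.ball x₀ r) := by ring

end Covering

/-! ### Scale-invariant jets; small values with a large gradient. -/

section Goodness

variable {K : Type*} [NontriviallyNormedField K] {d : ℕ}

/-- Scale invariant bounds for a jet, on a set of diameter comparable to `r`. -/
structure JetBound (l : ℕ) (J : (Fin d → ℕ) → (Fin d → K) → K) (S : Set (Fin d → K))
    (r A : ℝ) : Prop where
  diff : ∀ β, ∑ i, β i ≤ l → ∀ y ∈ S, ∀ z ∈ S,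
    ‖J β z - J β y‖ * r ^ (∑ i, β i) ≤ A * (‖z - y‖ / r)
  lin : ∀ β, ∑ i, β i + 1 ≤ l → ∀ y ∈ S, ∀ z ∈ S,
    ‖J β z - J β y - ∑ i, J (β + Pi.single i 1) y * (z - y) i‖ * r ^ (∑ i, β i) ≤
      A * (‖z - y‖ / r) ^ 2

/-- One derivative removes one weight `r`, hence `A / r`. Passing to `r' ≤ r` shrinks the weights
and enlarges `‖z - y‖ / r'`, so both inequalities survive. -/
theorem JetBound.shift {l : ℕ} {J : (Fin d → ℕ) → (Fin d → K) → K} {S S' : Set (Fin d → K)}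
    {r r' A : ℝ} (hA : 0 ≤ A) (hr' : 0 < r') (hrr : r' ≤ r) (hS : S' ⊆ S)
    (h : JetBound (l + 1) J S r A) (i : Fin d) :
    JetBound l (fun β => J (β + Pi.single i 1)) S' r' (A / r) := by
  have hr : 0 < r := hr'.trans_le hrr
  constructor
  · intro β hβ y hy z hz
    have h1 := h.diff (β + Pi.single i 1) (by rw [sum_add_single]; omega) y (hS hy) z (hS hz)
    rw [sum_add_single, pow_succ, ← mul_assoc, ← le_div_iff₀ hr] at h1
    calc _ ≤ ‖J (β + Pi.single i 1) z - J (β + Pi.single i 1) y‖ * r ^ (∑ i, β i) := by gcongr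
      _ ≤ A * (‖z - y‖ / r) / r := h1
      _ = A / r * (‖z - y‖ / r) := by ring
      _ ≤ A / r * (‖z - y‖ / r') := by gcongr
  · intro β hβ y hy z hz
    have h1 := h.lin (β + Pi.single i 1) (by rw [sum_add_single]; omega) y (hS hy) z (hS hz)
    rw [sum_add_single, pow_succ, ← mul_assoc, ← le_div_iff₀ hr] at h1
    simp only [add_right_comm β _ (Pi.single i 1)]
    calc _ ≤ ‖J (β + Pi.single i 1) z - J (β + Pi.single i 1) y -
          ∑ k, J (β + Pi.single i 1 + Pi.single k 1) y * (z - y) k‖ * r ^ (∑ i, β i) := by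
          gcongr
      _ ≤ A * (‖z - y‖ / r) ^ 2 / r := h1
      _ = A / r * (‖z - y‖ / r) ^ 2 := by ring
      _ ≤ A / r * (‖z - y‖ / r') ^ 2 := by gcongr

/-- The values at `w` and at `w + t e_i` differ by `G i * t`, so one of them is at least half of
this. The second point need not lie in `supp μ`, which is why absolute decay is the right
hypothesis. -/
theorem exists_le_norm_affine {κ : ℝ}
    (hκ : ∀ t : ℝ, 0 < t → ∃ a : K, a ≠ 0 ∧ ‖a‖ < t ∧ t ≤ κ * ‖a‖) (G : Fin d → K) (c : K)
    (i : Fin d) (w : Fin d → K) {s : ℝ} (hs : 0 < s) :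
    ∃ z ∈ Metric.ball w s, ‖G i‖ * s ≤ 2 * κ * ‖∑ k, G k * z k + c‖ := by
  obtain ⟨t, ht, hts, hst⟩ := hκ s hs
  have hκ0 : 0 < κ := by
    by_contra hneg
    have : κ * ‖t‖ ≤ 0 := mul_nonpos_of_nonpos_of_nonneg (not_lt.1 hneg) (norm_nonneg _)
    linarith
  set z := w + Pi.single i t with hz
  have hzw : z ∈ Metric.ball w s := by
    rw [Metric.mem_ball, dist_eq_norm, hz, add_sub_cancel_left, Pi.norm_single]
    exact hts
  have hdiff : (∑ k, G k * z k + c) - (∑ k, G k * w k + c) = G i * t := by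
    rw [add_sub_add_right_eq_sub, ← Finset.sum_sub_distrib, Finset.sum_eq_single i]
    · simp [hz, mul_add]
    · intro k _ hk
      simp [hz, hk]
    · simp
  have h1 : ‖G i‖ * s ≤ κ * (‖∑ k, G k * z k + c‖ + ‖∑ k, G k * w k + c‖) := by
    calc ‖G i‖ * s ≤ ‖G i‖ * (κ * ‖t‖) := by gcongr
      _ = κ * ‖G i * t‖ := by rw [norm_mul]; ring
      _ ≤ _ := by
        rw [← hdiff]
        gcongr
        exact norm_sub_le _ _
  rcases le_total ‖∑ k, G k * w k + c‖ ‖∑ k, G k * z k + c‖ with h | h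
  · refine ⟨z, hzw, h1.trans ?_⟩
    nlinarith
  · refine ⟨w, Metric.mem_ball_self hs, h1.trans ?_⟩
    nlinarith

variable [MeasurableSpace K] [BorelSpace K] [ProperSpace K]

/-- The part of a ball where a function is small and its gradient is not. -/
theorem measure_small_of_large_gradient {μ : Measure (Fin d → K)} {W : Set (Fin d → K)}
    {D : ℝ≥0∞}
    (hD : ∀ x ∈ μ.support, ∀ s : ℝ, 0 < s → Metric.ball x (3 * s) ⊆ W →
      μ (Metric.ball x (3 * s)) ≤ D * μ (Metric.ball x s))
    {C₀ α₀ : ℝ} (hα₀ : 0 < α₀) (hdec : AbsolutelyDecayingOn μ C₀ α₀ W) {κ : ℝ}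
    (hκ0 : 0 < κ) (hκ : ∀ t : ℝ, 0 < t → ∃ a : K, a ≠ 0 ∧ ‖a‖ < t ∧ t ≤ κ * ‖a‖)
    {y : Fin d → K} (hy : y ∈ μ.support) {r : ℝ} (hW : Metric.ball y (3 * r) ⊆ W)
    {g : (Fin d → K) → K} {G : Fin d → (Fin d → K) → K} {A : ℝ} (hA : 0 ≤ A)
    (hlin : ∀ w ∈ Metric.ball y (3 * r), ∀ z ∈ Metric.ball y (3 * r),
      ‖g z - g w - ∑ k, G k w * (z - w) k‖ ≤ A * (‖z - w‖ / r) ^ 2)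
    (i : Fin d) {ε θ b : ℝ} (hε : 0 < ε) (hb : 0 < b) (hθ : 0 < θ) (hθ1 : θ ≤ 1) (hr : 0 < r) :
    μ ({z | ‖g z‖ < ε ∧ b ≤ ‖G i z‖ * r} ∩ Metric.ball y r) ≤
      ENNReal.ofReal C₀ * ENNReal.ofReal ((2 * κ * (ε + A * θ ^ 2) / (b * θ)) ^ α₀) * D ^ 2 *
        μ (Metric.ball y r) := by
  -- On a ball of radius `θ * r` about a point `w` of the set, `g` is within `A * θ ^ 2` of its
  -- linearization at `w`, whose supremum is at least `b * θ / (2 * κ)`. Decay of that affine map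
  -- gives the quotient in the statement.
  refine measure_inter_ball_le_of_local hD hy (s := θ * r) (by positivity) (by nlinarith) hW ?_
  rintro w hw ⟨hwε, hwb⟩ hwy
  have hsub : Metric.ball w (θ * r) ⊆ Metric.ball y (3 * r) := by
    refine Metric.ball_subset_ball' ?_
    nlinarith
  have hw3 : w ∈ Metric.ball y (3 * r) := hsub (Metric.mem_ball_self (by positivity))
  set c := g w - ∑ k, G k w * w k
  have hL : ∀ z, (∑ k, G k w * z k + c) = g w + ∑ k, G k w * (z - w) k := by
    intro z
    simp only [c, Pi.sub_apply, mul_sub, Finset.sum_sub_distrib]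
    ring
  have hdecay := hdec (fun k => G k w) c w hw (θ * r) (by positivity) (hsub.trans hW)
    (ε + A * θ ^ 2) (by positivity)
  obtain ⟨z₀, hz₀, hz₀L⟩ := exists_le_norm_affine hκ (fun k => G k w) c i w
    (s := θ * r) (by positivity)
  refine (measure_mono ?_).trans (hdecay.trans ?_)
  · rintro z ⟨⟨hzε, -⟩, hz⟩
    refine ⟨hz, ?_⟩
    simp only [hL]
    have h1 := hlin w hw3 z (hsub hz)
    have h2 : ‖z - w‖ / r ≤ θ := by
      rw [div_le_iff₀ hr, ← dist_eq_norm]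
      exact (Metric.mem_ball.1 hz).le
    calc _ = ‖g z - (g z - g w - ∑ k, G k w * (z - w) k)‖ := by congr 1; ring
      _ ≤ ‖g z‖ + A * (‖z - w‖ / r) ^ 2 := (norm_sub_le _ _).trans (by gcongr)
      _ ≤ ‖g z‖ + A * θ ^ 2 := by gcongr
      _ < ε + A * θ ^ 2 := by linarith
  · refine mul_le_mul' (mul_le_mul' le_rfl ?_) le_rfl
    have hbθ : b * θ / (2 * κ) ≤ ‖∑ k, G k w * z₀ k + c‖ := by
      rw [div_le_iff₀ (by positivity)]
      calc b * θ ≤ ‖G i w‖ * r * θ := by gcongr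
        _ = ‖G i w‖ * (θ * r) := by ring
        _ ≤ _ := hz₀L.trans (le_of_eq (by ring))
    have hsup : ENNReal.ofReal (b * θ / (2 * κ)) ≤
        ⨆ z ∈ Metric.ball w (θ * r), ‖∑ k, G k w * z k + c‖ₑ := by
      refine le_iSup₂_of_le z₀ hz₀ ?_
      rw [← ofReal_norm]
      exact ENNReal.ofReal_le_ofReal hbθ
    rw [← ENNReal.ofReal_rpow_of_nonneg (by positivity) hα₀.le]
    refine ENNReal.rpow_le_rpow ?_ hα₀.le
    calc _ ≤ ENNReal.ofReal (ε + A * θ ^ 2) / ENNReal.ofReal (b * θ / (2 * κ)) :=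
          ENNReal.div_le_div_left hsup _
      _ = ENNReal.ofReal (2 * κ * (ε + A * θ ^ 2) / (b * θ)) := by
        rw [← ENNReal.ofReal_div_of_pos (by positivity)]
        congr 1
        field_simp

end Goodness

/-! ### Small values of functions with nondegenerate jets: induction on the order. -/

section GoodnessOfJets

variable {K : Type*} [NontriviallyNormedField K] {d : ℕ}
variable [MeasurableSpace K] [BorelSpace K] [ProperSpace K]

/-- The estimate of the measure of small values of functions with nondegenerate jets of order
`l`. -/
def JetsGood (μ : Measure (Fin d → K)) (W : Set (Fin d → K)) (l : ℕ) (α Q C : ℝ) : Prop :=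
  ∀ x₀ ∈ μ.support, ∀ r : ℝ, 0 < r → Metric.ball x₀ (3 * r) ⊆ W →
    ∀ (J : (Fin d → ℕ) → (Fin d → K) → K) (a : ℝ), 0 < a →
    JetBound l J (Metric.ball x₀ (3 * r)) r (Q * a) →
    (∀ y ∈ Metric.ball x₀ (3 * r), ∃ β, ∑ i, β i ≤ l ∧ a ≤ ‖J β y‖ * r ^ (∑ i, β i)) →
    ∀ ε : ℝ, 0 < ε → μ ({y | ‖J 0 y‖ < ε} ∩ Metric.ball x₀ r) ≤
      ENNReal.ofReal (C * (ε / a) ^ α) * μ (Metric.ball x₀ r)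

-- At order zero the lower bound on the jet is one on the function itself: for `ε ≤ a` the set is
-- empty, and for `ε ≥ a` the bound is trivial.
omit [BorelSpace K] [ProperSpace K] in
theorem jetsGood_zero (μ : Measure (Fin d → K)) (W : Set (Fin d → K)) (Q : ℝ) :
    JetsGood μ W 0 1 Q 1 := by
  intro x₀ _ r hr _ J a ha _ hlow ε hε
  rcases le_total ε a with h | h
  · have : {y | ‖J 0 y‖ < ε} ∩ Metric.ball x₀ r = ∅ := by
      rw [eq_empty_iff_forall_notMem]
      rintro y ⟨hy, hyr⟩
      obtain ⟨β, hβ, hle⟩ := hlow y (Metric.ball_subset_ball (by linarith) hyr)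
      have hβ0 : ∑ i, β i = 0 := by omega
      rw [hβ0, eq_zero_of_sum_eq_zero hβ0, pow_zero, mul_one] at hle
      have hy : ‖J 0 y‖ < ε := hy
      linarith
    rw [this]
    simp
  · calc _ ≤ 1 * μ (Metric.ball x₀ r) := by
          rw [one_mul]
          exact measure_mono inter_subset_right
      _ ≤ _ := by
          gcongr
          rw [ENNReal.one_le_ofReal, one_mul, Real.rpow_one, one_le_div ha]
          exact h

omit [MeasurableSpace K] [BorelSpace K] [ProperSpace K] in
/-- On a small ball around a point where the function is small, a fixed derivative of positive
order is large. -/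
theorem JetBound.exists_large_derivative {l : ℕ} {J : (Fin d → ℕ) → (Fin d → K) → K}
    {S : Set (Fin d → K)} {r a Q ρ : ℝ} (hr : 0 < r) (ha : 0 < a) (hQ : 0 < Q)
    (hρ : 0 < ρ) (hρQ : 6 * Q * ρ ≤ 1) (hρ1 : ρ ≤ 1)
    (hJ : JetBound (l + 1) J S r (Q * a)) {y : Fin d → K} (hyS : y ∈ S)
    (hsub : Metric.ball y (3 * (ρ * r)) ⊆ S)
    (hlow : ∃ β, ∑ i, β i ≤ l + 1 ∧ a ≤ ‖J β y‖ * r ^ (∑ i, β i)) (hy : ‖J 0 y‖ < a) :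
    ∃ i, ∃ β : Fin d → ℕ, ∑ i, β i ≤ l ∧ ∀ z ∈ Metric.ball y (3 * (ρ * r)),
      a / (2 * r) * ρ ^ l ≤ ‖J (β + Pi.single i 1) z‖ * (ρ * r) ^ (∑ i, β i) := by
  obtain ⟨β, hβ, hle⟩ := hlow
  have hβ0 : β ≠ 0 := by
    rintro rfl
    simp at hle
    linarith
  obtain ⟨i, β', rfl⟩ := exists_eq_add_single hβ0
  rw [sum_add_single] at hβ hle
  refine ⟨i, β', by omega, fun z hz => ?_⟩
  -- The value at `y` is large and `6 * Q * ρ ≤ 1` makes the variation over the small ball at most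
  -- half of it. Replacing the weight `r` by `ρ * r` then costs at most `ρ ^ l`.
  have h1 := hJ.diff (β' + Pi.single i 1) (by rw [sum_add_single]; exact hβ) y hyS z (hsub hz)
  rw [sum_add_single] at h1
  have hzy : ‖z - y‖ / r ≤ 3 * ρ := by
    rw [div_le_iff₀ hr, ← dist_eq_norm]
    exact (Metric.mem_ball.1 hz).le.trans (le_of_eq (by ring))
  have h2 : Q * a * (‖z - y‖ / r) ≤ a / 2 := by
    calc Q * a * (‖z - y‖ / r) ≤ Q * a * (3 * ρ) := by gcongr
      _ = (6 * Q * ρ) * (a / 2) := by ring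
      _ ≤ 1 * (a / 2) := by gcongr
      _ = a / 2 := one_mul _
  have h3 : a / 2 ≤ ‖J (β' + Pi.single i 1) z‖ * r ^ (∑ i, β' i + 1) := by
    have h4 : ‖J (β' + Pi.single i 1) y‖ ≤ ‖J (β' + Pi.single i 1) z‖ +
        ‖J (β' + Pi.single i 1) z - J (β' + Pi.single i 1) y‖ := by
      have := norm_sub_le (J (β' + Pi.single i 1) z)
        (J (β' + Pi.single i 1) z - J (β' + Pi.single i 1) y)
      rwa [sub_sub_cancel] at this
    have h5 := mul_le_mul_of_nonneg_right h4 (pow_nonneg hr.le (∑ i, β' i + 1))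
    rw [add_mul] at h5
    linarith
  rw [pow_succ, ← mul_assoc, ← div_le_iff₀ hr] at h3
  calc a / (2 * r) * ρ ^ l = (a / 2 / r) * ρ ^ l := by field_simp
    _ ≤ (‖J (β' + Pi.single i 1) z‖ * r ^ (∑ i, β' i)) * ρ ^ (∑ i, β' i) := by
        refine mul_le_mul h3 ?_ (by positivity) (by positivity)
        exact pow_le_pow_of_le_one hρ.le hρ1 (by omega)
    _ = _ := by rw [mul_pow]; ring

/-- Around a point where `J 0` is small, the set is cut according to the size of one first
derivative: the induction hypothesis for that derivative on one side, linearization and absolute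
decay on the other. The ratio `Q` worsens when passing to the derivative, so the hypothesis is
needed for all `Q`, with `α` independent of `Q`. -/
theorem jetsGood_succ {μ : Measure (Fin d → K)} {W : Set (Fin d → K)} {D : ℝ} (hD0 : 0 ≤ D)
    (hD : ∀ x ∈ μ.support, ∀ s : ℝ, 0 < s → Metric.ball x (3 * s) ⊆ W →
      μ (Metric.ball x (3 * s)) ≤ ENNReal.ofReal D * μ (Metric.ball x s))
    {C₀ α₀ : ℝ} (hC₀ : 0 < C₀) (hα₀ : 0 < α₀) (hdec : AbsolutelyDecayingOn μ C₀ α₀ W)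
    {l : ℕ} {α : ℝ} (hα : 0 < α) (h : ∀ Q : ℝ, 1 ≤ Q → ∃ C : ℝ, 0 < C ∧ JetsGood μ W l α Q C)
    {Q : ℝ} (hQ : 1 ≤ Q) : ∃ C : ℝ, 0 < C ∧ JetsGood μ W (l + 1) (min α α₀ / 4) Q C := by
  obtain ⟨κ, hκ1, hκ⟩ := exists_norm_shell K
  have hκ0 : 0 < κ := by linarith
  have hQ0 : 0 < Q := by linarith
  set ρ : ℝ := 1 / (6 * Q) with hρdef
  have hρ : 0 < ρ := by positivity
  have hρQ : 6 * Q * ρ ≤ 1 := by rw [hρdef]; field_simp; exact le_refl _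
  have hρ6 : ρ ≤ 1 / 6 := by
    rw [hρdef]
    gcongr
    linarith
  have hρ1 : ρ ≤ 1 := by linarith
  -- On the ball of radius `ρ * r` the differentiated jet has lower bound `a / (2 * r) * ρ ^ l` and
  -- upper bound `Q * a / r`; this is their ratio.
  have hQ' : 1 ≤ 2 * Q / ρ ^ l := by
    rw [le_div_iff₀ (by positivity)]
    have : ρ ^ l ≤ 1 := pow_le_one₀ hρ.le hρ1
    linarith
  obtain ⟨C, hC, hgood⟩ := h _ hQ'
  set m := min α α₀ with hm
  have hm0 : 0 < m := lt_min hα hα₀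
  set C₁ : ℝ := C * (2 / ρ ^ l) ^ α + C₀ * (2 * κ * (1 + Q) / ρ) ^ α₀ * D ^ 2 with hC₁
  have hC₁0 : 0 ≤ C₁ := by positivity
  refine ⟨1 + C₁ * D ^ 2, by positivity, ?_⟩
  intro x₀ hx₀ r hr hW J a ha hJ hlow ε hε
  rcases le_or_gt a ε with hεa | hεa
  · calc _ ≤ 1 * μ (Metric.ball x₀ r) := by
          rw [one_mul]
          exact measure_mono inter_subset_right
      _ ≤ _ := by
          gcongr
          rw [ENNReal.one_le_ofReal]
          have h1 : 1 ≤ (ε / a) ^ (m / 4) :=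
            Real.one_le_rpow ((one_le_div ha).2 hεa) (by positivity)
          have h2 : 1 ≤ 1 + C₁ * D ^ 2 := by
            have : 0 ≤ C₁ * D ^ 2 := by positivity
            linarith
          nlinarith
  set u := ε / a with hu
  have hu0 : 0 < u := by positivity
  have hu1 : u < 1 := (div_lt_one ha).2 hεa
  have hεu : ε = u * a := by rw [hu]; field_simp
  -- The derivative is cut at `v * a / r` and linearization is done at relative scale `θ = v ^ 2`.
  -- Then `ε` and `Q * a * θ ^ 2` are both of size `a * v ^ 4`, against `v ^ 3 * a * ρ` for gradient
  -- times scale, so the quotient is of order `v`. The induction hypothesis contributes `v ^ α`; as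
  -- `v = u ^ (1 / 4)`, the exponent is `min α α₀ / 4`.
  set v := u ^ (1 / 4 : ℝ) with hv
  have hv0 : 0 < v := Real.rpow_pos_of_pos hu0 _
  have hv1 : v ≤ 1 := Real.rpow_le_one hu0.le hu1.le (by norm_num)
  have hv4 : v ^ 4 = u := by
    rw [hv, ← Real.rpow_natCast, ← Real.rpow_mul hu0.le]
    norm_num
  have hvm : v ^ m = u ^ (m / 4) := by
    rw [hv, ← Real.rpow_mul hu0.le]
    congr 1
    ring
  have hlocal : ∀ y ∈ μ.support, y ∈ {y | ‖J 0 y‖ < ε} → dist y x₀ < r →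
      μ ({y | ‖J 0 y‖ < ε} ∩ Metric.ball y (ρ * r)) ≤
        ENNReal.ofReal (C₁ * v ^ m) * μ (Metric.ball y (ρ * r)) := by
    intro y hy hyε hyr
    have hyε : ‖J 0 y‖ < ε := hyε
    have hsub : Metric.ball y (3 * (ρ * r)) ⊆ Metric.ball x₀ (3 * r) := by
      refine Metric.ball_subset_ball' ?_
      nlinarith
    have hyS : y ∈ Metric.ball x₀ (3 * r) := hsub (Metric.mem_ball_self (by positivity))
    obtain ⟨i, β, hβ, hbig⟩ := hJ.exists_large_derivative hr ha hQ0 hρ hρQ hρ1 hyS hsub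
      (hlow y hyS) (hyε.trans hεa)
    have hshift := hJ.shift (by positivity) (mul_pos hρ hr)
      (show ρ * r ≤ r by nlinarith) hsub i
    have e1 : Q * a / r = 2 * Q / ρ ^ l * (a / (2 * r) * ρ ^ l) := by field_simp
    rw [e1] at hshift
    have hsmall := hgood y hy (ρ * r) (by positivity) (hsub.trans hW)
      (fun β => J (β + Pi.single i 1)) (a / (2 * r) * ρ ^ l) (by positivity) hshift
      (fun z hz => ⟨β, hβ, hbig z hz⟩) (v * a / r) (by positivity)
    have hlarge := measure_small_of_large_gradient hD hα₀ hdec hκ0 hκ hy (hsub.trans hW)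
      (g := J 0) (G := fun k => J (0 + Pi.single k 1)) (A := Q * a) (by positivity)
      (fun w hw z hz => by
        have h1 := hJ.lin 0 (by simp) w (hsub hw) z (hsub hz)
        simp only [Pi.zero_apply, Finset.sum_const_zero, pow_zero, mul_one] at h1
        refine h1.trans ?_
        gcongr
        nlinarith) i hε (show 0 < v * a * ρ by positivity) (show 0 < v ^ 2 by positivity)
      (pow_le_one₀ hv0.le hv1) (mul_pos hρ hr)
    have hcover : {y | ‖J 0 y‖ < ε} ∩ Metric.ball y (ρ * r) ⊆
        ({z | ‖J (0 + Pi.single i 1) z‖ < v * a / r} ∩ Metric.ball y (ρ * r)) ∪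
        ({z | ‖J 0 z‖ < ε ∧ v * a * ρ ≤ ‖J (0 + Pi.single i 1) z‖ * (ρ * r)} ∩
          Metric.ball y (ρ * r)) := by
      rintro z ⟨hz, hzy⟩
      rcases lt_or_ge ‖J (0 + Pi.single i 1) z‖ (v * a / r) with h1 | h1
      · exact Or.inl ⟨h1, hzy⟩
      · refine Or.inr ⟨⟨hz, ?_⟩, hzy⟩
        rw [div_le_iff₀ hr] at h1
        calc v * a * ρ ≤ ‖J (0 + Pi.single i 1) z‖ * r * ρ := by gcongr
          _ = _ := by ring
    have hb1 : C * (v * a / r / (a / (2 * r) * ρ ^ l)) ^ α ≤ C * (2 / ρ ^ l) ^ α * v ^ m := by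
      have e2 : v * a / r / (a / (2 * r) * ρ ^ l) = 2 / ρ ^ l * v := by field_simp
      rw [e2, Real.mul_rpow (by positivity) hv0.le, ← mul_assoc]
      exact mul_le_mul_of_nonneg_left
        (Real.rpow_le_rpow_of_exponent_ge hv0 hv1 (min_le_left _ _)) (by positivity)
    have hb2 : C₀ * (2 * κ * (ε + Q * a * (v ^ 2) ^ 2) / (v * a * ρ * v ^ 2)) ^ α₀ * D ^ 2 ≤
        C₀ * (2 * κ * (1 + Q) / ρ) ^ α₀ * D ^ 2 * v ^ m := by
      have e2 : 2 * κ * (ε + Q * a * (v ^ 2) ^ 2) / (v * a * ρ * v ^ 2) =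
          2 * κ * (1 + Q) / ρ * v := by
        rw [hεu, ← hv4]
        field_simp
      rw [e2, Real.mul_rpow (by positivity) hv0.le]
      have h3 : v ^ α₀ ≤ v ^ m := Real.rpow_le_rpow_of_exponent_ge hv0 hv1 (min_le_right _ _)
      calc _ = C₀ * (2 * κ * (1 + Q) / ρ) ^ α₀ * D ^ 2 * v ^ α₀ := by ring
        _ ≤ _ := by gcongr
    refine (measure_mono hcover).trans ((measure_union_le _ _).trans ?_)
    refine (add_le_add hsmall hlarge).trans ?_
    rw [← add_mul]
    gcongr
    rw [← ENNReal.ofReal_pow hD0, ← ENNReal.ofReal_mul hC₀.le, ← ENNReal.ofReal_mul (by positivity),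
      ← ENNReal.ofReal_add (by positivity) (by positivity)]
    refine ENNReal.ofReal_le_ofReal ((add_le_add hb1 hb2).trans (le_of_eq ?_))
    rw [hC₁]
    ring
  refine (measure_inter_ball_le_of_local hD hx₀ (s := ρ * r) (by positivity) (by nlinarith) hW
    hlocal).trans ?_
  gcongr
  rw [← ENNReal.ofReal_pow hD0, ← ENNReal.ofReal_mul (by positivity), hvm]
  refine ENNReal.ofReal_le_ofReal ?_
  have : 0 ≤ u ^ (m / 4) := by positivity
  nlinarith

/-- Functions with nondegenerate jets are good with respect to absolutely decaying Federer
measures. -/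
theorem exists_jetsGood {μ : Measure (Fin d → K)} {W : Set (Fin d → K)} {D : ℝ} (hD0 : 0 ≤ D)
    (hD : ∀ x ∈ μ.support, ∀ s : ℝ, 0 < s → Metric.ball x (3 * s) ⊆ W →
      μ (Metric.ball x (3 * s)) ≤ ENNReal.ofReal D * μ (Metric.ball x s))
    {C₀ α₀ : ℝ} (hC₀ : 0 < C₀) (hα₀ : 0 < α₀) (hdec : AbsolutelyDecayingOn μ C₀ α₀ W) (l : ℕ) :
    ∃ α : ℝ, 0 < α ∧ ∀ Q : ℝ, 1 ≤ Q → ∃ C : ℝ, 0 < C ∧ JetsGood μ W l α Q C := by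
  induction l with
  | zero => exact ⟨1, one_pos, fun Q _ => ⟨1, one_pos, jetsGood_zero μ W Q⟩⟩
  | succ l ih =>
    obtain ⟨α, hα, h⟩ := ih
    exact ⟨min α α₀ / 4, by have := lt_min hα hα₀; positivity,
      fun Q hQ => jetsGood_succ hD0 hD hC₀ hα₀ hdec hα h hQ⟩

end GoodnessOfJets

/-! ### From Taylor expansions to scale-invariant jet bounds. -/

section ScaleInvariance

variable {K : Type*} [NontriviallyNormedField K] {d : ℕ}

/-- The size at scale `r` of the jet `J` at `y`. -/
noncomputable def jetSize (l : ℕ) (J : (Fin d → ℕ) → (Fin d → K) → K) (r : ℝ) (y : Fin d → K) : ℝ :=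
  ∑ β ∈ degIdx d l, ‖J β y‖ * r ^ (∑ i, β i)

theorem jetSize_nonneg (l : ℕ) (J : (Fin d → ℕ) → (Fin d → K) → K) {r : ℝ} (hr : 0 ≤ r)
    (y : Fin d → K) : 0 ≤ jetSize l J r y :=
  Finset.sum_nonneg fun _ _ => by positivity

theorem le_jetSize {l : ℕ} (J : (Fin d → ℕ) → (Fin d → K) → K) {r : ℝ} (hr : 0 ≤ r)
    (y : Fin d → K) {β : Fin d → ℕ} (hβ : ∑ i, β i ≤ l) :
    ‖J β y‖ * r ^ (∑ i, β i) ≤ jetSize l J r y :=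
  Finset.single_le_sum (f := fun β => ‖J β y‖ * r ^ (∑ i, β i)) (fun _ _ => by positivity)
    (mem_degIdx.2 hβ)

theorem pow_le_mul_pow {t T : ℝ} (ht : 0 ≤ t) (htT : t ≤ T) (hT : 1 ≤ T) {k m L : ℕ} (hkm : k ≤ m)
    (hmL : m ≤ L) : t ^ m ≤ T ^ L * t ^ k := by
  obtain ⟨e, rfl⟩ := Nat.exists_eq_add_of_le hkm
  rw [pow_add, mul_comm]
  gcongr
  calc t ^ e ≤ T ^ e := by gcongr
    _ ≤ T ^ L := pow_le_pow_right₀ hT (by omega)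

/-- The part of a Taylor polynomial of order at least `k`, in units of the jet size. The ratio `6`
is for two points of a ball of radius `3 * r`; higher powers of `‖h‖ / r` are reduced to the `k`-th
at the cost of `6 ^ (l + 1)`. -/
theorem norm_sum_divMon_le {l : ℕ} {F : ℝ} (hF : 1 ≤ F)
    (hdiv : ∀ γ ∈ degIdx d l, ∀ h : Fin d → K, ‖divMon γ h‖ ≤ F * ‖h‖ ^ (∑ i, γ i))
    (J : (Fin d → ℕ) → (Fin d → K) → K) {r : ℝ} (hr : 0 < r) (y h : Fin d → K)
    (hh : ‖h‖ / r ≤ 6) {β : Fin d → ℕ} (hβ : ∑ i, β i ≤ l) (k : ℕ) :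
    ‖∑ γ ∈ (degIdx d (l - ∑ i, β i)).filter (fun γ => k ≤ ∑ i, γ i), J (β + γ) y * divMon γ h‖ *
      r ^ (∑ i, β i) ≤
      (degIdx d l).card * F * 6 ^ (l + 1) * jetSize l J r y * (‖h‖ / r) ^ k := by
  have hN := jetSize_nonneg l J hr.le y
  set s := (degIdx d (l - ∑ i, β i)).filter (fun γ => k ≤ ∑ i, γ i)
  have hs : s ⊆ degIdx d l := by
    intro γ hγ
    rw [Finset.mem_filter, mem_degIdx] at hγ
    rw [mem_degIdx]
    omega
  have hterm : ∀ γ ∈ s, ‖J (β + γ) y * divMon γ h‖ * r ^ (∑ i, β i) ≤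
      F * 6 ^ (l + 1) * jetSize l J r y * (‖h‖ / r) ^ k := by
    intro γ hγ
    have hγ' := Finset.mem_filter.1 hγ
    rw [mem_degIdx] at hγ'
    have h1 := le_jetSize J hr.le y (β := β + γ) (l := l) (by
      simp only [Pi.add_apply, Finset.sum_add_distrib]
      omega)
    simp only [Pi.add_apply, Finset.sum_add_distrib, pow_add] at h1
    have h2 : ‖h‖ ^ (∑ i, γ i) = (‖h‖ / r) ^ (∑ i, γ i) * r ^ (∑ i, γ i) := by
      rw [← mul_pow, div_mul_cancel₀ _ hr.ne']
    have h3 : (‖h‖ / r) ^ (∑ i, γ i) ≤ 6 ^ (l + 1) * (‖h‖ / r) ^ k :=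
      pow_le_mul_pow (by positivity) hh (by norm_num) hγ'.2 (by omega)
    calc ‖J (β + γ) y * divMon γ h‖ * r ^ (∑ i, β i)
        ≤ ‖J (β + γ) y‖ * (F * ‖h‖ ^ (∑ i, γ i)) * r ^ (∑ i, β i) := by
          rw [norm_mul]
          gcongr
          exact hdiv γ (hs hγ) h
      _ = F * (‖h‖ / r) ^ (∑ i, γ i) * (‖J (β + γ) y‖ * (r ^ (∑ i, β i) * r ^ (∑ i, γ i))) := by
          rw [h2]
          ring
      _ ≤ F * (6 ^ (l + 1) * (‖h‖ / r) ^ k) * jetSize l J r y := by gcongr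
      _ = _ := by ring
  calc _ ≤ (∑ γ ∈ s, ‖J (β + γ) y * divMon γ h‖) * r ^ (∑ i, β i) := by
        gcongr
        exact norm_sum_le _ _
    _ = ∑ γ ∈ s, ‖J (β + γ) y * divMon γ h‖ * r ^ (∑ i, β i) := Finset.sum_mul _ _ _
    _ ≤ ∑ γ ∈ s, F * 6 ^ (l + 1) * jetSize l J r y * (‖h‖ / r) ^ k := Finset.sum_le_sum hterm
    _ = s.card * (F * 6 ^ (l + 1) * jetSize l J r y * (‖h‖ / r) ^ k) := by
        rw [Finset.sum_const, nsmul_eq_mul]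
    _ ≤ (degIdx d l).card * (F * 6 ^ (l + 1) * jetSize l J r y * (‖h‖ / r) ^ k) := by
        gcongr
    _ = _ := by ring

/-- If the error in the Taylor expansions is small compared to the size of the jet, then the jet
satisfies scale invariant bounds. -/
theorem exists_jetBound_of_hasTaylorJet (K : Type*) [NontriviallyNormedField K] (d l : ℕ) :
    ∃ Q : ℝ, 1 ≤ Q ∧ ∃ η : ℝ, 0 < η ∧ ∀ (J : (Fin d → ℕ) → (Fin d → K) → K) (x₀ : Fin d → K)
      (r B : ℝ), 0 < r → HasTaylorJet l J (Metric.ball x₀ (3 * r)) B →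
      0 ≤ B → 0 < jetSize l J r x₀ → B * r ^ (l + 1) ≤ η * jetSize l J r x₀ →
      ∃ a : ℝ, 0 < a ∧ JetBound l J (Metric.ball x₀ (3 * r)) r (Q * a) ∧
        (∀ y ∈ Metric.ball x₀ (3 * r), ∃ β, ∑ i, β i ≤ l ∧ a ≤ ‖J β y‖ * r ^ (∑ i, β i)) ∧
        ∀ y ∈ Metric.ball x₀ (3 * r), ‖J 0 y‖ ≤ Q * a := by
  obtain ⟨F, hF, hdiv⟩ := exists_norm_divMon_le K d l
  set N : ℝ := ((degIdx d l).card : ℝ) with hN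
  have hN1 : 1 ≤ N := by
    rw [hN]
    exact_mod_cast Finset.card_pos.2 ⟨0, zero_mem_degIdx⟩
  set T : ℝ := 6 ^ (l + 1) with hT
  have hT1 : 1 ≤ T := one_le_pow₀ (by norm_num)
  set P : ℝ := N * (N * F * T) with hP
  have hP1 : 1 ≤ P := by
    have h1 : 1 ≤ N * F := one_le_mul_of_one_le_of_one_le hN1 hF
    exact one_le_mul_of_one_le_of_one_le hN1 (one_le_mul_of_one_le_of_one_le h1 hT1)
  set Q₀ : ℝ := N * F * T * (P + 1) + T with hQ₀
  have hQ₀1 : P + 1 ≤ Q₀ := by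
    have h1 : 1 ≤ N * F * T :=
      one_le_mul_of_one_le_of_one_le (one_le_mul_of_one_le_of_one_le hN1 hF) hT1
    nlinarith
  -- This `η` makes the Taylor errors of all `N` components add up to at most half the jet size at
  -- `x₀`.
  refine ⟨Q₀ * (2 * P * N), ?_, 1 / (2 * N * T), by positivity, ?_⟩
  · have : 1 ≤ 2 * P * N := by nlinarith
    nlinarith
  intro J x₀ r B hr hJ hB ha hBa
  set a := jetSize l J r x₀ with hadef
  have hη : 1 / (2 * N * T) * a ≤ a := by
    rw [div_mul_eq_mul_div, one_mul, div_le_iff₀ (by positivity)]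
    have : 1 ≤ 2 * N * T := by nlinarith
    nlinarith
  have hscale : ∀ y ∈ Metric.ball x₀ (3 * r), ∀ z ∈ Metric.ball x₀ (3 * r), ‖z - y‖ / r ≤ 6 := by
    intro y hy z hz
    rw [div_le_iff₀ hr, ← dist_eq_norm]
    refine (dist_triangle_right z y x₀).trans ?_
    rw [Metric.mem_ball] at hy hz
    linarith
  have herr : ∀ β, ∑ i, β i ≤ l → ∀ y ∈ Metric.ball x₀ (3 * r), ∀ z ∈ Metric.ball x₀ (3 * r),
      ‖J β z - taylorPoly (fun γ => J (β + γ) y) (l - ∑ i, β i) (z - y)‖ * r ^ (∑ i, β i) ≤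
        1 / (2 * N * T) * a * (‖z - y‖ / r) ^ (l + 1 - ∑ i, β i) := by
    intro β hβ y hy z hz
    have h1 : ‖z - y‖ ^ (l + 1 - ∑ i, β i) * r ^ (∑ i, β i) =
        r ^ (l + 1) * (‖z - y‖ / r) ^ (l + 1 - ∑ i, β i) := by
      have e : l + 1 = (l + 1 - ∑ i, β i) + ∑ i, β i := by omega
      conv_rhs => rw [e, Nat.add_sub_cancel, pow_add, mul_right_comm, ← mul_pow,
        mul_div_cancel₀ _ hr.ne']
    calc _ ≤ B * ‖z - y‖ ^ (l + 1 - ∑ i, β i) * r ^ (∑ i, β i) := by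
          gcongr
          exact hJ β hβ y hy z hz
      _ = B * r ^ (l + 1) * (‖z - y‖ / r) ^ (l + 1 - ∑ i, β i) := by
          rw [mul_assoc, h1, mul_assoc]
      _ ≤ _ := by gcongr
  have hsize : ∀ y ∈ Metric.ball x₀ (3 * r), ∀ z ∈ Metric.ball x₀ (3 * r),
      jetSize l J r z ≤ P * jetSize l J r y + a / 2 := by
    intro y hy z hz
    have hterm : ∀ β ∈ degIdx d l, ‖J β z‖ * r ^ (∑ i, β i) ≤
        N * F * T * jetSize l J r y + 1 / (2 * N * T) * a * T := by
      intro β hβ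
      rw [mem_degIdx] at hβ
      have h1 := norm_sum_divMon_le hF hdiv J hr y (z - y) (hscale y hy z hz) hβ 0
      simp only [Nat.zero_le, Finset.filter_true, pow_zero, mul_one] at h1
      have h2 := herr β hβ y hy z hz
      have h3 : (‖z - y‖ / r) ^ (l + 1 - ∑ i, β i) ≤ T := by
        have := pow_le_mul_pow (k := 0) (m := l + 1 - ∑ i, β i) (L := l + 1)
          (by positivity) (hscale y hy z hz) (by norm_num) (Nat.zero_le _) (by omega)
        simpa using this
      have h4 : ‖J β z‖ ≤ ‖taylorPoly (fun γ => J (β + γ) y) (l - ∑ i, β i) (z - y)‖ +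
          ‖J β z - taylorPoly (fun γ => J (β + γ) y) (l - ∑ i, β i) (z - y)‖ := by
        have := norm_add_le (taylorPoly (fun γ => J (β + γ) y) (l - ∑ i, β i) (z - y))
          (J β z - taylorPoly (fun γ => J (β + γ) y) (l - ∑ i, β i) (z - y))
        rwa [add_sub_cancel] at this
      calc _ ≤ (‖taylorPoly (fun γ => J (β + γ) y) (l - ∑ i, β i) (z - y)‖ +
          ‖J β z - taylorPoly (fun γ => J (β + γ) y) (l - ∑ i, β i) (z - y)‖) *
            r ^ (∑ i, β i) := by gcongr
        _ ≤ _ := by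
          rw [add_mul]
          refine add_le_add h1 (h2.trans ?_)
          gcongr
    calc jetSize l J r z ≤ ∑ β ∈ degIdx d l,
          (N * F * T * jetSize l J r y + 1 / (2 * N * T) * a * T) := Finset.sum_le_sum hterm
      _ = N * (N * F * T * jetSize l J r y + 1 / (2 * N * T) * a * T) := by
          rw [Finset.sum_const, nsmul_eq_mul]
      _ = _ := by
          rw [hP]
          field_simp
  have hx₀ : x₀ ∈ Metric.ball x₀ (3 * r) := Metric.mem_ball_self (by positivity)
  have hupper : ∀ y ∈ Metric.ball x₀ (3 * r), jetSize l J r y ≤ (P + 1) * a := fun y hy => by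
    have := hsize x₀ hx₀ y hy
    linarith
  -- Expanding from `y` to `x₀` instead, the error `a / 2` is absorbed on the left.
  have hlower : ∀ y ∈ Metric.ball x₀ (3 * r), a ≤ 2 * P * jetSize l J r y := fun y hy => by
    have := hsize y hy x₀ hx₀
    linarith
  have hQa : Q₀ * (2 * P * N) * (a / (2 * P * N)) = Q₀ * a := by field_simp
  -- The case `k = 1` serves `diff` and `k = 2` serves `lin`: once the terms of order below `k` are
  -- subtracted, what remains is the tail plus the Taylor error, whose exponent is at least `k`.
  have hmain : ∀ k ≤ 2, ∀ β, ∑ i, β i + k ≤ l + 1 →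
      ∀ y ∈ Metric.ball x₀ (3 * r), ∀ z ∈ Metric.ball x₀ (3 * r),
      ∑ i, β i ≤ l →
      ‖(J β z - taylorPoly (fun γ => J (β + γ) y) (l - ∑ i, β i) (z - y)) +
        ∑ γ ∈ (degIdx d (l - ∑ i, β i)).filter (fun γ => k ≤ ∑ i, γ i),
          J (β + γ) y * divMon γ (z - y)‖ * r ^ (∑ i, β i) ≤ Q₀ * a * (‖z - y‖ / r) ^ k := by
    intro k hk β hβk y hy z hz hβ
    have h1 := norm_sum_divMon_le hF hdiv J hr y (z - y) (hscale y hy z hz) hβ k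
    have h2 := herr β hβ y hy z hz
    have h3 : (‖z - y‖ / r) ^ (l + 1 - ∑ i, β i) ≤ T * (‖z - y‖ / r) ^ k :=
      pow_le_mul_pow (by positivity) (hscale y hy z hz) (by norm_num) (by omega) (by omega)
    calc _ ≤ (‖J β z - taylorPoly (fun γ => J (β + γ) y) (l - ∑ i, β i) (z - y)‖ +
          ‖∑ γ ∈ (degIdx d (l - ∑ i, β i)).filter (fun γ => k ≤ ∑ i, γ i),
            J (β + γ) y * divMon γ (z - y)‖) * r ^ (∑ i, β i) := by
          gcongr
          exact norm_add_le _ _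
      _ ≤ 1 / (2 * N * T) * a * (‖z - y‖ / r) ^ (l + 1 - ∑ i, β i) +
          N * F * T * jetSize l J r y * (‖z - y‖ / r) ^ k := by
          rw [add_mul]
          exact add_le_add h2 h1
      _ ≤ a * (T * (‖z - y‖ / r) ^ k) + N * F * T * ((P + 1) * a) * (‖z - y‖ / r) ^ k := by
          gcongr
          exact hupper y hy
      _ = _ := by
          rw [hQ₀]
          ring
  -- The jet size is at least `a / (2 * P)` throughout, so one of its `N` terms is at least `a / (2
  -- * P * N)`.
  refine ⟨a / (2 * P * N), by positivity, ⟨?_, ?_⟩, ?_, ?_⟩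
  · intro β hβ y hy z hz
    rw [hQa]
    have h1 := hmain 1 (by norm_num) β (by omega) y hy z hz hβ
    rw [taylorPoly_eq_zero_add, pow_one, add_zero] at h1
    refine le_trans (le_of_eq ?_) h1
    congr 2
    ring
  · intro β hβ y hy z hz
    rw [hQa]
    have h1 := hmain 2 le_rfl β (by omega) y hy z hz (by omega)
    rw [taylorPoly_eq_linear_add _ (by omega), add_zero] at h1
    refine le_trans (le_of_eq ?_) h1
    congr 2
    ring
  · intro y hy
    by_contra! hcon
    have h1 : jetSize l J r y < ∑ _β ∈ degIdx d l, a / (2 * P * N) :=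
      Finset.sum_lt_sum_of_nonempty ⟨0, zero_mem_degIdx⟩ fun β hβ => hcon β (mem_degIdx.1 hβ)
    rw [Finset.sum_const, nsmul_eq_mul] at h1
    have h2 : (degIdx d l).card * (a / (2 * P * N)) = a / (2 * P) := by
      rw [← hN]
      field_simp
    rw [h2, lt_div_iff₀ (by positivity)] at h1
    linarith [hlower y hy]
  · intro y hy
    rw [hQa]
    have h1 := le_jetSize J hr.le y (l := l) (β := 0) (by simp)
    simp only [Pi.zero_apply, Finset.sum_const_zero, pow_zero, mul_one] at h1
    calc ‖J 0 y‖ ≤ (P + 1) * a := h1.trans (hupper y hy)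
      _ ≤ Q₀ * a := by gcongr

end ScaleInvariance

/-! ### Jets of affine combinations, uniformly in the coefficients. -/

section AffineCombinations

variable {K : Type*} [NontriviallyNormedField K] {d n : ℕ}

/-- The jet of the function `∑ c_j f_j + c₀`, where `D j` is the jet of `f_j`. -/
noncomputable def affineJet (D : Fin n → (Fin d → ℕ) → (Fin d → K) → K) (c : Fin n → K) (c₀ : K)
    (β : Fin d → ℕ) (y : Fin d → K) : K :=
  ∑ j, c j * D j β y + if β = 0 then c₀ else 0

theorem norm_sum_mul_le (c v : Fin n → K) {b : ℝ} (hv : ∀ j, ‖v j‖ ≤ b) :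
    ‖∑ j, c j * v j‖ ≤ n * ‖c‖ * b := by
  calc ‖∑ j, c j * v j‖ ≤ ∑ _j : Fin n, ‖c‖ * b := by
        refine norm_sum_le_of_le _ fun j _ => ?_
        rw [norm_mul]
        exact mul_le_mul (norm_le_pi_norm c j) (hv j) (norm_nonneg _) (norm_nonneg _)
    _ = n * ‖c‖ * b := by
        rw [Finset.sum_const, Finset.card_univ, Fintype.card_fin, nsmul_eq_mul]
        ring

/-- A constant has no Taylor error, so the bound depends on `‖c‖` alone and not on `c₀`. -/
theorem HasTaylorJet.affineJet {l : ℕ} {D : Fin n → (Fin d → ℕ) → (Fin d → K) → K}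
    {S : Set (Fin d → K)} {M : ℝ} (hD : ∀ j, HasTaylorJet l (D j) S M) (c : Fin n → K) (c₀ : K) :
    HasTaylorJet l (affineJet D c c₀) S (n * ‖c‖ * M) := by
  intro β hβ y hy z hz
  have e : taylorPoly (fun γ => _root_.affineJet D c c₀ (β + γ) y) (l - ∑ i, β i) (z - y) =
      ∑ j, c j * taylorPoly (fun γ => D j (β + γ) y) (l - ∑ i, β i) (z - y) +
        if β = 0 then c₀ else 0 := by
    have e1 : taylorPoly (fun γ : Fin d → ℕ => if β + γ = 0 then c₀ else 0) (l - ∑ i, β i) (z - y) =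
        if β = 0 then c₀ else 0 := by
      rw [taylorPoly, Finset.sum_eq_single 0]
      · simp
      · intro γ _ hγ
        have : β + γ ≠ 0 := fun h => hγ (by
          ext i
          have := congrFun h i
          simp only [Pi.add_apply, Pi.zero_apply] at this ⊢
          omega)
        simp [this]
      · simp [zero_mem_degIdx]
    rw [← e1]
    simp only [taylorPoly, _root_.affineJet, Finset.mul_sum, add_mul, Finset.sum_add_distrib,
      Finset.sum_mul]
    rw [Finset.sum_comm]
    simp only [mul_assoc]
  rw [e, _root_.affineJet, add_sub_add_right_eq_sub, ← Finset.sum_sub_distrib]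
  simp only [← mul_sub]
  refine (norm_sum_mul_le c _ fun j => hD j β hβ y hy z hz).trans (le_of_eq ?_)
  ring

theorem HasTaylorJet.continuousAt {l : ℕ} {D : (Fin d → ℕ) → (Fin d → K) → K}
    {S : Set (Fin d → K)} {M : ℝ} (hD : HasTaylorJet l D S M) {p : Fin d → K} (hS : S ∈ 𝓝 p)
    {β : Fin d → ℕ} (hβ : ∑ i, β i ≤ l) : ContinuousAt (D β) p := by
  have hsub : Tendsto (fun z => z - p) (𝓝 p) (𝓝 0) := by
    have : Tendsto (fun z => z - p) (𝓝 p) (𝓝 (p - p)) :=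
      (continuous_id.sub continuous_const).tendsto p
    rwa [sub_self] at this
  have h1 : Tendsto (fun z => taylorPoly (fun γ => D (β + γ) p) (l - ∑ i, β i) (z - p)) (𝓝 p)
      (𝓝 (D β p)) := by
    have := ((continuous_taylorPoly (fun γ => D (β + γ) p) (l - ∑ i, β i)).tendsto 0).comp hsub
    simp only [taylorPoly_zero_right, add_zero] at this
    exact this
  have h2 : Tendsto (fun z => D β z -
      taylorPoly (fun γ => D (β + γ) p) (l - ∑ i, β i) (z - p)) (𝓝 p) (𝓝 0) := by
    refine squeeze_zero_norm' (a := fun z => M * ‖z - p‖ ^ (l + 1 - ∑ i, β i)) ?_ ?_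
    · filter_upwards [hS] with z hz
      exact hD β hβ p (mem_of_mem_nhds hS) z hz
    · have h3 := (hsub.norm.pow (l + 1 - ∑ i, β i)).const_mul M
      rw [norm_zero, zero_pow (by omega), mul_zero] at h3
      exact h3
  have := h2.add h1
  simpa [ContinuousAt] using this

/-- A functional vanishing on a spanning family is zero, so evaluation on the family is injective,
hence bounded below in finite dimension. -/
theorem exists_lower_bound_of_span [CompleteSpace K] {ι : Type*} [Fintype ι] (v : ι → Fin n → K)
    (hv : Submodule.span K (range v) = ⊤) :
    ∃ κ : ℝ, 0 < κ ∧ ∀ c : Fin n → K, c ≠ 0 → ∃ i, κ * ‖c‖ ≤ ‖∑ j, c j * v i j‖ := by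
  let φ : (Fin n → K) →ₗ[K] (ι → K) :=
    { toFun := fun c i => ∑ j, c j * v i j
      map_add' := fun c c' => by ext i; simp [add_mul, Finset.sum_add_distrib]
      map_smul' := fun a c => by ext i; simp [Finset.mul_sum, mul_assoc] }
  have hφ : LinearMap.ker φ = ⊥ := by
    rw [LinearMap.ker_eq_bot']
    intro c hc
    let ψ : (Fin n → K) →ₗ[K] K :=
      { toFun := fun w => ∑ j, c j * w j
        map_add' := fun w w' => by simp [mul_add, Finset.sum_add_distrib]
        map_smul' := fun a w => by simp [Finset.mul_sum, mul_left_comm] }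
    have hψ : ψ = 0 := by
      refine LinearMap.ext_on hv ?_
      rintro _ ⟨i, rfl⟩
      exact congrFun hc i
    ext j
    have := LinearMap.congr_fun hψ (Pi.single j 1)
    simpa [ψ, Pi.single_apply] using this
  obtain ⟨C, hC, h⟩ := φ.exists_antilipschitzWith hφ
  have hC' : (0 : ℝ) < C := hC
  refine ⟨1 / C, by positivity, fun c hc => ?_⟩
  by_contra! hcon
  have h1 := h.le_mul_dist c 0
  rw [map_zero, dist_zero_right, dist_zero_right] at h1
  have hc0 : 0 < ‖c‖ := norm_pos_iff.2 hc
  have h2 : ‖φ c‖ < 1 / C * ‖c‖ := (pi_norm_lt_iff (by positivity)).2 hcon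
  have h3 : (C : ℝ) * ‖φ c‖ < C * (1 / C * ‖c‖) := by gcongr
  have h4 : (C : ℝ) * (1 / C * ‖c‖) = ‖c‖ := by field_simp
  linarith

/-- Over `ℚ_p` a ball does not determine its radius. Any radius is still controlled up to `κ`, by
moving along a coordinate; a coordinate must therefore exist. -/
theorem radius_le_of_ball_subset {κ : ℝ} (hκ0 : 0 ≤ κ)
    (hκ : ∀ t : ℝ, 0 < t → ∃ a : K, a ≠ 0 ∧ ‖a‖ < t ∧ t ≤ κ * ‖a‖) (i : Fin d)
    {x p : Fin d → K} {r R : ℝ} (hr : 0 < r) (h : Metric.ball x r ⊆ Metric.ball p R) :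
    r ≤ κ * (2 * R) := by
  obtain ⟨a, -, ha, hra⟩ := hκ r hr
  have h1 := h (Metric.mem_ball_self hr)
  have h2 : x + Pi.single i a ∈ Metric.ball p R := h (by
    rw [Metric.mem_ball, dist_eq_norm, add_sub_cancel_left, Pi.norm_single]
    exact ha)
  have h3 : ‖a‖ ≤ 2 * R := by
    have h4 : ‖a‖ = dist (x + Pi.single i a) x := by
      rw [dist_eq_norm, add_sub_cancel_left, Pi.norm_single]
    rw [h4]
    refine (dist_triangle_right _ _ p).trans ?_
    rw [Metric.mem_ball] at h1 h2
    linarith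
  exact hra.trans (by gcongr)

/-- Near a nondegenerate point, affine combinations of the components have scale invariant jet
bounds. -/
theorem exists_jetBound_affineJet [CompleteSpace K] {l : ℕ}
    {D : Fin n → (Fin d → ℕ) → (Fin d → K) → K} {p : Fin d → K} {R M : ℝ} (hR : 0 < R)
    (hM : 0 ≤ M) (hD : ∀ j, HasTaylorJet l (D j) (Metric.ball p R) M)
    (hspan : Submodule.span K {v : Fin n → K | ∃ β : Fin d → ℕ, 1 ≤ ∑ i, β i ∧ ∑ i, β i ≤ l ∧
      v = fun j => D j β p} = ⊤) :
    ∃ R' : ℝ, 0 < R' ∧ R' ≤ R ∧ ∃ Q : ℝ, 1 ≤ Q ∧ ∀ (c : Fin n → K) (c₀ : K), c ≠ 0 →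
      ∀ (x₀ : Fin d → K) (r : ℝ), 0 < r → Metric.ball x₀ (3 * r) ⊆ Metric.ball p R' →
      ∃ a : ℝ, 0 < a ∧ JetBound l (affineJet D c c₀) (Metric.ball x₀ (3 * r)) r (Q * a) ∧
        (∀ y ∈ Metric.ball x₀ (3 * r), ∃ β, ∑ i, β i ≤ l ∧
          a ≤ ‖affineJet D c c₀ β y‖ * r ^ (∑ i, β i)) ∧
        ∀ y ∈ Metric.ball x₀ (3 * r), ‖affineJet D c c₀ 0 y‖ ≤ Q * a := by
  obtain ⟨Q, hQ, η, hη, hmain⟩ := exists_jetBound_of_hasTaylorJet K d l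
  obtain ⟨κ', hκ'1, hκ'⟩ := exists_norm_shell K
  let I := (degIdx d l).filter fun β => 1 ≤ ∑ i, β i
  obtain ⟨κ, hκ, hlow⟩ := exists_lower_bound_of_span (fun (β : I) j => D j β.1 p) (by
    rw [← hspan]
    congr 1
    ext v
    constructor
    · rintro ⟨β, rfl⟩
      have := β.2
      simp only [I, Finset.mem_filter, mem_degIdx] at this
      exact ⟨β.1, this.2, this.1, rfl⟩
    · rintro ⟨β, h1, h2, rfl⟩
      exact ⟨⟨β, by simp only [I, Finset.mem_filter, mem_degIdx]; exact ⟨h2, h1⟩⟩, rfl⟩)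
  have hev : ∀ᶠ y in 𝓝 p, ∀ β ∈ I, ∀ j, ‖D j β y - D j β p‖ ≤ κ / (2 * (n + 1)) := by
    refine (eventually_all_finset _).2 fun β hβ => eventually_all.2 fun j => ?_
    simp only [I, Finset.mem_filter, mem_degIdx] at hβ
    have h1 := (hD j).continuousAt (Metric.ball_mem_nhds p hR) hβ.1
    have h2 : Tendsto (fun y => ‖D j β y - D j β p‖) (𝓝 p) (𝓝 0) := by
      have := (h1.tendsto.sub_const (D j β p)).norm
      simpa using this
    exact h2.eventually_le_const (by positivity)
  obtain ⟨R₁, hR₁, hR₁'⟩ := Metric.mem_nhds_iff.1 hev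
  -- The second bound makes `r` so small that the Taylor error `n * ‖c‖ * M * r ^ (l + 1)` is at
  -- most `η` times `κ / 2 * ‖c‖ * r ^ l`, a lower bound for the jet size coming from a derivative
  -- of positive order.
  set R' := min (min R R₁) (min 1 (η * κ / (2 * (n * M + 1))) / (2 * κ')) with hR'
  have hκ'0 : 0 < κ' := by linarith
  have hR'0 : 0 < R' := by positivity
  refine ⟨R', hR'0, (min_le_left _ _).trans (min_le_left _ _), Q, hQ, ?_⟩
  intro c c₀ hc x₀ r hr hball
  obtain ⟨β, hβc⟩ := hlow c hc
  have hβ := β.2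
  simp only [I, Finset.mem_filter, mem_degIdx] at hβ
  have hβ0 : β.1 ≠ 0 := by
    intro h
    rw [h] at hβ
    simp at hβ
  obtain ⟨i, -, -⟩ := exists_eq_add_single hβ0
  have hrR : r ≤ min 1 (η * κ / (2 * (n * M + 1))) := by
    have h1 := radius_le_of_ball_subset hκ'0.le hκ' i (show 0 < 3 * r by positivity) hball
    have h2 : κ' * (2 * R') ≤ min 1 (η * κ / (2 * (n * M + 1))) := by
      have h3 : R' ≤ min 1 (η * κ / (2 * (n * M + 1))) / (2 * κ') := min_le_right _ _
      rw [le_div_iff₀ (by positivity)] at h3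
      linarith
    linarith
  have hr1 : r ≤ 1 := hrR.trans (min_le_left _ _)
  have hrη : r ≤ η * κ / (2 * (n * M + 1)) := hrR.trans (min_le_right _ _)
  have hx₀ : x₀ ∈ Metric.ball p R' := hball (Metric.mem_ball_self (by positivity))
  have hc0 : 0 < ‖c‖ := norm_pos_iff.2 hc
  have hjx₀ : κ / 2 * ‖c‖ ≤ ‖affineJet D c c₀ β.1 x₀‖ := by
    have h1 : ‖∑ j, c j * (D j β.1 x₀ - D j β.1 p)‖ ≤ n * ‖c‖ * (κ / (2 * (n + 1))) :=
      norm_sum_mul_le c _ fun j => hR₁' (Metric.ball_subset_ball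
        ((min_le_left _ _).trans (min_le_right _ _)) hx₀) β.1 β.2 j
    have h2 : n * ‖c‖ * (κ / (2 * (n + 1))) ≤ κ / 2 * ‖c‖ := by
      have : (n : ℝ) * ‖c‖ * (κ / (2 * (n + 1))) = κ / 2 * ‖c‖ * (n / (n + 1)) := by field_simp
      rw [this]
      refine mul_le_of_le_one_right (by positivity) ?_
      rw [div_le_one (by positivity)]
      linarith
    have h3 : affineJet D c c₀ β.1 x₀ =
        ∑ j, c j * D j β.1 p + ∑ j, c j * (D j β.1 x₀ - D j β.1 p) := by
      rw [affineJet, if_neg hβ0, add_zero, ← Finset.sum_add_distrib]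
      exact Finset.sum_congr rfl fun j _ => by ring
    rw [h3]
    have h4 := norm_sub_le (∑ j, c j * D j β.1 p + ∑ j, c j * (D j β.1 x₀ - D j β.1 p))
      (∑ j, c j * (D j β.1 x₀ - D j β.1 p))
    rw [add_sub_cancel_right] at h4
    linarith
  have hsize : κ / 2 * ‖c‖ * r ^ l ≤ jetSize l (affineJet D c c₀) r x₀ := by
    calc κ / 2 * ‖c‖ * r ^ l ≤ ‖affineJet D c c₀ β.1 x₀‖ * r ^ (∑ i, β.1 i) := by
          gcongr ?_ * ?_
          exact pow_le_pow_of_le_one hr.le hr1 hβ.1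
      _ ≤ _ := le_jetSize _ hr.le x₀ hβ.1
  refine hmain (affineJet D c c₀) x₀ r (n * ‖c‖ * M) hr ?_ (by positivity) ?_ ?_
  · have h1 := HasTaylorJet.affineJet hD c c₀
    have hsub : Metric.ball x₀ (3 * r) ⊆ Metric.ball p R :=
      hball.trans (Metric.ball_subset_ball ((min_le_left _ _).trans (min_le_left _ _)))
    exact fun β hβ y hy z hz => h1 β hβ y (hsub hy) z (hsub hz)
  · exact lt_of_lt_of_le (by positivity) hsize
  · calc n * ‖c‖ * M * r ^ (l + 1) = n * M * r * (‖c‖ * r ^ l) := by ring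
      _ ≤ (n * M + 1) * (η * κ / (2 * (n * M + 1))) * (‖c‖ * r ^ l) := by
          gcongr
          linarith
      _ = η * (κ / 2 * ‖c‖ * r ^ l) := by field_simp
      _ ≤ _ := by gcongr

end AffineCombinations

/-! ### Bi-Lipschitz charts at generic points. -/

section GoodChart

variable {K : Type*} [NontriviallyNormedField K] {d n : ℕ}

theorem exists_lower_bound_of_linearIndependent [CompleteSpace K] (v : Fin d → Fin n → K)
    (hv : LinearIndependent K v) :
    ∃ κ : ℝ, 0 < κ ∧ ∀ h : Fin d → K, κ * ‖h‖ ≤ ‖∑ i, h i • v i‖ := by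
  obtain ⟨C, hC, h⟩ := (Fintype.linearCombination K v).exists_antilipschitzWith (by
    rw [LinearMap.ker_eq_bot]
    exact linearIndependent_iff_injective_fintypeLinearCombination.1 hv)
  have hC' : (0 : ℝ) < C := hC
  refine ⟨1 / C, by positivity, fun c => ?_⟩
  have h1 := h.le_mul_dist c 0
  rw [map_zero, dist_zero_right, dist_zero_right, Fintype.linearCombination_apply] at h1
  rw [div_mul_eq_mul_div, one_mul, div_le_iff₀ hC']
  linarith

/-- A map with Taylor jets is bi-Lipschitz near a nonsingular point. -/
theorem exists_bilipschitz [CompleteSpace K] {l : ℕ} (hl : 1 ≤ l) {f : (Fin d → K) → Fin n → K}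
    {D : Fin n → (Fin d → ℕ) → (Fin d → K) → K} {p : Fin d → K} {R M : ℝ} (hR : 0 < R)
    (hM : 0 ≤ M) (hD : ∀ j, HasTaylorJet l (D j) (Metric.ball p R) M)
    (hf : ∀ j, ∀ y ∈ Metric.ball p R, D j 0 y = f y j)
    (hind : LinearIndependent K fun i : Fin d => fun j => D j (Pi.single i 1) p) :
    ∃ R' κ L : ℝ, 0 < R' ∧ R' ≤ R ∧ 0 < κ ∧ 0 < L ∧ ∀ y ∈ Metric.ball p R',
      ∀ z ∈ Metric.ball p R', κ * dist z y ≤ dist (f z) (f y) ∧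
        dist (f z) (f y) ≤ L * dist z y := by
  obtain ⟨κ, hκ, hlow⟩ := exists_lower_bound_of_linearIndependent _ hind
  obtain ⟨F, hF, hdiv⟩ := exists_norm_divMon_le K d l
  set b := ∑ i : Fin d, ∑ j : Fin n, ‖D j (Pi.single i 1) p‖ with hb
  have hb0 : 0 ≤ b := by positivity
  set B := ∑ j, (jetSize l (D j) 1 p + 1) with hB
  have hBj : ∀ j, jetSize l (D j) 1 p + 1 ≤ B := fun j =>
    Finset.single_le_sum (f := fun j => jetSize l (D j) 1 p + 1)
      (fun j _ => by have := jetSize_nonneg l (D j) zero_le_one p; positivity) (Finset.mem_univ j)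
  have hB0 : 0 ≤ B := Finset.sum_nonneg fun j _ => by
    have := jetSize_nonneg l (D j) zero_le_one p
    positivity
  have hcont : ∀ j, ∀ β ∈ degIdx d l, ContinuousAt (D j β) p := fun j β hβ =>
    (hD j).continuousAt (Metric.ball_mem_nhds p hR) (mem_degIdx.1 hβ)
  have hev1 : ∀ᶠ y in 𝓝 p, ∀ j, jetSize l (D j) 1 y ≤ jetSize l (D j) 1 p + 1 := by
    refine eventually_all.2 fun j => ?_
    have : Tendsto (jetSize l (D j) 1) (𝓝 p) (𝓝 (jetSize l (D j) 1 p)) :=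
      tendsto_finsetSum _ fun β hβ => (hcont j β hβ).norm.mul_const _
    exact this.eventually_le_const (lt_add_one _)
  have hev2 : ∀ᶠ y in 𝓝 p, ∀ j, ∀ i : Fin d,
      ‖D j (Pi.single i 1) y - D j (Pi.single i 1) p‖ ≤ κ / (4 * (d + 1)) := by
    refine eventually_all.2 fun j => eventually_all.2 fun i => ?_
    have h1 := hcont j (Pi.single i 1) (mem_degIdx.2 (by simpa using hl))
    have h2 := (h1.tendsto.sub_const (D j (Pi.single i 1) p)).norm
    rw [sub_self, norm_zero] at h2
    exact h2.eventually_le_const (by positivity)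
  obtain ⟨R₁, hR₁, hR₁'⟩ := Metric.mem_nhds_iff.1 (hev1.and hev2)
  set A : ℝ := (degIdx d l).card * F * 6 ^ (l + 1) * B + M with hA
  have hA0 : 0 ≤ A := by positivity
  -- The increment of `f` is compared with the differential at `p`, which is at least `κ * ‖h‖`. The
  -- terms of order at least two together with the Taylor error, and the variation of the first
  -- derivatives, are each kept below `κ / 4 * ‖h‖`.
  set R' := min (min R R₁) (min (1 / 2) (κ / (8 * (A + 1)))) with hR'
  refine ⟨R', κ / 2, κ / 2 + d * b, by positivity, (min_le_left _ _).trans (min_le_left _ _),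
    by positivity, by positivity, ?_⟩
  intro y hy z hz
  have hsub : Metric.ball p R' ⊆ Metric.ball p R :=
    Metric.ball_subset_ball ((min_le_left _ _).trans (min_le_left _ _))
  have hyR₁ := hR₁' (Metric.ball_subset_ball ((min_le_left _ _).trans (min_le_right _ _)) hy)
  set h := z - y with hh
  have hh2 : ‖h‖ ≤ 2 * R' := by
    rw [hh, ← dist_eq_norm]
    refine (dist_triangle_right _ _ p).trans ?_
    rw [Metric.mem_ball] at hy hz
    linarith
  have hR'1 : R' ≤ 1 / 2 := (min_le_right _ _).trans (min_le_left _ _)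
  have hR'2 : R' ≤ κ / (8 * (A + 1)) := (min_le_right _ _).trans (min_le_right _ _)
  have hh1 : ‖h‖ ≤ 1 := by linarith
  have hhA : A * ‖h‖ ≤ κ / 4 := by
    calc A * ‖h‖ ≤ (A + 1) * (2 * (κ / (8 * (A + 1)))) := by
          gcongr
          · linarith
          · linarith
      _ = κ / 4 := by field_simp; norm_num
  have hmain : ‖(f z - f y) - ∑ i, h i • fun j => D j (Pi.single i 1) p‖ ≤ κ / 2 * ‖h‖ := by
    rw [pi_norm_le_iff_of_nonneg (by positivity)]
    intro j
    have h1 := hD j 0 (by simp) y (hsub hy) z (hsub hz)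
    simp only [zero_add, Pi.zero_apply, Finset.sum_const_zero, Nat.sub_zero] at h1
    rw [taylorPoly_eq_linear_add _ hl, ← hh] at h1
    have h2 := norm_sum_divMon_le hF hdiv (D j) one_pos y h (by rw [div_one]; linarith)
      (β := 0) (by simp) 2
    simp only [zero_add, Pi.zero_apply, Finset.sum_const_zero, Nat.sub_zero, pow_zero, mul_one,
      div_one] at h2
    have h3 : ‖∑ i, h i * (D j (Pi.single i 1) y - D j (Pi.single i 1) p)‖ ≤
        d * ‖h‖ * (κ / (4 * (d + 1))) := norm_sum_mul_le h _ fun i => hyR₁.2 j i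
    have h4 : d * ‖h‖ * (κ / (4 * (d + 1))) ≤ κ / 4 * ‖h‖ := by
      have : (d : ℝ) * ‖h‖ * (κ / (4 * (d + 1))) = κ / 4 * ‖h‖ * (d / (d + 1)) := by field_simp
      rw [this]
      refine mul_le_of_le_one_right (by positivity) ?_
      rw [div_le_one (by positivity)]
      linarith
    have h5 : jetSize l (D j) 1 y ≤ B := (hyR₁.1 j).trans (hBj j)
    have h6 : ‖h‖ ^ (l + 1) ≤ ‖h‖ ^ 2 := pow_le_pow_of_le_one (norm_nonneg _) hh1 (by omega)
    rw [hf j z (hsub hz), hf j y (hsub hy)] at h1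
    set S := ∑ γ ∈ (degIdx d l).filter (fun γ => 2 ≤ ∑ i, γ i), D j γ y * divMon γ h
    have e : ((f z - f y) - ∑ i, h i • fun j => D j (Pi.single i 1) p) j =
        (f z j - (f y j + ∑ i, D j (Pi.single i 1) y * h i + S)) + S +
          ∑ i, h i * (D j (Pi.single i 1) y - D j (Pi.single i 1) p) := by
      simp only [Pi.sub_apply, Finset.sum_apply, Pi.smul_apply, smul_eq_mul, mul_comm (h _),
        sub_mul, Finset.sum_sub_distrib]
      ring
    rw [e]
    calc _ ≤ M * ‖h‖ ^ 2 + (degIdx d l).card * F * 6 ^ (l + 1) * B * ‖h‖ ^ 2 +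
          κ / 4 * ‖h‖ := by
          refine norm_add_le_of_le (norm_add_le_of_le (h1.trans ?_) (h2.trans ?_)) (h3.trans h4)
          · gcongr
          · gcongr
      _ = A * ‖h‖ * ‖h‖ + κ / 4 * ‖h‖ := by rw [hA]; ring
      _ ≤ κ / 4 * ‖h‖ + κ / 4 * ‖h‖ := by gcongr
      _ = κ / 2 * ‖h‖ := by ring
  have hup : ‖∑ i, h i • fun j => D j (Pi.single i 1) p‖ ≤ d * b * ‖h‖ := by
    rw [pi_norm_le_iff_of_nonneg (by positivity)]
    intro j
    simp only [Finset.sum_apply, Pi.smul_apply, smul_eq_mul]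
    refine (norm_sum_mul_le h _ (b := b) fun i => ?_).trans (le_of_eq (by ring))
    calc ‖D j (Pi.single i 1) p‖ ≤ ∑ j : Fin n, ‖D j (Pi.single i 1) p‖ :=
          Finset.single_le_sum (f := fun j => ‖D j (Pi.single i 1) p‖)
            (fun _ _ => norm_nonneg _) (Finset.mem_univ j)
      _ ≤ b := Finset.single_le_sum (f := fun i : Fin d => ∑ j : Fin n, ‖D j (Pi.single i 1) p‖)
            (fun _ _ => by positivity) (Finset.mem_univ i)
  rw [dist_eq_norm z y, dist_eq_norm (f z), ← hh]
  have hlo := hlow h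
  constructor
  · have := norm_sub_le (f z - f y) ((f z - f y) - ∑ i, h i • fun j => D j (Pi.single i 1) p)
    rw [sub_sub_cancel] at this
    linarith
  · have := norm_add_le ((f z - f y) - ∑ i, h i • fun j => D j (Pi.single i 1) p)
      (∑ i, h i • fun j => D j (Pi.single i 1) p)
    rw [sub_add_cancel] at this
    linarith

variable [MeasurableSpace K]

/-- The quantitative properties of `μ` and `f` near a generic point `p`. -/
structure GoodChart (μ : Measure (Fin d → K)) (f : (Fin d → K) → Fin n → K) (p : Fin d → K)
    (R : ℝ) where
  D : ℝ
  C : ℝ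
  α : ℝ
  Q : ℝ
  κ : ℝ
  L : ℝ
  R_pos : 0 < R
  D_nonneg : 0 ≤ D
  C_pos : 0 < C
  α_pos : 0 < α
  Q_pos : 0 < Q
  κ_pos : 0 < κ
  L_pos : 0 < L
  lower : ∀ y ∈ Metric.ball p R, ∀ z ∈ Metric.ball p R, κ * dist z y ≤ dist (f z) (f y)
  upper : ∀ y ∈ Metric.ball p R, ∀ z ∈ Metric.ball p R, dist (f z) (f y) ≤ L * dist z y
  federer : ∀ x ∈ μ.support, ∀ s : ℝ, 0 < s → Metric.ball x (3 * s) ⊆ Metric.ball p R →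
    μ (Metric.ball x (3 * s)) ≤ ENNReal.ofReal D * μ (Metric.ball x s)
  good : ∀ (c : Fin n → K) (c₀ : K), c ≠ 0 → ∀ x ∈ μ.support, ∀ r : ℝ, 0 < r →
    Metric.ball x (3 * r) ⊆ Metric.ball p R → ∃ a : ℝ, 0 < a ∧
      (∀ ε : ℝ, 0 < ε → μ ({y | ‖∑ j, c j * f y j + c₀‖ < ε} ∩ Metric.ball x r) ≤
        ENNReal.ofReal (C * (ε / a) ^ α) * μ (Metric.ball x r)) ∧
      ∀ y ∈ Metric.ball x r, ‖∑ j, c j * f y j + c₀‖ ≤ Q * a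

variable [BorelSpace K] [ProperSpace K]

theorem exists_goodChart {l : ℕ} (hn : 0 < n) {f : (Fin d → K) → Fin n → K}
    {D : Fin n → (Fin d → ℕ) → (Fin d → K) → K} {p : Fin d → K} {R M : ℝ} (hR : 0 < R)
    (hM : 0 ≤ M) (hD : ∀ j, HasTaylorJet l (D j) (Metric.ball p R) M)
    (hf : ∀ j, ∀ y ∈ Metric.ball p R, D j 0 y = f y j)
    (hns : NonsingularAt f p) (hnd : NondegenerateAt l f p) {μ : Measure (Fin d → K)}
    {W : Set (Fin d → K)} (hW : W ∈ 𝓝 p) {A : ℝ} (hfed : FedererOn μ A W) {C₀ α₀ : ℝ}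
    (hC₀ : 0 < C₀) (hα₀ : 0 < α₀) (hdec : AbsolutelyDecayingOn μ C₀ α₀ W) :
    ∃ R' ≤ R, Metric.ball p R' ⊆ W ∧ Nonempty (GoodChart μ f p R') := by
  -- With `l = 0` there are no derivatives to span a nonzero space; this is where `0 < n` is used.
  have hl : 1 ≤ l := by
    by_contra hl
    have : NeZero n := ⟨hn.ne'⟩
    have h0 : {v : Fin n → K | ∃ β : Fin d → ℕ, 1 ≤ ∑ i, β i ∧ ∑ i, β i ≤ l ∧
        v = pderivMulti β f p} = ∅ := by
      rw [eq_empty_iff_forall_notMem]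
      rintro v ⟨β, h1, h2, -⟩
      omega
    rw [NondegenerateAt, h0, Submodule.span_empty] at hnd
    exact bot_ne_top hnd
  set E : (Fin d → ℕ) → (Fin d → K) → Fin n → K := fun β x j => D j β x
  have hE : ∀ β : Fin d → ℕ, ∑ i, β i + 1 ≤ l → ∀ x ∈ Metric.ball p R, ∀ i,
      HasDerivAt (fun t => E β (Function.update x i t)) (E (β + Pi.single i 1) x) (x i) :=
    fun β hβ x hx i => hasDerivAt_pi.2 fun j =>
      (hD j).hasDerivAt hM Metric.isOpen_ball hβ hx i
  have hfE : ∀ x ∈ Metric.ball p R, f x = E 0 x := fun x hx => by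
    ext j
    exact (hf j x hx).symm
  have hp : p ∈ Metric.ball p R := Metric.mem_ball_self hR
  -- The jets come from approximation; only here are they identified with the partial derivatives in
  -- the hypotheses.
  have hspan : Submodule.span K {v : Fin n → K | ∃ β : Fin d → ℕ, 1 ≤ ∑ i, β i ∧
      ∑ i, β i ≤ l ∧ v = fun j => D j β p} = ⊤ := by
    rw [← hnd]
    congr 1
    ext v
    refine exists_congr fun β => and_congr_right fun _ => and_congr_right fun h2 => ?_
    rw [pderivMulti_eq Metric.isOpen_ball hE hfE h2 p hp]
  have hind : LinearIndependent K fun i : Fin d => fun j => D j (Pi.single i 1) p := by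
    have e : ∀ i, pderivAt i f p = fun j => D j (Pi.single i 1) p := fun i => by
      have := pderivAt_iterate_eq Metric.isOpen_ball hE hfE i 1 (by simpa using hl) p hp
      simpa using this
    have : (fun i => pderivAt i f p) = fun i : Fin d => fun j => D j (Pi.single i 1) p :=
      funext e
    rw [← this]
    exact hns
  obtain ⟨R₁, κ, L, hR₁, hR₁R, hκ, hL, hlip⟩ := exists_bilipschitz hl hR hM hD hf hind
  obtain ⟨R₂, hR₂, hR₂R, Q, hQ, hjet⟩ := exists_jetBound_affineJet hR hM hD hspan
  obtain ⟨R₃, hR₃, hR₃W⟩ := Metric.mem_nhds_iff.1 hW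
  obtain ⟨B, -, hB⟩ := hfed
  -- The Federer constant is an arbitrary real number; it is made nonnegative so that its powers can
  -- be moved through `ENNReal.ofReal`.
  have hB' : ∀ x ∈ μ.support, ∀ s : ℝ, 0 < s → Metric.ball x (3 * s) ⊆ W →
      μ (Metric.ball x (3 * s)) ≤ ENNReal.ofReal (max B 0) * μ (Metric.ball x s) := by
    intro x hx s hs hxs
    refine (hB x hx s hs hxs).trans ?_
    gcongr
    exact le_max_left _ _
  obtain ⟨α, hα, hgood⟩ := exists_jetsGood (le_max_right B 0) hB' hC₀ hα₀ hdec l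
  obtain ⟨C, hC, hgood⟩ := hgood Q hQ
  set R' := min (min R₁ R₂) R₃
  have h1 : Metric.ball p R' ⊆ Metric.ball p R₁ :=
    Metric.ball_subset_ball ((min_le_left _ _).trans (min_le_left _ _))
  have h2 : Metric.ball p R' ⊆ Metric.ball p R₂ :=
    Metric.ball_subset_ball ((min_le_left _ _).trans (min_le_right _ _))
  have h3 : Metric.ball p R' ⊆ W := (Metric.ball_subset_ball (min_le_right _ _)).trans hR₃W
  refine ⟨R', ((min_le_left _ _).trans (min_le_left _ _)).trans hR₁R, h3, ⟨{
    D := max B 0, C := C, α := α, Q := Q, κ := κ, L := L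
    R_pos := by positivity
    D_nonneg := le_max_right _ _
    C_pos := hC
    α_pos := hα
    Q_pos := by linarith
    κ_pos := hκ
    L_pos := hL
    lower := fun y hy z hz => (hlip y (h1 hy) z (h1 hz)).1
    upper := fun y hy z hz => (hlip y (h1 hy) z (h1 hz)).2
    federer := fun x hx s hs hxs => hB' x hx s hs (hxs.trans h3)
    good := ?_ }⟩⟩
  intro c c₀ hc x hx r hr hxr
  obtain ⟨a, ha, hJ, hlow, hup⟩ := hjet c c₀ hc x r hr (hxr.trans h2)
  have hval : ∀ y ∈ Metric.ball x r, affineJet D c c₀ 0 y = ∑ j, c j * f y j + c₀ := by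
    intro y hy
    rw [affineJet, if_pos rfl]
    congr 1
    refine Finset.sum_congr rfl fun j _ => ?_
    rw [hf j y (Metric.ball_subset_ball hR₂R
      (h2 (hxr (Metric.ball_subset_ball (by linarith) hy))))]
  refine ⟨a, ha, fun ε hε => ?_, fun y hy => ?_⟩
  · have := hgood x hx r hr (hxr.trans h3) (affineJet D c c₀) a ha hJ hlow ε hε
    refine le_trans (measure_mono ?_) this
    rintro y ⟨hy, hyr⟩
    refine ⟨?_, hyr⟩
    simp only [mem_ofPred_eq] at hy ⊢
    rwa [hval y hyr]
  · rw [← hval y hy]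
    exact hup y (Metric.ball_subset_ball (by linarith) hy)

end GoodChart

/-! ### Transfer of the estimates to the image measure. -/

section Pushforward

variable {K : Type*} [NontriviallyNormedField K] {d n : ℕ} [MeasurableSpace K]

theorem GoodChart.continuousOn {μ : Measure (Fin d → K)} {f : (Fin d → K) → Fin n → K}
    {p : Fin d → K} {R : ℝ} (g : GoodChart μ f p R) : ContinuousOn f (Metric.ball p R) := by
  have : LipschitzOnWith ⟨g.L, g.L_pos.le⟩ f (Metric.ball p R) :=
    LipschitzOnWith.of_dist_le_mul fun y hy z hz => g.upper z hz y hy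
  exact this.continuousOn

theorem GoodChart.federer_pow {μ : Measure (Fin d → K)} {f : (Fin d → K) → Fin n → K}
    {p : Fin d → K} {R : ℝ} (g : GoodChart μ f p R) {x : Fin d → K} (hx : x ∈ μ.support) {s : ℝ}
    (hs : 0 < s) (m : ℕ) (h : Metric.ball x (3 ^ m * s) ⊆ Metric.ball p R) :
    μ (Metric.ball x (3 ^ m * s)) ≤ ENNReal.ofReal (g.D ^ m) * μ (Metric.ball x s) := by
  induction m with
  | zero => simp
  | succ m ih =>
    have e : (3 : ℝ) ^ (m + 1) * s = 3 * (3 ^ m * s) := by ring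
    rw [e] at h ⊢
    have h3 : 0 < 3 ^ m * s := by positivity
    refine (g.federer x hx _ h3 h).trans ?_
    rw [pow_succ, mul_comm (g.D ^ m), ENNReal.ofReal_mul g.D_nonneg, mul_assoc]
    gcongr
    exact ih ((Metric.ball_subset_ball (by linarith)).trans h)

/-- Needed because the affine maps tested for decay include the constants: when the set is nonempty,
the ratio of `ε` to the supremum is at least `1`. -/
theorem goodOn_const {ν : Measure (Fin n → K)} {C α : ℝ} (hC : 1 ≤ C) (hα : 0 < α) (c : K)
    (W : Set (Fin n → K)) : GoodOn ν C α (fun _ => c) W := by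
  intro x _ r _ _ ε hε
  by_cases hc : ‖c‖ < ε
  · have h1 : 1 ≤ ENNReal.ofReal ε / ⨆ y ∈ Metric.ball x r ∩ ν.support, ‖c‖ₑ := by
      have hsup : (⨆ y ∈ Metric.ball x r ∩ ν.support, ‖c‖ₑ) ≤ ‖c‖ₑ := iSup₂_le fun _ _ => le_rfl
      refine le_trans ?_ (ENNReal.div_le_div_left hsup _)
      rw [← ofReal_norm]
      have hle : ENNReal.ofReal ‖c‖ ≤ ENNReal.ofReal ε := ENNReal.ofReal_le_ofReal hc.le
      rcases eq_or_ne (ENNReal.ofReal ‖c‖) 0 with h0 | h0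
      · rw [h0, ENNReal.div_zero (by simpa using hε)]
        exact le_top
      · rw [ENNReal.le_div_iff_mul_le (Or.inl h0) (Or.inl ENNReal.ofReal_ne_top), one_mul]
        exact hle
    calc _ ≤ 1 * 1 * ν (Metric.ball x r) := by
          rw [one_mul, one_mul]
          exact measure_mono fun y hy => hy.1
      _ ≤ _ := by
          refine mul_le_mul' (mul_le_mul' ?_ ?_) le_rfl
          · rwa [ENNReal.one_le_ofReal]
          · exact ENNReal.one_le_rpow h1 hα
  · simp [hc]

variable [ProperSpace K]

/-- On a small ball about each point of `supp μ`, let `ε → 0` in the estimate for `a·f - c`;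
finiteness of the measure gives limit `0`, and the complement of the support is null. -/
theorem GoodChart.measure_hyperplane {μ : Measure (Fin d → K)} {f : (Fin d → K) → Fin n → K}
    {p : Fin d → K} {R : ℝ} (g : GoodChart μ f p R) (hμ : μ (Metric.ball p R) ≠ ∞)
    {a : Fin n → K} (ha : a ≠ 0) (c : K) :
    μ (f ⁻¹' {y | ∑ i, a i * y i = c} ∩ Metric.ball p R) = 0 := by
  set S := f ⁻¹' {y | ∑ i, a i * y i = c} ∩ Metric.ball p R with hS
  have hnull : μ (S ∩ μ.support) = 0 := by
    refine measure_null_of_locally_null _ ?_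
    rintro x ⟨⟨hxS, hxp⟩, hx⟩
    obtain ⟨r, hr, hrp⟩ := Metric.isOpen_iff.1 Metric.isOpen_ball x hxp
    have hr3 : 0 < r / 3 := by positivity
    obtain ⟨b, hb, hsmall, -⟩ := g.good a (-c) ha x hx (r / 3) hr3
      (by rwa [mul_div_cancel₀ _ three_ne_zero])
    refine ⟨S ∩ Metric.ball x (r / 3), ?_, ?_⟩
    · refine inter_mem ?_ (mem_nhdsWithin_of_mem_nhds (Metric.ball_mem_nhds x hr3))
      exact mem_of_superset self_mem_nhdsWithin inter_subset_left
    · have hfin : μ (Metric.ball x (r / 3)) ≠ ∞ :=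
        ((measure_mono ((Metric.ball_subset_ball (by linarith)).trans hrp)).trans_lt
          (lt_top_iff_ne_top.2 hμ)).ne
      have hlim : Tendsto (fun ε : ℝ => ENNReal.ofReal (g.C * (ε / b) ^ g.α) *
          μ (Metric.ball x (r / 3))) (𝓝[>] 0) (𝓝 0) := by
        have h1 : Tendsto (fun ε : ℝ => g.C * (ε / b) ^ g.α) (𝓝 0) (𝓝 0) := by
          have hc : Continuous fun ε : ℝ => g.C * (ε / b) ^ g.α :=
            continuous_const.mul ((continuous_id.div_const b).rpow_const
              fun _ => Or.inr g.α_pos.le)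
          have := hc.tendsto 0
          simpa [Real.zero_rpow g.α_pos.ne'] using this
        have h1' : Tendsto (fun ε : ℝ => g.C * (ε / b) ^ g.α) (𝓝[>] 0) (𝓝 0) :=
          h1.mono_left nhdsWithin_le_nhds
        have h2 := ENNReal.Tendsto.mul_const (b := μ (Metric.ball x (r / 3)))
          (ENNReal.tendsto_ofReal h1') (Or.inr hfin)
        simpa using h2
      refine le_antisymm (ge_of_tendsto hlim ?_) zero_le
      filter_upwards [self_mem_nhdsWithin] with ε hε
      refine (measure_mono ?_).trans (hsmall ε hε)
      rintro z ⟨⟨hz, -⟩, hzr⟩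
      refine ⟨?_, hzr⟩
      have hz : ∑ i, a i * f z i = c := hz
      have hε : 0 < ε := hε
      simp [hz, hε]
  refine le_antisymm ?_ zero_le
  calc μ S ≤ μ ((S ∩ μ.support) ∪ μ.supportᶜ) := measure_mono fun x hx => by
        by_cases h : x ∈ μ.support
        · exact Or.inl ⟨hx, h⟩
        · exact Or.inr h
    _ ≤ μ (S ∩ μ.support) + μ μ.supportᶜ := measure_union_le _ _
    _ = 0 := by rw [hnull, Measure.measure_compl_support, add_zero]

variable [BorelSpace K]

/-- A chart around `p`, a point `x₁` in it, and a measure `ν` which near `f x₁` is the image of the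
restriction of `μ` to a ball around `x₁`. -/
structure LocalImage {μ : Measure (Fin d → K)} {f : (Fin d → K) → Fin n → K} {p : Fin d → K}
    {R : ℝ} (g : GoodChart μ f p R) (x₁ : Fin d → K) (ρ : ℝ) (ν : Measure (Fin n → K)) (σ : ℝ) :
    Prop where
  σ_pos : 0 < σ
  sub : Metric.ball x₁ ρ ⊆ Metric.ball p R
  lt : σ / g.κ < ρ
  eq : ∀ S, MeasurableSet S → S ⊆ Metric.ball (f x₁) σ → ν S = μ (Metric.ball x₁ ρ ∩ f ⁻¹' S)

/-- The image under `f` of the part of `supp μ` in a closed ball is compact. A point outside it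
would have an open neighbourhood whose preimage in the chart misses `supp μ`, hence of `ν`-measure
zero. The lower Lipschitz bound confines the preimages to that closed ball. -/
theorem LocalImage.exists_preimage {μ : Measure (Fin d → K)} {f : (Fin d → K) → Fin n → K}
    {p : Fin d → K} {R : ℝ} {g : GoodChart μ f p R} {x₁ : Fin d → K} {ρ : ℝ}
    {ν : Measure (Fin n → K)} {σ : ℝ} (h : LocalImage g x₁ ρ ν σ) {y : Fin n → K}
    (hy : y ∈ ν.support) (hyσ : y ∈ Metric.ball (f x₁) σ) :
    ∃ z ∈ Metric.closedBall x₁ (σ / g.κ), z ∈ μ.support ∧ f z = y := by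
  have hρ : 0 < ρ := lt_trans (div_pos h.σ_pos g.κ_pos) h.lt
  have hx₁ : x₁ ∈ Metric.ball p R := h.sub (Metric.mem_ball_self hρ)
  set Z := Metric.closedBall x₁ (σ / g.κ) ∩ μ.support
  have hZ : IsCompact Z := (isCompact_closedBall _ _).inter_right Measure.isClosed_support
  have hZsub : Z ⊆ Metric.ball p R := fun z hz =>
    h.sub (Metric.mem_ball.2 ((Metric.mem_closedBall.1 hz.1).trans_lt h.lt))
  have hfZ : IsClosed (f '' Z) := (hZ.image_of_continuousOn (g.continuousOn.mono hZsub)).isClosed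
  by_contra! hcon
  have hyZ : y ∉ f '' Z := by
    rintro ⟨z, hz, hzy⟩
    exact hcon z hz.1 hz.2 hzy
  have hopen : IsOpen (Metric.ball (f x₁) σ ∩ (f '' Z)ᶜ) :=
    Metric.isOpen_ball.inter hfZ.isOpen_compl
  have hpos := (Measure.mem_support_iff_forall y).1 hy _ (hopen.mem_nhds ⟨hyσ, hyZ⟩)
  rw [h.eq _ hopen.measurableSet inter_subset_left] at hpos
  refine hpos.ne' (le_antisymm ?_ zero_le)
  rw [← Measure.measure_compl_support (μ := μ)]
  refine measure_mono ?_
  rintro x ⟨hx, hxσ, hxZ⟩ hxs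
  refine hxZ ⟨x, ⟨?_, hxs⟩, rfl⟩
  rw [Metric.mem_closedBall, le_div_iff₀ g.κ_pos, mul_comm]
  exact (g.lower x₁ hx₁ x (h.sub hx)).trans (Metric.mem_ball.1 hxσ).le

/-- Comparison of the measures of balls in the image and in the source. -/
theorem LocalImage.ball_estimates {μ : Measure (Fin d → K)} {f : (Fin d → K) → Fin n → K}
    {p : Fin d → K} {R : ℝ} {g : GoodChart μ f p R} {x₁ : Fin d → K} {ρ : ℝ}
    {ν : Measure (Fin n → K)} {σ : ℝ} (h : LocalImage g x₁ ρ ν σ) {z : Fin d → K}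
    (hz : z ∈ Metric.ball x₁ ρ) {r : ℝ} (hr : Metric.ball (f z) r ⊆ Metric.ball (f x₁) σ) :
    (∀ S, MeasurableSet S → S ⊆ Metric.ball (f z) r →
      ν S ≤ μ (f ⁻¹' S ∩ Metric.ball z (r / g.κ))) ∧
    (Metric.ball z (r / g.L) ⊆ Metric.ball x₁ ρ →
      μ (Metric.ball z (r / g.L)) ≤ ν (Metric.ball (f z) r)) := by
  constructor
  · intro S hS hSr
    rw [h.eq S hS (hSr.trans hr)]
    refine measure_mono ?_
    rintro x ⟨hx, hxS⟩
    refine ⟨hxS, ?_⟩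
    rw [Metric.mem_ball, lt_div_iff₀ g.κ_pos, mul_comm]
    exact (g.lower z (h.sub hz) x (h.sub hx)).trans_lt (Metric.mem_ball.1 (hSr hxS))
  · intro hsub
    rw [h.eq _ Metric.isOpen_ball.measurableSet hr]
    refine measure_mono fun x hx => ⟨hsub hx, ?_⟩
    have h1 := g.upper z (h.sub hz) x (h.sub (hsub hx))
    rw [Metric.mem_ball, lt_div_iff₀ g.L_pos, mul_comm] at hx
    exact h1.trans_lt hx

/-- The image measure is Federer and decaying near the image of a generic point. -/
theorem LocalImage.exists_federerOn_decayingOn {μ : Measure (Fin d → K)}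
    {f : (Fin d → K) → Fin n → K} {p : Fin d → K} {R : ℝ} {g : GoodChart μ f p R}
    (hn : 0 < n) {x₁ : Fin d → K} {ρ : ℝ} {ν : Measure (Fin n → K)} {σ₀ : ℝ}
    (h₀ : LocalImage g x₁ ρ ν σ₀) :
    ∃ W : Set (Fin n → K), IsOpen W ∧ f x₁ ∈ W ∧
      ∃ C α D : ℝ, 0 < C ∧ 0 < α ∧ 0 < D ∧ FedererOn ν D W ∧ DecayingOn ν C α W := by
  obtain ⟨κ', hκ'1, hκ'⟩ := exists_norm_shell K
  have hκ'0 : 0 < κ' := by linarith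
  have hκ := g.κ_pos
  have hL := g.L_pos
  have hρ : 0 < ρ := lt_trans (div_pos h₀.σ_pos hκ) h₀.lt
  -- The preimage of a ball of radius `r` contains a ball of radius `r / g.L`, and that of the
  -- tripled ball lies in one of radius `3 * r / g.κ`; `m` triplings lead from the first to beyond
  -- the second.
  obtain ⟨m, hm⟩ := pow_unbounded_of_one_lt (3 * g.L / g.κ) (by norm_num : (1 : ℝ) < 3)
  have hmL : 3 / g.κ ≤ 3 ^ m / g.L := by
    rw [div_le_div_iff₀ hκ hL]
    rw [div_lt_iff₀ hκ] at hm
    linarith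
  set T := 3 ^ m / g.L with hT
  have hT0 : 0 < T := by positivity
  -- A ball inside `Metric.ball (f x₁) σ` may have radius up to `κ' * (2 * σ)`; this `σ` keeps all
  -- the enlarged source balls inside the chart.
  set σ := min σ₀ (ρ / (2 * (1 / g.κ + T * (κ' * 2)))) with hσ
  have hσ0 : 0 < σ := lt_min h₀.σ_pos (by positivity)
  have hσρ : σ / g.κ + T * (κ' * (2 * σ)) ≤ ρ / 2 := by
    have h1 : σ ≤ ρ / (2 * (1 / g.κ + T * (κ' * 2))) := min_le_right _ _
    rw [le_div_iff₀ (by positivity)] at h1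
    have h2 : σ / g.κ + T * (κ' * (2 * σ)) = σ * (2 * (1 / g.κ + T * (κ' * 2))) / 2 := by
      field_simp
    rw [h2]
    linarith
  have h : LocalImage g x₁ ρ ν σ := by
    refine ⟨hσ0, h₀.sub, ?_, fun S hS hSσ => h₀.eq S hS
      (hSσ.trans (Metric.ball_subset_ball (min_le_left _ _)))⟩
    have : 0 ≤ T * (κ' * (2 * σ)) := by positivity
    linarith
  have hball : ∀ z ∈ Metric.closedBall x₁ (σ / g.κ), ∀ r : ℝ, 0 < r →
      Metric.ball (f z) r ⊆ Metric.ball (f x₁) σ → Metric.ball z (T * r) ⊆ Metric.ball x₁ ρ := by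
    intro z hz r hr hrσ
    have h1 := radius_le_of_ball_subset hκ'0.le hκ' ⟨0, hn⟩ hr hrσ
    refine Metric.ball_subset_ball' ?_
    have h2 : T * r ≤ T * (κ' * (2 * σ)) := by gcongr
    have h3 := Metric.mem_closedBall.1 hz
    linarith
  have hcomp : ∀ z ∈ Metric.closedBall x₁ (σ / g.κ), z ∈ μ.support → ∀ r : ℝ, 0 < r →
      Metric.ball (f z) r ⊆ Metric.ball (f x₁) σ →
      μ (Metric.ball z (T * r)) ≤ ENNReal.ofReal (g.D ^ m) * ν (Metric.ball (f z) r) := by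
    intro z hz hzs r hr hrσ
    have hT1 : T * r = 3 ^ m * (r / g.L) := by rw [hT]; ring
    have hb := hball z hz r hr hrσ
    have h1 := g.federer_pow hzs (show 0 < r / g.L by positivity) m (by
      rw [← hT1]
      exact hb.trans h.sub)
    rw [← hT1] at h1
    refine h1.trans ?_
    gcongr
    have hzρ : z ∈ Metric.ball x₁ ρ :=
      Metric.mem_ball.2 ((Metric.mem_closedBall.1 hz).trans_lt h.lt)
    refine (h.ball_estimates hzρ hrσ).2 ((Metric.ball_subset_ball ?_).trans hb)
    rw [hT1]
    have : (1 : ℝ) ≤ 3 ^ m := one_le_pow₀ (by norm_num)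
    have : 0 < r / g.L := by positivity
    nlinarith
  have hκT : ∀ r : ℝ, 0 < r → 3 * (r / g.κ) ≤ T * r := fun r hr => by
    calc 3 * (r / g.κ) = 3 / g.κ * r := by ring
      _ ≤ T * r := by gcongr
  -- The summand `1` provides `1 ≤ C`, which the constant maps require.
  set C := g.C * g.Q ^ g.α * g.D ^ m + 1 with hC
  have hC1 : 1 ≤ C := by
    have := g.C_pos
    have := g.Q_pos
    have := g.D_nonneg
    have : 0 ≤ g.C * g.Q ^ g.α * g.D ^ m := by positivity
    linarith
  refine ⟨Metric.ball (f x₁) σ, Metric.isOpen_ball, Metric.mem_ball_self hσ0, C, g.α,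
    g.D ^ m + 1, by linarith, g.α_pos, by have := g.D_nonneg; positivity,
    ⟨g.D ^ m, by linarith, ?_⟩, ?_⟩
  · intro y hy r hr hyr
    obtain ⟨z, hz, hzs, rfl⟩ := h.exists_preimage hy (hyr (Metric.mem_ball_self (by positivity)))
    have hzρ : z ∈ Metric.ball x₁ ρ :=
      Metric.mem_ball.2 ((Metric.mem_closedBall.1 hz).trans_lt h.lt)
    have hr' : Metric.ball (f z) r ⊆ Metric.ball (f x₁) σ :=
      (Metric.ball_subset_ball (by linarith)).trans hyr
    calc ν (Metric.ball (f z) (3 * r))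
        ≤ μ (f ⁻¹' Metric.ball (f z) (3 * r) ∩ Metric.ball z (3 * r / g.κ)) :=
          (h.ball_estimates hzρ hyr).1 _ Metric.isOpen_ball.measurableSet Subset.rfl
      _ ≤ μ (Metric.ball z (T * r)) := by
          refine measure_mono (inter_subset_right.trans (Metric.ball_subset_ball ?_))
          have := hκT r hr
          rwa [mul_div_assoc]
      _ ≤ _ := hcomp z hz hzs r hr hr'
  · intro a c
    rcases eq_or_ne a 0 with rfl | ha
    · simp only [Pi.zero_apply, zero_mul, Finset.sum_const_zero, zero_add]
      exact goodOn_const hC1 g.α_pos c _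
    intro y hy r hr hyr ε hε
    obtain ⟨z, hz, hzs, rfl⟩ := h.exists_preimage hy (hyr (Metric.mem_ball_self hr))
    have hzρ : z ∈ Metric.ball x₁ ρ :=
      Metric.mem_ball.2 ((Metric.mem_closedBall.1 hz).trans_lt h.lt)
    have hb := hball z hz r hr hyr
    have hrκ : 0 < r / g.κ := by positivity
    obtain ⟨b, hb0, hsmall, hbound⟩ := g.good a c ha z hzs (r / g.κ) hrκ
      ((Metric.ball_subset_ball (hκT r hr)).trans (hb.trans h.sub))
    have hQ := g.Q_pos
    have hmeas : MeasurableSet {y | y ∈ Metric.ball (f z) r ∧ ‖∑ i, a i * y i + c‖ < ε} := by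
      refine (Metric.isOpen_ball.inter (isOpen_lt (Continuous.norm ?_)
        continuous_const)).measurableSet
      fun_prop
    -- Only points of `supp ν` count, and each has a preimage within `r / g.κ` of `z`, where the
    -- chart bounds the function by `g.Q * b`.
    have hsup : (⨆ y ∈ Metric.ball (f z) r ∩ ν.support, ‖∑ i, a i * y i + c‖ₑ) ≤
        ENNReal.ofReal (g.Q * b) := by
      refine iSup₂_le ?_
      rintro y' ⟨hy'r, hy's⟩
      obtain ⟨z', hz', -, rfl⟩ := h.exists_preimage hy's (hyr hy'r)
      rw [← ofReal_norm]
      refine ENNReal.ofReal_le_ofReal (hbound z' ?_)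
      have hz'ρ : z' ∈ Metric.ball x₁ ρ :=
        Metric.mem_ball.2 ((Metric.mem_closedBall.1 hz').trans_lt h.lt)
      rw [Metric.mem_ball, lt_div_iff₀ hκ, mul_comm]
      exact (g.lower z (h.sub hzρ) z' (h.sub hz'ρ)).trans_lt (Metric.mem_ball.1 hy'r)
    have hcoef : ENNReal.ofReal (g.C * (ε / b) ^ g.α) * ENNReal.ofReal (g.D ^ m) ≤
        ENNReal.ofReal C * (ENNReal.ofReal ε /
          ⨆ y ∈ Metric.ball (f z) r ∩ ν.support, ‖∑ i, a i * y i + c‖ₑ) ^ g.α := by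
      have h1 : ENNReal.ofReal ((ε / (g.Q * b)) ^ g.α) ≤ (ENNReal.ofReal ε /
          ⨆ y ∈ Metric.ball (f z) r ∩ ν.support, ‖∑ i, a i * y i + c‖ₑ) ^ g.α := by
        rw [← ENNReal.ofReal_rpow_of_nonneg (by positivity) g.α_pos.le]
        refine ENNReal.rpow_le_rpow ?_ g.α_pos.le
        rw [ENNReal.ofReal_div_of_pos (by positivity)]
        exact ENNReal.div_le_div_left hsup _
      refine le_trans ?_ (mul_le_mul' le_rfl h1)
      have hCp := g.C_pos
      rw [← ENNReal.ofReal_mul (by positivity), ← ENNReal.ofReal_mul (by linarith)]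
      refine ENNReal.ofReal_le_ofReal ?_
      have e : ε / b = g.Q * (ε / (g.Q * b)) := by field_simp
      rw [e, Real.mul_rpow hQ.le (by positivity), hC, add_mul]
      have : 0 ≤ 1 * (ε / (g.Q * b)) ^ g.α := by positivity
      linarith
    calc _ ≤ μ (f ⁻¹' {y | y ∈ Metric.ball (f z) r ∧ ‖∑ i, a i * y i + c‖ < ε} ∩
          Metric.ball z (r / g.κ)) :=
          (h.ball_estimates hzρ hyr).1 _ hmeas fun y hy => hy.1
      _ ≤ μ ({x | ‖∑ i, a i * f x i + c‖ < ε} ∩ Metric.ball z (r / g.κ)) :=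
          measure_mono fun x hx => ⟨hx.1.2, hx.2⟩
      _ ≤ ENNReal.ofReal (g.C * (ε / b) ^ g.α) * μ (Metric.ball z (r / g.κ)) := hsmall ε hε
      _ ≤ ENNReal.ofReal (g.C * (ε / b) ^ g.α) *
          (ENNReal.ofReal (g.D ^ m) * ν (Metric.ball (f z) r)) := by
          refine mul_le_mul' le_rfl (le_trans (measure_mono (Metric.ball_subset_ball ?_))
            (hcomp z hz hzs r hr hyr))
          have := hκT r hr
          linarith
      _ ≤ _ := by
          rw [← mul_assoc]
          exact mul_le_mul' hcoef le_rfl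

end Pushforward

theorem continuousOn_of_hasTaylorApprox {K : Type*} [NontriviallyNormedField K] [CharZero K]
    [ProperSpace K] {d n l : ℕ}
    {f : (Fin d → K) → Fin n → K} {U : Set (Fin d → K)}
    (hf : ∀ p ∈ U, ∃ R > 0, ∃ M ≥ 0, Metric.ball p R ⊆ U ∧
      ∀ j, HasTaylorApprox l (fun x => f x j) (Metric.ball p R) M) : ContinuousOn f U := by
  intro p hp
  obtain ⟨R, hR, M, hM, -, hT⟩ := hf p hp
  obtain ⟨R₁, hR₁, -, M₁, hM₁, D, hD, hD0⟩ := exists_jets_of_hasTaylorApprox hR hM hT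
  refine ContinuousAt.continuousWithinAt (continuousAt_pi.2 fun j => ?_)
  refine ((hD j).continuousAt (Metric.ball_mem_nhds p hR₁) (β := 0) (by simp)).congr ?_
  filter_upwards [Metric.ball_mem_nhds p hR₁] with y hy using hD0 j y hy

/-! ### Friendliness of the pushforward, locally and globally. -/

section Friendly

variable {K : Type*} [NontriviallyNormedField K] {d n : ℕ} [MeasurableSpace K]

theorem FedererOn.mono {X : Type*} [MetricSpace X] [MeasurableSpace X] {μ : Measure X} {D : ℝ}
    {U V : Set X} (h : FedererOn μ D U) (hVU : V ⊆ U) : FedererOn μ D V := by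
  obtain ⟨D', hD', h⟩ := h
  exact ⟨D', hD', fun x hx r hr hV => h x hx r hr (hV.trans hVU)⟩

theorem AbsolutelyDecayingOn.mono {μ : Measure (Fin n → K)} {C α : ℝ} {U V : Set (Fin n → K)}
    (h : AbsolutelyDecayingOn μ C α U) (hVU : V ⊆ U) : AbsolutelyDecayingOn μ C α V :=
  fun a c x hx r hr hV => h a c x hx r hr (hV.trans hVU)

/-- The points near which `ν` is Federer and decaying. -/
def friendlyPoints (ν : Measure (Fin n → K)) : Set (Fin n → K) :=
  {y | ∃ W : Set (Fin n → K), IsOpen W ∧ y ∈ W ∧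
    ∃ C α D : ℝ, 0 < C ∧ 0 < α ∧ 0 < D ∧ FedererOn ν D W ∧ DecayingOn ν C α W}

theorem isOpen_friendlyPoints (ν : Measure (Fin n → K)) : IsOpen (friendlyPoints ν) :=
  isOpen_iff_forall_mem_open.2 fun _ ⟨W, hW, hy, h⟩ => ⟨W, fun _ hz => ⟨W, hW, hz, h⟩, hW, hy⟩

/-- The target is a point: there are no hyperplanes, every ball is the whole space and every affine
map is constant. This case is separate because nondegeneracy then gives no information. -/
theorem isFriendly_of_fin_zero (ν : Measure (Fin 0 → K)) (hν : IsLocallyFiniteMeasure ν) :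
    IsFriendly ν := by
  refine ⟨hν, fun a c ha => (ha (Subsingleton.elim _ _)).elim, Eventually.of_forall fun x =>
    ⟨univ, isOpen_univ, mem_univ x, 1, 1, 2, one_pos, one_pos, two_pos,
      ⟨1, one_lt_two, fun y _ r hr _ => ?_⟩, fun a c => ?_⟩⟩
  · rw [ENNReal.ofReal_one, one_mul]
    refine measure_mono fun z _ => ?_
    rw [Subsingleton.elim z y]
    exact Metric.mem_ball_self hr
  · simpa using goodOn_const le_rfl one_pos c univ

variable [BorelSpace K] [ProperSpace K]

/-- The lower Lipschitz bound holds on all of `V`, so the points of `V` sent near `f x` are near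
`x`. Every point of `V` therefore has the local image property, and no exceptional set remains. -/
theorem GoodChart.isFriendly_map_restrict {μ : Measure (Fin d → K)}
    {f : (Fin d → K) → Fin n → K} {p : Fin d → K} {R : ℝ} (g : GoodChart μ f p R) (hn : 0 < n)
    (hfin : μ (Metric.ball p R) ≠ ∞) {V : Set (Fin d → K)} (hV : IsOpen V)
    (hVR : V ⊆ Metric.ball p R) : IsFriendly ((μ.restrict V).map f) := by
  have hae : AEMeasurable f (μ.restrict V) :=
    (g.continuousOn.mono hVR).aemeasurable hV.measurableSet
  have hmap : ∀ S, MeasurableSet S → (μ.restrict V).map f S = μ (V ∩ f ⁻¹' S) := by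
    intro S hS
    rw [Measure.map_apply_of_aemeasurable hae hS, Measure.restrict_apply' hV.measurableSet,
      inter_comm]
  have hfinite : IsFiniteMeasure ((μ.restrict V).map f) := by
    refine ⟨?_⟩
    rw [hmap _ MeasurableSet.univ]
    exact (measure_mono (inter_subset_left.trans hVR)).trans_lt (lt_top_iff_ne_top.2 hfin)
  refine ⟨inferInstance, fun a c ha => ?_, ?_⟩
  · have hS : IsClosed {y : Fin n → K | ∑ i, a i * y i = c} :=
      isClosed_eq (by fun_prop) continuous_const
    rw [hmap _ hS.measurableSet, inter_comm]
    exact measure_mono_null (inter_subset_inter_right _ hVR) (g.measure_hyperplane hfin ha c)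
  · change (μ.restrict V).map f (friendlyPoints ((μ.restrict V).map f))ᶜ = 0
    rw [hmap _ (isOpen_friendlyPoints _).measurableSet.compl]
    convert measure_empty (μ := μ)
    rw [eq_empty_iff_forall_notMem]
    rintro x ⟨hx, hxn⟩
    refine hxn ?_
    obtain ⟨ρ, hρ, hρV⟩ := Metric.isOpen_iff.1 hV x hx
    have hκ := g.κ_pos
    refine LocalImage.exists_federerOn_decayingOn hn (g := g) (x₁ := x) (ρ := ρ)
      (σ₀ := g.κ * (ρ / 2)) ⟨by positivity, hρV.trans hVR, ?_, fun S hS hSσ => ?_⟩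
    · rw [mul_div_cancel_left₀ _ hκ.ne']
      linarith
    · rw [hmap S hS]
      congr 1
      refine Subset.antisymm ?_ (inter_subset_inter_left _ hρV)
      rintro z ⟨hzV, hzS⟩
      refine ⟨?_, hzS⟩
      have h1 := g.lower x (hVR hx) z (hVR hzV)
      have h2 : dist (f z) (f x) < g.κ * (ρ / 2) := hSσ hzS
      have h3 := lt_of_mul_lt_mul_left (h1.trans_lt h2) hκ.le
      rw [Metric.mem_ball]
      linarith

/-- At almost every point of `U` there is a chart. -/
theorem ae_exists_goodChart [CharZero K] {l : ℕ} {f : (Fin d → K) → Fin n → K} (hn : 0 < n)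
    {U : Set (Fin d → K)} (hU : IsOpen U)
    (hf : ∀ p ∈ U, ∃ R > 0, ∃ M ≥ 0, Metric.ball p R ⊆ U ∧
      ∀ j, HasTaylorApprox l (fun x => f x j) (Metric.ball p R) M)
    {μ : Measure (Fin d → K)} (hμU : μ Uᶜ = 0) (hμfin : ∀ x ∈ U, ∃ W ∈ 𝓝 x, μ W < ∞)
    (hdecay : IsAbsolutelyDecaying μ) (hfed : IsFederer μ)
    (hns : ∀ᵐ x ∂μ, NonsingularAt f x) (hnd : ∀ᵐ x ∂μ, NondegenerateAt l f x) :
    ∀ᵐ p ∂μ, ∃ R : ℝ, Metric.ball p R ⊆ U ∧ μ (Metric.ball p R) ≠ ∞ ∧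
      Nonempty (GoodChart μ f p R) := by
  have hUae : ∀ᵐ x ∂μ, x ∈ U := hμU
  filter_upwards [hUae, hdecay, hfed, hns, hnd]
  rintro p hp ⟨W₁, hW₁, hp₁, C, α, hC, hα, hdec⟩ ⟨W₂, hW₂, hp₂, A, -, hfedp⟩ hnsp hndp
  obtain ⟨W₃, hW₃, hfin⟩ := hμfin p hp
  obtain ⟨R, hR, M, hM, -, hT⟩ := hf p hp
  obtain ⟨R₁, hR₁, -, M₁, hM₁, D, hD, hD0⟩ := exists_jets_of_hasTaylorApprox hR hM hT
  have hW : U ∩ W₁ ∩ W₂ ∩ W₃ ∈ 𝓝 p :=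
    inter_mem (inter_mem (inter_mem (hU.mem_nhds hp) (hW₁.mem_nhds hp₁)) (hW₂.mem_nhds hp₂)) hW₃
  obtain ⟨R', -, hR'W, g⟩ := exists_goodChart hn hR₁ hM₁ hD hD0 hnsp hndp hW
    (hfedp.mono fun x hx => hx.1.2) hC hα (hdec.mono fun x hx => hx.1.1.2)
  exact ⟨R', fun x hx => (hR'W hx).1.1.1,
    ((measure_mono fun x hx => (hR'W hx).2).trans_lt hfin).ne, g⟩

/-- Friendliness at `f p` concerns the whole image measure near `f p`. The hypothesis `hinj`
excludes contributions from outside the chart at `p`, so there the measure is the image of the chart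
alone. -/
theorem isFriendly_map_of_ae_exists_goodChart {f : (Fin d → K) → Fin n → K} (hn : 0 < n)
    {U : Set (Fin d → K)} (hU : IsOpen U) (hf : ContinuousOn f U) {μ : Measure (Fin d → K)}
    (hμU : μ Uᶜ = 0)
    (hchart : ∀ᵐ p ∂μ, ∃ R : ℝ, Metric.ball p R ⊆ U ∧ μ (Metric.ball p R) ≠ ∞ ∧
      Nonempty (GoodChart μ f p R))
    (hinj : ∀ᵐ x ∂μ, ∀ V ∈ 𝓝 x, ∃ W ∈ 𝓝 (f x), U ∩ f ⁻¹' W ⊆ V)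
    (hfin : IsLocallyFiniteMeasure (μ.map f)) : IsFriendly (μ.map f) := by
  have hUae : ∀ᵐ x ∂μ, x ∈ U := hμU
  have hae : AEMeasurable f μ := by
    rw [← Measure.restrict_eq_self_of_ae_mem hUae]
    exact hf.aemeasurable hU.measurableSet
  refine ⟨hfin, fun a c ha => ?_, ?_⟩
  · have hS : IsClosed {y : Fin n → K | ∑ i, a i * y i = c} :=
      isClosed_eq (by fun_prop) continuous_const
    rw [Measure.map_apply_of_aemeasurable hae hS.measurableSet]
    set T := {p | ∃ R : ℝ, Metric.ball p R ⊆ U ∧ μ (Metric.ball p R) ≠ ∞ ∧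
      Nonempty (GoodChart μ f p R)} with hT
    have h1 : μ (f ⁻¹' {y | ∑ i, a i * y i = c} ∩ T) = 0 := by
      refine measure_null_of_locally_null _ ?_
      rintro x ⟨-, R, -, hR, ⟨g⟩⟩
      exact ⟨_, inter_mem_nhdsWithin _ (Metric.ball_mem_nhds x g.R_pos),
        measure_mono_null (inter_subset_inter_left _ inter_subset_left)
          (g.measure_hyperplane hR ha c)⟩
    rwa [measure_inter_conull hchart] at h1
  · change μ.map f (friendlyPoints (μ.map f))ᶜ = 0
    rw [Measure.map_apply_of_aemeasurable hae (isOpen_friendlyPoints _).measurableSet.compl]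
    change ∀ᵐ x ∂μ, f x ∈ friendlyPoints (μ.map f)
    filter_upwards [hchart, hinj]
    rintro p ⟨R, hRU, -, ⟨g⟩⟩ hinjp
    obtain ⟨W, hW, hWR⟩ := hinjp _ (Metric.ball_mem_nhds p g.R_pos)
    obtain ⟨σ, hσ, hσW⟩ := Metric.mem_nhds_iff.1 hW
    have hκ := g.κ_pos
    have hR := g.R_pos
    refine LocalImage.exists_federerOn_decayingOn hn (g := g) (x₁ := p) (ρ := R)
      (σ₀ := min σ (g.κ * (R / 2))) ⟨by positivity, Subset.rfl, ?_, fun S hS hSσ => ?_⟩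
    · rw [div_lt_iff₀ hκ]
      have : min σ (g.κ * (R / 2)) ≤ g.κ * (R / 2) := min_le_right _ _
      nlinarith
    · rw [Measure.map_apply_of_aemeasurable hae hS, ← measure_inter_conull (s := f ⁻¹' S) hUae]
      congr 1
      refine Subset.antisymm ?_ fun z hz => ⟨hz.2, hRU hz.1⟩
      rintro z ⟨hzS, hzU⟩
      refine ⟨hWR ⟨hzU, hσW ?_⟩, hzS⟩
      exact Metric.ball_subset_ball (min_le_left _ _) (hSσ hzS)

theorem isFriendly_map_of_hasTaylorApprox [CharZero K] {l : ℕ} {f : (Fin d → K) → Fin n → K}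
    {U : Set (Fin d → K)} (hU : IsOpen U)
    (hf : ∀ p ∈ U, ∃ R > 0, ∃ M ≥ 0, Metric.ball p R ⊆ U ∧
      ∀ j, HasTaylorApprox l (fun x => f x j) (Metric.ball p R) M)
    {μ : Measure (Fin d → K)} (hμU : μ Uᶜ = 0) (hμfin : ∀ x ∈ U, ∃ W ∈ 𝓝 x, μ W < ∞)
    (hdecay : IsAbsolutelyDecaying μ) (hfed : IsFederer μ)
    (hns : ∀ᵐ x ∂μ, NonsingularAt f x) (hnd : ∀ᵐ x ∂μ, NondegenerateAt l f x) :
    (∀ᵐ x ∂μ, ∃ V : Set (Fin d → K), IsOpen V ∧ x ∈ V ∧ V ⊆ U ∧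
      ∀ V' : Set (Fin d → K), IsOpen V' → V' ⊆ V → IsFriendly ((μ.restrict V').map f)) ∧
    ((∀ᵐ x ∂μ, ∀ V ∈ 𝓝 x, ∃ W ∈ 𝓝 (f x), U ∩ f ⁻¹' W ⊆ V) →
      IsLocallyFiniteMeasure (μ.map f) → IsFriendly (μ.map f)) := by
  have hcont := continuousOn_of_hasTaylorApprox hf
  rcases Nat.eq_zero_or_pos n with rfl | hn
  · refine ⟨?_, fun _ h => isFriendly_of_fin_zero _ h⟩
    have hUae : ∀ᵐ x ∂μ, x ∈ U := hμU
    filter_upwards [hUae] with p hp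
    obtain ⟨W, hW, hWfin⟩ := hμfin p hp
    obtain ⟨V, hVW, hV, hpV⟩ := mem_nhds_iff.1 (inter_mem hW (hU.mem_nhds hp))
    refine ⟨V, hV, hpV, hVW.trans inter_subset_right, fun V' _ hV'V =>
      isFriendly_of_fin_zero _ ?_⟩
    have : IsFiniteMeasure (μ.restrict V') := by
      refine ⟨?_⟩
      rw [Measure.restrict_apply_univ]
      exact (measure_mono (hV'V.trans (hVW.trans inter_subset_left))).trans_lt hWfin
    infer_instance
  · have hchart := ae_exists_goodChart hn hU hf hμU hμfin hdecay hfed hns hnd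
    refine ⟨?_, isFriendly_map_of_ae_exists_goodChart hn hU hcont hμU hchart⟩
    filter_upwards [hchart]
    rintro p ⟨R, hRU, hfin, ⟨g⟩⟩
    exact ⟨Metric.ball p R, Metric.isOpen_ball, Metric.mem_ball_self g.R_pos, hRU,
      fun V' hV' h => g.isFriendly_map_restrict hn hfin hV' h⟩

end Friendly

/-! ### Specialization to the fields `ℚ_ν`. -/

instance instProperSpaceQv : (ν : Place) → ProperSpace (Qv ν)
  | .infinite => inferInstanceAs (ProperSpace ℝ)
  | .prime p hp =>
      haveI : Fact p.Prime := ⟨hp⟩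
      inferInstanceAs (ProperSpace ℚ_[p])

instance instCharZeroQv : (ν : Place) → CharZero (Qv ν)
  | .infinite => inferInstanceAs (CharZero ℝ)
  | .prime p hp =>
      haveI : Fact p.Prime := ⟨hp⟩
      inferInstanceAs (CharZero ℚ_[p])

theorem IsCk.exists_hasTaylorApprox {ν : Place} {d n l : ℕ} {U : Set (Fin d → Qv ν)}
    (hU : IsOpen U) {f : (Fin d → Qv ν) → (Fin n → Qv ν)} (hf : IsCk ν (l + 1) f U)
    {p : Fin d → Qv ν} (hp : p ∈ U) : ∃ R > 0, ∃ M ≥ 0, Metric.ball p R ⊆ U ∧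
      ∀ j, HasTaylorApprox l (fun x => f x j) (Metric.ball p R) M := by
  cases ν with
  | infinite => exact ContDiffOn.exists_hasTaylorApprox (d := d) (n := n) (l := l) hU hf hp
  | prime q hq => exact IsCkDiffQuot.exists_hasTaylorApprox hf hp

/-- `μ` is a measure on `U`, viewed as a Borel measure on `ℚ_ν^d` vanishing off `U` and finite near
each point of `U`. First conclusion: the pushforward is friendly locally on the source. Second
conclusion: it is friendly as a whole, when it is a locally finite measure and distinct parts of
`U` do not pile up in the image (at almost every `x`, points of `U` whose image is close to `f x`
are close to `x`, as is the case when `f` is a homeomorphism of `U` onto `f(U)`). -/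
theorem mainTheorem1 (ν : Place) (d n l : ℕ)
    (U : Set (Fin d → Qv ν)) (hU : IsOpen U)
    (f : (Fin d → Qv ν) → (Fin n → Qv ν)) (hf : IsCk ν (l + 1) f U)
    (μ : Measure (Fin d → Qv ν)) (hμU : μ Uᶜ = 0)
    (hμfin : ∀ x ∈ U, ∃ W ∈ 𝓝 x, μ W < ∞)
    (hdecay : IsAbsolutelyDecaying μ) (hfed : IsFederer μ)
    (hns : ∀ᵐ x ∂μ, NonsingularAt f x)
    (hnd : ∀ᵐ x ∂μ, NondegenerateAt l f x) :
    (∀ᵐ x ∂μ, ∃ V : Set (Fin d → Qv ν), IsOpen V ∧ x ∈ V ∧ V ⊆ U ∧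
      ∀ V' : Set (Fin d → Qv ν), IsOpen V' → V' ⊆ V →
        IsFriendly ((μ.restrict V').map f)) ∧
    ((∀ᵐ x ∂μ, ∀ V ∈ 𝓝 x, ∃ W ∈ 𝓝 (f x), U ∩ f ⁻¹' W ⊆ V) →
      IsLocallyFiniteMeasure (μ.map f) → IsFriendly (μ.map f)) :=
  isFriendly_map_of_hasTaylorApprox hU (fun _ hp => hf.exists_hasTaylorApprox hU hp) hμU hμfin
    hdecay hfed hns hnd
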